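/- Let $m\ge 1$, let $M$ be a connected smooth $m$-dimensional manifold, and let $\phi:M\to\mathbb S^{m+1}\subset\mathbb R^{m+2}$ be a smooth immersion into the unit sphere (a hypersurface of $\mathbb S^{m+1}$). Equip $M$ with the induced metric $g$. Let $\nabla$ be the connection induced on $\phi^{-1}T\mathbb S^{m+1}$, let $\Delta=-\operatorname{trace}\nabla^2$ be the rough Laplacian on its sections, and let $R(X,Y)Z=\langle Y,Z\rangle X-\langle X,Z\rangle Y$ be the curvature tensor of $\mathbb S^{m+1}$. The tension field and the bitension field of $\phi$ are $$\tau(\phi)=\operatorname{trace}\nabla d\phi,\qquad \tau_2(\phi)=-\Delta\tau(\phi)-\operatorname{trace}R(d\phi,\tau(\phi))d\phi .$$ Suppose that $M$ is proper biharmonic, that is, $\tau_2(\phi)=0$ on $M$ while $\tau(\phi)$ does not vanish identically, and that at every point of $M$ the shape operator has at most two distinct eigenvalues (principal curvatures). Then one of the following holds: (a) $M$ is an open part of a hypersphere $\mathbb S^m(\tfrac1{\sqrt2})$, i.e. of $\{\,y+\tfrac1{\sqrt2}v : y\perp v,\ |y|=\tfrac1{\sqrt2}\,\}$ for some unit vector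 $v\in\mathbb R^{m+2}$; (b) there are integers $m_1,m_2\ge1$ with $m_1+m_2=m$ and $m_1\ne m_2$ such that $M$ is an open part of a generalized Clifford torus $\mathbb S^{m_1}(\tfrac1{\sqrt2})\times\mathbb S^{m_2}(\tfrac1{\sqrt2})$, i.e. of $\{\,y+z : y\in V,\ z\in V^\perp,\ |y|=|z|=\tfrac1{\sqrt2}\,\}$ for some linear subspace $V\subset\mathbb R^{m+2}$ with $\dim V=m_1+1$ and $\dim V^\perp=m_2+1$. Here "$M$ is an open part of $S$" means that $\phi(M)\subset S$ and that $\phi$ maps open subsets of $M$ to relatively open subsets of $S$; in particular, if $M$ is an embedded submanifold and $\phi$ the inclusion, $M$ is an open subset of $S$. -/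

import Mathlib

open scoped Manifold ContDiff InnerProductSpace

noncomputable section

/-- Euclidean space `ℝⁿ`. -/
abbrev Euc (n : ℕ) : Type := EuclideanSpace ℝ (Fin n)

/-- The unit sphere `𝕊ⁿ ⊆ ℝⁿ⁺¹`, with the manifold structure of Mathlib. -/
abbrev UnitSphere (n : ℕ) : Type := Metric.sphere (0 : Euc (n + 1)) 1

namespace Biharmonic

/-! ### Maps into a unit sphere, in local coordinates

`G` is a Riemannian metric in coordinates `u ∈ ℝᵐ`, `X : ℝᵐ → F` is a map (only used near the point
under consideration) with values in the unit sphere of the Euclidean space `F`, and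
`V : ℝᵐ → F` is a vector field along `X`. -/

section Coordinates

variable {m : ℕ} {F : Type*} [NormedAddCommGroup F] [InnerProductSpace ℝ F]

/-- The partial derivative `∂ᵢ V`. -/
def pd (i : Fin m) (V : Euc m → F) (u : Euc m) : F :=
  fderiv ℝ V u (EuclideanSpace.single i 1)

/-- The metric induced by `X`: `gᵢⱼ = ⟨∂ᵢX, ∂ⱼX⟩`. -/
def inducedMetric (X : Euc m → F) (u : Euc m) : Matrix (Fin m) (Fin m) ℝ :=
  Matrix.of fun i j => ⟪pd i X u, pd j X u⟫_ℝ

/-- The Christoffel symbol `Γᵏᵢⱼ` of the Levi-Civita connection of the metric `G`. -/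
def christoffel (G : Euc m → Matrix (Fin m) (Fin m) ℝ) (k i j : Fin m) (u : Euc m) : ℝ :=
  (1 / 2) * ∑ l, (G u)⁻¹ k l *
    (pd i (fun w => G w j l) u + pd j (fun w => G w i l) u - pd l (fun w => G w i j) u)

/-- The trace `gⁱʲ Tᵢⱼ` with respect to `G`. -/
def metricTrace (G : Euc m → Matrix (Fin m) (Fin m) ℝ) (u : Euc m) (T : Fin m → Fin m → F) : F :=
  ∑ i, ∑ j, (G u)⁻¹ i j • T i j

/-- The connection of the pull-back `X⁻¹T𝕊` of the tangent bundle of the unit sphere: `∇ᵢV` is the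
orthogonal projection of `∂ᵢV` to the tangent space `X(u)^⊥` of the sphere at `X(u)`. -/
def nabla (X : Euc m → F) (i : Fin m) (V : Euc m → F) (u : Euc m) : F :=
  pd i V u - ⟪X u, pd i V u⟫_ℝ • X u

/-- The tension field `τ(X) = trace ∇dX = gⁱʲ (∇ᵢ∂ⱼX - Γᵏᵢⱼ ∂ₖX)`. -/
def tension (G : Euc m → Matrix (Fin m) (Fin m) ℝ) (X : Euc m → F) (u : Euc m) : F :=
  metricTrace G u fun i j =>
    nabla X i (pd j X) u - ∑ k, christoffel G k i j u • pd k X u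

/-- The rough Laplacian (with the sign that makes it a non-negative operator)
`ΔV = - gⁱʲ (∇ᵢ∇ⱼV - Γᵏᵢⱼ ∇ₖV)` on sections of `X⁻¹T𝕊`. -/
def roughLaplacian (G : Euc m → Matrix (Fin m) (Fin m) ℝ) (X V : Euc m → F) (u : Euc m) : F :=
  -metricTrace G u fun i j =>
    nabla X i (nabla X j V) u - ∑ k, christoffel G k i j u • nabla X k V u

/-- The curvature tensor `R(Y, Z)W = ⟨Z, W⟩Y - ⟨Y, W⟩Z` of the unit sphere. -/
def sphereCurvature (Y Z W : F) : F :=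
  ⟪Z, W⟫_ℝ • Y - ⟪Y, W⟫_ℝ • Z

/-- The bitension field `τ₂(X) = -Δτ(X) - trace R(dX, τ(X))dX`. -/
def bitension (G : Euc m → Matrix (Fin m) (Fin m) ℝ) (X : Euc m → F) (u : Euc m) : F :=
  -roughLaplacian G X (tension G X) u -
    metricTrace G u fun i j => sphereCurvature (pd i X u) (tension G X u) (pd j X u)

/-- `η` is a unit normal at `u` of the hypersurface `X` of the unit sphere: it is tangent to the
sphere at `X(u)` and orthogonal to the hypersurface. -/
def IsUnitNormal (X : Euc m → F) (u : Euc m) (η : F) : Prop :=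
  ‖η‖ = 1 ∧ ⟪X u, η⟫_ℝ = 0 ∧ ∀ i, ⟪pd i X u, η⟫_ℝ = 0

/-- The second fundamental form `hᵢⱼ = ⟨∇ᵢ∂ⱼX, η⟩` with respect to the unit normal `η`. -/
def secondFundamentalForm (X : Euc m → F) (u : Euc m) (η : F) : Matrix (Fin m) (Fin m) ℝ :=
  Matrix.of fun i j => ⟪nabla X i (pd j X) u, η⟫_ℝ

/-- The matrix `gⁱᵏ hₖⱼ` of the shape operator with respect to the unit normal `η`. -/
def shapeOperator (X : Euc m → F) (u : Euc m) (η : F) : Matrix (Fin m) (Fin m) ℝ :=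
  (inducedMetric X u)⁻¹ * secondFundamentalForm X u η

/-- The set of principal curvatures with respect to the unit normal `η`: the eigenvalues of the
shape operator. -/
def principalCurvatures (X : Euc m → F) (u : Euc m) (η : F) : Set ℝ :=
  {k | Module.End.HasEigenvalue (Matrix.toLin' (shapeOperator X u η)) k}

end Coordinates

/-! ### Immersed hypersurfaces of the unit sphere -/

section Hypersurfaces

variable {m : ℕ} {M : Type*} [TopologicalSpace M] [ChartedSpace (Euc m) M]

/-- A smooth immersion of the `m`-dimensional manifold `M` in `𝕊ᵐ⁺¹`. -/
def IsImmersedHypersurface (φ : M → UnitSphere (m + 1)) : Prop :=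
  ContMDiff (𝓡 m) (𝓡 (m + 1)) ∞ φ ∧
    ∀ p, Function.Injective (mfderiv (𝓡 m) (𝓡 (m + 1)) φ p)

/-- The expression of `φ` in the chart `e` of `M`, as a map to the ambient `ℝᵐ⁺²`. -/
def localRep (φ : M → UnitSphere (m + 1)) (e : OpenPartialHomeomorph M (Euc m)) :
    Euc m → Euc (m + 2) :=
  fun u => (φ (e.symm u) : Euc (m + 2))

/-- The tension field of `φ : (M, g) → 𝕊ᵐ⁺¹`, `g` the induced metric, vanishes identically. -/
def IsHarmonic (φ : M → UnitSphere (m + 1)) : Prop :=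
  ∀ e ∈ IsManifold.maximalAtlas (𝓡 m) ∞ M, ∀ u ∈ e.target,
    tension (inducedMetric (localRep φ e)) (localRep φ e) u = 0

/-- The bitension field of `φ : (M, g) → 𝕊ᵐ⁺¹`, `g` the induced metric, vanishes identically. -/
def IsBiharmonic (φ : M → UnitSphere (m + 1)) : Prop :=
  ∀ e ∈ IsManifold.maximalAtlas (𝓡 m) ∞ M, ∀ u ∈ e.target,
    bitension (inducedMetric (localRep φ e)) (localRep φ e) u = 0

/-- Proper biharmonic: biharmonic and not harmonic. -/
def IsProperBiharmonic (φ : M → UnitSphere (m + 1)) : Prop :=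
  IsBiharmonic φ ∧ ¬ IsHarmonic φ

/-- At each point there are at most two distinct principal curvatures. -/
def AtMostTwoPrincipalCurvatures (φ : M → UnitSphere (m + 1)) : Prop :=
  ∀ e ∈ IsManifold.maximalAtlas (𝓡 m) ∞ M, ∀ u ∈ e.target, ∀ η : Euc (m + 2),
    IsUnitNormal (localRep φ e) u η →
      (principalCurvatures (localRep φ e) u η).encard ≤ 2

/-- `M` is, through `φ`, an open part of `S`: `φ` takes values in `S`, and it maps open subsets of
`M` to relatively open subsets of `S`. -/
def IsOpenPartOf (φ : M → UnitSphere (m + 1)) (S : Set (Euc (m + 2))) : Prop :=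
  (∀ p, (φ p : Euc (m + 2)) ∈ S) ∧
    ∀ W : Set M, IsOpen W →
      ∃ O : Set (Euc (m + 2)), IsOpen O ∧ (fun p => (φ p : Euc (m + 2))) '' W = O ∩ S

end Hypersurfaces

/-! ### The model hypersurfaces -/

/-- The hypersphere `𝕊ᵐ(1/√2)` of `𝕊ᵐ⁺¹` with (Euclidean) center `v/√2`, where `v` is a unit
vector: the sphere of radius `1/√2` in the affine hyperplane through `v/√2` orthogonal to `v`. -/
def smallHypersphere {n : ℕ} (v : Euc n) : Set (Euc n) :=
  {x | ∃ y : Euc n, ⟪v, y⟫_ℝ = 0 ∧ ‖y‖ = 1 / √2 ∧ x = y + (1 / √2) • v}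

/-- The product of the spheres of radius `1/√2` of the orthogonal subspaces `V` and `V^⊥`. -/
def cliffordTorus {n : ℕ} (V : Submodule ℝ (Euc n)) : Set (Euc n) :=
  {x | ∃ y ∈ V, ∃ z ∈ Vᗮ, ‖y‖ = 1 / √2 ∧ ‖z‖ = 1 / √2 ∧ x = y + z}

end Biharmonic

end

open scoped Manifold ContDiff InnerProductSpace

noncomputable section

/-! Let A be the shape operator for a local unit normal N and f = tr A, so that τ = f N. The normal
and tangential components of τ₂ = 0 are div grad f = (|A|² - m) f and A(grad f) = -(f/2) grad f
(`laplacian_meanC`, `shape_gradV`). The rest follows from these two equations and from the Codazzi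
and Gauss equations.

The function f is locally constant (`dirD_meanC_eq_zero`). Otherwise f and grad f have no zeros on
some ball. There -f/2 is one principal curvature and the other is c f with c constant, because
integer multiplicities leave finitely many values for c. Codazzi forces the eigenspace of -f/2 to be
the line of grad f (`shape_eq_of_quadratic`), so A is c f Id plus a rank-one term. Commuting
derivatives of N determines the Hessian of f in terms of f and w = |grad f|² (`dirD_gradC`). The
normal equation and a Gauss equation for grad f are then incompatible relations between f and w
(`false_of_mean_curvature_system`).

Hence |τ| is a constant c > 0 on M, and the normal equation gives |A|² = m. If c = m, equality in
Cauchy–Schwarz makes A = ±Id; then φ + τ/m is a constant vector, and φ lies in a small hypersphere.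
If c ≠ m, there are two distinct principal curvatures a, b, which are constant. Codazzi makes the
second fundamental form parallel (`codForm_eq_zero`), Gauss gives ab = -1 (`mul_eq_neg_one`), and
|A|² = m gives a + b = 0, so A² = Id. The linear map exchanging X and N and sending dX to dN is then
a symmetric involution that does not depend on the point (`dirD_reflect`). Its eigenspaces are the
factors of the Clifford torus, and its trace, nonzero up to sign equal to c, makes their dimensions
different.

Openness in the model is proved in both cases by displacing φ in its normal plane, which is a
submersion onto the ambient space (`isOpenPartOf_of_normal`). -/

namespace Biharmonic

/-! ### Directional derivatives -/

section Calculus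

variable {E F : Type*} [NormedAddCommGroup E] [NormedSpace ℝ E]
  [NormedAddCommGroup F] [InnerProductSpace ℝ F]

/-- The derivative of `V` in the direction of the fixed vector `v`. -/
def dirD (v : E) (V : E → F) (u : E) : F := fderiv ℝ V u v

theorem pd_eq_dirD {m : ℕ} (i : Fin m) (V : Euc m → F) :
    pd i V = dirD (EuclideanSpace.single i 1) V := rfl

variable {V W : E → F} {c : E → ℝ} {u a b : E}

theorem _root_.ContDiffAt.diffAt (h : ContDiffAt ℝ ∞ V u) : DifferentiableAt ℝ V u :=
  h.differentiableAt (by simp)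

theorem _root_.ContDiffAt.dirD (h : ContDiffAt ℝ ∞ V u) (a : E) : ContDiffAt ℝ ∞ (dirD a V) u :=
  (h.fderiv_right (m := ∞) (by simp)).clm_apply contDiffAt_const

theorem dirD_add_dir (a b : E) (V : E → F) (u : E) :
    dirD (a + b) V u = dirD a V u + dirD b V u := map_add _ _ _

theorem dirD_smul_dir (r : ℝ) (a : E) (V : E → F) (u : E) :
    dirD (r • a) V u = r • dirD a V u := map_smul _ _ _

theorem dirD_sub_dir (a b : E) (V : E → F) (u : E) :
    dirD (a - b) V u = dirD a V u - dirD b V u := map_sub _ _ _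

theorem dirD_zero_dir (V : E → F) (u : E) : dirD 0 V u = 0 := map_zero _

theorem dirD_add (hV : ContDiffAt ℝ ∞ V u) (hW : ContDiffAt ℝ ∞ W u) (a : E) :
    dirD a (fun x => V x + W x) u = dirD a V u + dirD a W u := by
  simp only [dirD]
  rw [fderiv_fun_add hV.diffAt hW.diffAt]; rfl

theorem dirD_sub (hV : ContDiffAt ℝ ∞ V u) (hW : ContDiffAt ℝ ∞ W u) (a : E) :
    dirD a (fun x => V x - W x) u = dirD a V u - dirD a W u := by
  simp only [dirD]
  rw [fderiv_fun_sub hV.diffAt hW.diffAt]; rfl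

theorem dirD_neg (V : E → F) (u a : E) : dirD a (fun x => - V x) u = - dirD a V u := by
  simp only [dirD]
  rw [fderiv_fun_neg]; rfl

theorem dirD_const (y : F) (u a : E) : dirD a (fun _ => y) u = 0 := by
  simp [dirD]

theorem dirD_smul (hc : ContDiffAt ℝ ∞ c u) (hV : ContDiffAt ℝ ∞ V u) (a : E) :
    dirD a (fun x => c x • V x) u = dirD a c u • V u + c u • dirD a V u := by
  simp only [dirD]
  rw [fderiv_fun_smul hc.diffAt hV.diffAt]
  simp [add_comm]

theorem dirD_mul {c d : E → ℝ} (hc : ContDiffAt ℝ ∞ c u) (hd : ContDiffAt ℝ ∞ d u) (a : E) :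
    dirD a (fun x => c x * d x) u = dirD a c u * d u + c u * dirD a d u :=
  dirD_smul hc hd a

theorem dirD_const_smul (r : ℝ) (hV : ContDiffAt ℝ ∞ V u) (a : E) :
    dirD a (fun x => r • V x) u = r • dirD a V u := by
  rw [dirD_smul contDiffAt_const hV, dirD_const]; simp

theorem dirD_const_mul (r : ℝ) (hc : ContDiffAt ℝ ∞ c u) (a : E) :
    dirD a (fun x => r * c x) u = r * dirD a c u :=
  dirD_const_smul r hc a

theorem dirD_inner (hV : ContDiffAt ℝ ∞ V u) (hW : ContDiffAt ℝ ∞ W u) (a : E) :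
    dirD a (fun x => ⟪V x, W x⟫_ℝ) u = ⟪dirD a V u, W u⟫_ℝ + ⟪V u, dirD a W u⟫_ℝ := by
  simp only [dirD]
  rw [fderiv_inner_apply ℝ hV.diffAt hW.diffAt, add_comm]

theorem dirD_sum {ι : Type*} (s : Finset ι) {V : ι → E → F}
    (hV : ∀ i ∈ s, ContDiffAt ℝ ∞ (V i) u) (a : E) :
    dirD a (fun x => ∑ i ∈ s, V i x) u = ∑ i ∈ s, dirD a (V i) u := by
  simp only [dirD]
  rw [fderiv_fun_sum fun i hi => (hV i hi).diffAt]; simp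

theorem dirD_div {c d : E → ℝ} (hc : ContDiffAt ℝ ∞ c u) (hd : ContDiffAt ℝ ∞ d u)
    (h0 : d u ≠ 0) (a : E) :
    dirD a (fun x => c x / d x) u = (dirD a c u * d u - c u * dirD a d u) / (d u) ^ 2 := by
  have h1 : dirD a (fun x => c x / d x * d x) u = dirD a c u := by
    have : (fun x => c x / d x * d x) =ᶠ[nhds u] c := by
      filter_upwards [hd.continuousAt.eventually_ne h0] with x hx
      field_simp
    simp only [dirD]
    rw [this.fderiv_eq]
  rw [dirD_mul (c := fun x => c x / d x) (hc.div hd h0) hd] at h1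
  field_simp at h1 ⊢
  linarith

theorem dirD_congr {U : Set E} (hU : IsOpen U) (hu : u ∈ U) (h : ∀ x ∈ U, V x = W x) (a : E) :
    dirD a V u = dirD a W u := by
  have : V =ᶠ[nhds u] W := Filter.eventually_of_mem (hU.mem_nhds hu) h
  simp only [dirD]
  rw [this.fderiv_eq]

theorem dirD_eq_zero_of_const {U : Set E} (hU : IsOpen U) (hu : u ∈ U) {y : F}
    (h : ∀ x ∈ U, V x = y) (a : E) : dirD a V u = 0 := by
  rw [dirD_congr hU hu (W := fun _ => y) h, dirD_const]

/-- The ambient space being flat, the Codazzi and Gauss equations used below are instances of this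
symmetry, applied to `X`, `N`, the gradient of the mean curvature, or `N + aX`. -/
theorem dirD_comm (h : ContDiffAt ℝ ∞ V u) (a b : E) :
    dirD a (dirD b V) u = dirD b (dirD a V) u := by
  have hs : IsSymmSndFDerivAt ℝ V u := h.isSymmSndFDerivAt (by simp; exact WithTop.coe_le_coe.2 le_top)
  have hd : DifferentiableAt ℝ (fderiv ℝ V) u :=
    (h.fderiv_right (m := ∞) (by simp)).differentiableAt (by simp)
  have key : ∀ a b : E, dirD a (dirD b V) u = fderiv ℝ (fderiv ℝ V) u a b := by
    intro a b
    have h1 : dirD b V = fun x => fderiv ℝ V x b := rfl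
    rw [h1]
    simp only [dirD]
    rw [fderiv_clm_apply hd (differentiableAt_const b)]
    simp
  rw [key, key]
  exact hs a b

theorem dirD_eq_sum {m : ℕ} (V : Euc m → F) (u v : Euc m) :
    dirD v V u = ∑ i, v i • pd i V u := by
  have hv : v = ∑ i, v i • EuclideanSpace.single i (1 : ℝ) := by
    have := (EuclideanSpace.basisFun (Fin m) ℝ).sum_repr v
    simpa using this.symm
  conv_lhs => rw [hv]
  simp only [dirD, map_sum, map_smul]
  rfl

end Calculus

/-! ### Smoothness of the inverse of a matrix -/

section MatrixInverse

variable {E : Type*} [NormedAddCommGroup E] [NormedSpace ℝ E] {m : ℕ}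

theorem contDiffAt_det {G : E → Matrix (Fin m) (Fin m) ℝ} {u : E}
    (h : ∀ i j, ContDiffAt ℝ ∞ (fun x => G x i j) u) :
    ContDiffAt ℝ ∞ (fun x => (G x).det) u := by
  simp only [Matrix.det_apply']
  exact ContDiffAt.sum fun σ _ => contDiffAt_const.mul (contDiffAt_prod fun i _ => h _ _)

theorem contDiffAt_inv_apply {G : E → Matrix (Fin m) (Fin m) ℝ} {u : E}
    (h : ∀ i j, ContDiffAt ℝ ∞ (fun x => G x i j) u) (h0 : (G u).det ≠ 0) (i j : Fin m) :
    ContDiffAt ℝ ∞ (fun x => (G x)⁻¹ i j) u := by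
  simp only [Matrix.inv_def, Matrix.smul_apply, Matrix.adjugate_apply, Ring.inverse_eq_inv']
  refine ((contDiffAt_det h).inv h0).smul (contDiffAt_det fun k l => ?_)
  simp only [Matrix.updateRow_apply]
  split_ifs
  · exact contDiffAt_const
  · exact h _ _

end MatrixInverse

/-! ### Oriented patches of hypersurfaces of the sphere -/

section Patches

variable {m : ℕ} {F : Type*} [NormedAddCommGroup F] [InnerProductSpace ℝ F]

/-- An immersed patch `X : U → F` of a hypersurface of the unit sphere of the
`(m + 2)`-dimensional Euclidean space `F`, with a smooth unit normal `N`. -/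
structure Patch (X N : Euc m → F) (U : Set (Euc m)) : Prop where
  finrank_eq : Module.finrank ℝ F = m + 2
  isOpen : IsOpen U
  smoothX : ∀ u ∈ U, ContDiffAt ℝ ∞ X u
  smoothN : ∀ u ∈ U, ContDiffAt ℝ ∞ N u
  inj : ∀ u ∈ U, Function.Injective (fderiv ℝ X u)
  XX : ∀ u ∈ U, ⟪X u, X u⟫_ℝ = 1
  NN : ∀ u ∈ U, ⟪N u, N u⟫_ℝ = 1
  XN : ∀ u ∈ U, ⟪X u, N u⟫_ℝ = 0
  DXN : ∀ u ∈ U, ∀ v, ⟪dirD v X u, N u⟫_ℝ = 0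

/-- The frame `Xⁱ = gⁱʲ ∂ⱼX` dual to the coordinate frame. -/
def dualFrame (X : Euc m → F) (i : Fin m) (u : Euc m) : F :=
  ∑ j, (inducedMetric X u)⁻¹ i j • pd j X u

/-- The shape operator as an endomorphism of the coordinate space. -/
def shape (X N : Euc m → F) (u : Euc m) : Euc m →ₗ[ℝ] Euc m :=
  Matrix.toEuclideanLin (shapeOperator X u (N u))

/-- The trace of the shape operator, expressed by the dual frame. -/
def meanC (X N : Euc m → F) (u : Euc m) : ℝ :=
  -∑ i, ⟪dualFrame X i u, pd i N u⟫_ℝ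

/-- The gradient of `meanC`, as a vector field of the ambient space. -/
def gradC (X N : Euc m → F) (u : Euc m) : F :=
  ∑ k, pd k (meanC X N) u • dualFrame X k u

/-- The gradient of `meanC`, as a vector field of the coordinate space. -/
def gradV (X N : Euc m → F) (u : Euc m) : Euc m :=
  ∑ k, ⟪dualFrame X k u, gradC X N u⟫_ℝ • EuclideanSpace.single k 1

theorem linearIndependent_pd {X : Euc m → F} {u : Euc m}
    (h : Function.Injective (fderiv ℝ X u)) : LinearIndependent ℝ fun i => pd i X u := by
  have h1 : LinearIndependent ℝ (EuclideanSpace.basisFun (Fin m) ℝ) :=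
    (EuclideanSpace.basisFun (Fin m) ℝ).orthonormal.linearIndependent
  have h2 := h1.map' (fderiv ℝ X u : Euc m →ₗ[ℝ] F) (LinearMap.ker_eq_bot.2 h)
  have h3 : (fun i => pd i X u)
      = (fderiv ℝ X u : Euc m →ₗ[ℝ] F) ∘ (EuclideanSpace.basisFun (Fin m) ℝ) := by
    funext i
    simp [pd]
  rw [h3]
  exact h2

theorem det_inducedMetric_ne_zero {X : Euc m → F} {u : Euc m}
    (h : Function.Injective (fderiv ℝ X u)) : (inducedMetric X u).det ≠ 0 :=
  (Matrix.posDef_gram_of_linearIndependent (𝕜 := ℝ) (linearIndependent_pd h)).det_pos.ne'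

theorem inducedMetric_isSymm (X : Euc m → F) (u : Euc m) (i j : Fin m) :
    (inducedMetric X u)⁻¹ i j = (inducedMetric X u)⁻¹ j i := by
  have h : (inducedMetric X u).transpose = inducedMetric X u := by
    ext i j
    simp [inducedMetric, real_inner_comm]
  have h2 : ((inducedMetric X u)⁻¹).transpose = (inducedMetric X u)⁻¹ := by
    rw [Matrix.transpose_nonsing_inv, h]
  exact congrFun (congrFun h2 j) i

theorem inner_dualFrame {X : Euc m → F} {u : Euc m}
    (h : Function.Injective (fderiv ℝ X u)) (i j : Fin m) :
    ⟪dualFrame X i u, pd j X u⟫_ℝ = if i = j then 1 else 0 := by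
  have h1 := congrFun (congrFun (Matrix.nonsing_inv_mul (inducedMetric X u)
    (isUnit_iff_ne_zero.2 (det_inducedMetric_ne_zero h))) i) j
  rw [Matrix.mul_apply, Matrix.one_apply] at h1
  rw [← h1]
  simp [dualFrame, sum_inner, inner_smul_left, inducedMetric]

theorem contDiffAt_inducedMetric {X : Euc m → F} {u : Euc m} (hX : ContDiffAt ℝ ∞ X u)
    (i j : Fin m) : ContDiffAt ℝ ∞ (fun x => inducedMetric X x i j) u :=
  (hX.dirD _).inner ℝ (hX.dirD _)

theorem contDiffAt_dualFrame {X : Euc m → F} {u : Euc m} (hX : ContDiffAt ℝ ∞ X u)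
    (h : Function.Injective (fderiv ℝ X u)) (i : Fin m) :
    ContDiffAt ℝ ∞ (dualFrame X i) u :=
  ContDiffAt.sum fun j _ => (contDiffAt_inv_apply (contDiffAt_inducedMetric hX)
    (det_inducedMetric_ne_zero h) i j).smul (hX.dirD _)

/-- Contraction with gⁱʲ against ∂ⱼX becomes pairing with the dual frame, the form in which the
traces are computed. -/
theorem sum_inducedMetric_inv_inner (X : Euc m → F) (u : Euc m) (P : Fin m → F) :
    ∑ i, ∑ j, (inducedMetric X u)⁻¹ i j * ⟪P i, pd j X u⟫_ℝ
      = ∑ i, ⟪P i, dualFrame X i u⟫_ℝ := by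
  simp [dualFrame, inner_sum, inner_smul_right]

namespace Patch

variable {X N : Euc m → F} {U : Set (Euc m)} (h : Patch X N U) {u : Euc m} (hu : u ∈ U)
include h

theorem mono {U' : Set (Euc m)} (hU' : IsOpen U') (hs : U' ⊆ U) : Patch X N U' :=
  ⟨h.finrank_eq, hU', fun u hu => h.smoothX u (hs hu), fun u hu => h.smoothN u (hs hu),
    fun u hu => h.inj u (hs hu), fun u hu => h.XX u (hs hu), fun u hu => h.NN u (hs hu),
    fun u hu => h.XN u (hs hu), fun u hu => h.DXN u (hs hu)⟩

theorem finiteDimensional : FiniteDimensional ℝ F :=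
  Module.finite_of_finrank_pos (by rw [h.finrank_eq]; omega)

include hu

theorem inner_X_DX (v : Euc m) : ⟪X u, dirD v X u⟫_ℝ = 0 := by
  have h1 := dirD_eq_zero_of_const h.isOpen hu h.XX v
  rw [dirD_inner (h.smoothX u hu) (h.smoothX u hu), real_inner_comm] at h1
  linarith

theorem inner_N_DN (v : Euc m) : ⟪N u, dirD v N u⟫_ℝ = 0 := by
  have h1 := dirD_eq_zero_of_const h.isOpen hu h.NN v
  rw [dirD_inner (h.smoothN u hu) (h.smoothN u hu), real_inner_comm] at h1
  linarith

theorem inner_N_DX (v : Euc m) : ⟪N u, dirD v X u⟫_ℝ = 0 := by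
  rw [real_inner_comm, h.DXN u hu]

theorem inner_X_DN (v : Euc m) : ⟪X u, dirD v N u⟫_ℝ = 0 := by
  have h1 := dirD_eq_zero_of_const h.isOpen hu h.XN v
  rw [dirD_inner (h.smoothX u hu) (h.smoothN u hu), h.DXN u hu] at h1
  linarith

theorem inner_N_DDX (v w : Euc m) :
    ⟪N u, dirD v (dirD w X) u⟫_ℝ = -⟪dirD v N u, dirD w X u⟫_ℝ := by
  have h1 := dirD_eq_zero_of_const h.isOpen hu (fun x hx => h.inner_N_DX hx w) v
  rw [dirD_inner (h.smoothN u hu) ((h.smoothX u hu).dirD w)] at h1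
  linarith

theorem inner_X_DDX (v w : Euc m) :
    ⟪X u, dirD v (dirD w X) u⟫_ℝ = -⟪dirD v X u, dirD w X u⟫_ℝ := by
  have h1 := dirD_eq_zero_of_const h.isOpen hu (fun x hx => h.inner_X_DX hx w) v
  rw [dirD_inner (h.smoothX u hu) ((h.smoothX u hu).dirD w)] at h1
  linarith

theorem inner_N_DDN (v w : Euc m) :
    ⟪N u, dirD v (dirD w N) u⟫_ℝ = -⟪dirD v N u, dirD w N u⟫_ℝ := by
  have h1 := dirD_eq_zero_of_const h.isOpen hu (fun x hx => h.inner_N_DN hx w) v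
  rw [dirD_inner (h.smoothN u hu) ((h.smoothN u hu).dirD w)] at h1
  linarith

theorem inner_X_DDN (v w : Euc m) :
    ⟪X u, dirD v (dirD w N) u⟫_ℝ = -⟪dirD v X u, dirD w N u⟫_ℝ := by
  have h1 := dirD_eq_zero_of_const h.isOpen hu (fun x hx => h.inner_X_DN hx w) v
  rw [dirD_inner (h.smoothX u hu) ((h.smoothN u hu).dirD w)] at h1
  linarith

theorem inner_DN_DX_comm (v w : Euc m) :
    ⟪dirD v N u, dirD w X u⟫_ℝ = ⟪dirD w N u, dirD v X u⟫_ℝ := by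
  have h1 := h.inner_N_DDX hu v w
  have h2 := h.inner_N_DDX hu w v
  rw [dirD_comm (h.smoothX u hu)] at h1
  linarith

/-- The Codazzi equation. -/
theorem codazzi (a v w : Euc m) :
    ⟪dirD a (dirD v N) u, dirD w X u⟫_ℝ - ⟪dirD a (dirD v X) u, dirD w N u⟫_ℝ
      = ⟪dirD a (dirD w N) u, dirD v X u⟫_ℝ - ⟪dirD a (dirD w X) u, dirD v N u⟫_ℝ := by
  have h1 := dirD_congr h.isOpen hu (fun x hx => h.inner_DN_DX_comm hx v w) a
  have hX := h.smoothX u hu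
  have hN := h.smoothN u hu
  rw [dirD_inner (hN.dirD v) (hX.dirD w), dirD_inner (hN.dirD w) (hX.dirD v)] at h1
  rw [real_inner_comm (dirD w N u), real_inner_comm (dirD v N u)]
  linarith

/-- The map (v, s, t) ↦ dX(v) + sN + tX is injective, since pairing with N and X detects s and t and
dX is injective; both dimensions are m + 2. -/
theorem exists_decomp (y : F) :
    ∃ (v : Euc m) (s t : ℝ), y = dirD v X u + s • N u + t • X u := by
  have := h.finiteDimensional
  let Φ : Euc m × ℝ × ℝ →ₗ[ℝ] F :=
    (fderiv ℝ X u : Euc m →ₗ[ℝ] F).coprod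
      ((LinearMap.toSpanSingleton ℝ F (N u)).coprod (LinearMap.toSpanSingleton ℝ F (X u)))
  have hΦ : ∀ v s t, Φ (v, s, t) = dirD v X u + (s • N u + t • X u) := fun v s t => rfl
  have hinj : Function.Injective Φ := by
    rw [← LinearMap.ker_eq_bot, LinearMap.ker_eq_bot']
    rintro ⟨v, s, t⟩ h0
    rw [hΦ] at h0
    have e1 := congrArg (fun y => ⟪N u, y⟫_ℝ) h0
    have e2 := congrArg (fun y => ⟪X u, y⟫_ℝ) h0
    simp only [inner_add_right, inner_smul_right, h.inner_N_DX hu, h.inner_X_DX hu, h.NN u hu,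
      h.XX u hu, h.XN u hu, real_inner_comm (X u) (N u), inner_zero_right] at e1 e2
    have hs : s = 0 := by linarith
    have ht : t = 0 := by linarith
    subst hs ht
    have h3 : fderiv ℝ X u v = fderiv ℝ X u 0 := by
      simpa [dirD] using h0
    rw [h.inj u hu h3]
    rfl
  have hsurj : Function.Surjective Φ := by
    refine (LinearMap.injective_iff_surjective_of_finrank_eq_finrank ?_).1 hinj
    simp [h.finrank_eq]
  obtain ⟨⟨v, s, t⟩, hy⟩ := hsurj y
  exact ⟨v, s, t, by rw [← hy, hΦ, add_assoc]⟩

theorem inner_dualFrame_DX (i : Fin m) (v : Euc m) :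
    ⟪dualFrame X i u, dirD v X u⟫_ℝ = v i := by
  rw [dirD_eq_sum, inner_sum]
  simp [inner_smul_right, inner_dualFrame (h.inj u hu)]

theorem inner_dualFrame_N (i : Fin m) : ⟪dualFrame X i u, N u⟫_ℝ = 0 := by
  simp only [dualFrame, sum_inner, inner_smul_left]
  exact Finset.sum_eq_zero fun j _ => by rw [pd_eq_dirD, h.DXN u hu, mul_zero]

theorem inner_dualFrame_X (i : Fin m) : ⟪dualFrame X i u, X u⟫_ℝ = 0 := by
  simp only [dualFrame, sum_inner, inner_smul_left]
  exact Finset.sum_eq_zero fun j _ => by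
    rw [pd_eq_dirD, real_inner_comm, h.inner_X_DX hu, mul_zero]

theorem decomp (y : F) :
    y = ∑ i, ⟪dualFrame X i u, y⟫_ℝ • pd i X u + ⟪N u, y⟫_ℝ • N u + ⟪X u, y⟫_ℝ • X u := by
  obtain ⟨v, s, t, hy⟩ := h.exists_decomp hu y
  have e1 : ⟪N u, y⟫_ℝ = s := by
    rw [hy]
    simp only [inner_add_right, inner_smul_right, h.inner_N_DX hu, h.NN u hu,
      real_inner_comm (X u) (N u), h.XN u hu]
    ring
  have e2 : ⟪X u, y⟫_ℝ = t := by
    rw [hy]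
    simp only [inner_add_right, inner_smul_right, h.inner_X_DX hu, h.XX u hu, h.XN u hu]
    ring
  have e3 : ∀ i, ⟪dualFrame X i u, y⟫_ℝ = v i := by
    intro i
    rw [hy]
    simp only [inner_add_right, inner_smul_right, h.inner_dualFrame_DX hu,
      h.inner_dualFrame_N hu, h.inner_dualFrame_X hu]
    ring
  rw [e1, e2]
  simp only [e3]
  rw [← dirD_eq_sum]
  exact hy

theorem tangent_decomp {y : F} (h1 : ⟪N u, y⟫_ℝ = 0) (h2 : ⟪X u, y⟫_ℝ = 0) :
    y = ∑ i, ⟪dualFrame X i u, y⟫_ℝ • pd i X u := by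
  conv_lhs => rw [h.decomp hu y, h1, h2]
  simp

theorem ext_inner {y z : F} (h1 : ⟪N u, y⟫_ℝ = ⟪N u, z⟫_ℝ) (h2 : ⟪X u, y⟫_ℝ = ⟪X u, z⟫_ℝ)
    (h3 : ∀ v, ⟪dirD v X u, y⟫_ℝ = ⟪dirD v X u, z⟫_ℝ) : y = z := by
  rw [h.decomp hu y, h.decomp hu z, h1, h2]
  congr 3
  funext i
  congr 1
  simp only [dualFrame, sum_inner, inner_smul_left, pd_eq_dirD, h3]

theorem DX_injective {v w : Euc m} (e : dirD v X u = dirD w X u) : v = w := h.inj u hu e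

/-- In the Koszul formula for gᵢⱼ = ⟨∂ᵢX, ∂ⱼX⟩, symmetry of second derivatives leaves only ⟨∂ᵢ∂ⱼX,
∂ₗX⟩. So the Levi-Civita connection is the tangential projection of the ambient derivative. -/
theorem christoffel_eq (k i j : Fin m) :
    christoffel (inducedMetric X) k i j u = ⟪dualFrame X k u, pd i (pd j X) u⟫_ℝ := by
  have hX := h.smoothX u hu
  have key : ∀ a b c : Fin m, pd a (fun w => inducedMetric X w b c) u
      = ⟪pd a (pd b X) u, pd c X u⟫_ℝ + ⟪pd b X u, pd a (pd c X) u⟫_ℝ := fun a b c =>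
    dirD_inner (hX.dirD _) (hX.dirD _) _
  have hc : ∀ a b : Fin m, pd a (pd b X) u = pd b (pd a X) u := fun a b => dirD_comm hX _ _
  rw [christoffel, dualFrame, sum_inner, Finset.mul_sum]
  refine Finset.sum_congr rfl fun l _ => ?_
  rw [inner_smul_left, key, key, key, hc l i, hc l j, hc j i,
    real_inner_comm (pd i (pd l X) u) (pd j X u), real_inner_comm (pd j (pd l X) u) (pd i X u),
    real_inner_comm (pd i (pd j X) u) (pd l X u)]
  simp only [conj_trivial]
  ring

theorem contDiffAt_dual (i : Fin m) : ContDiffAt ℝ ∞ (dualFrame X i) u :=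
  contDiffAt_dualFrame (h.smoothX u hu) (h.inj u hu) i

theorem contDiffAt_meanC : ContDiffAt ℝ ∞ (meanC X N) u :=
  (ContDiffAt.sum fun i _ => (h.contDiffAt_dual hu i).inner ℝ ((h.smoothN u hu).dirD _)).neg

theorem contDiffAt_gradC : ContDiffAt ℝ ∞ (gradC X N) u :=
  ContDiffAt.sum fun i _ => ((h.contDiffAt_meanC hu).dirD _).smul (h.contDiffAt_dual hu i)

theorem shapeOperator_apply (i j : Fin m) :
    shapeOperator X u (N u) i j = -⟪dualFrame X i u, pd j N u⟫_ℝ := by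
  rw [shapeOperator, Matrix.mul_apply, dualFrame, sum_inner, ← Finset.sum_neg_distrib]
  refine Finset.sum_congr rfl fun k _ => ?_
  have e : secondFundamentalForm X u (N u) k j = -⟪pd k X u, pd j N u⟫_ℝ := by
    simp only [secondFundamentalForm, Matrix.of_apply, nabla, inner_sub_left, inner_smul_left,
      h.XN u hu, mul_zero, sub_zero]
    rw [real_inner_comm, pd_eq_dirD, pd_eq_dirD, h.inner_N_DDX hu, h.inner_DN_DX_comm hu,
      real_inner_comm]
    rfl
  rw [e, inner_smul_left]
  simp

theorem shape_apply (v : Euc m) (i : Fin m) :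
    shape X N u v i = -⟪dualFrame X i u, dirD v N u⟫_ℝ := by
  simp only [shape, Matrix.toLpLin_apply, Matrix.mulVec, dotProduct,
    h.shapeOperator_apply hu]
  rw [dirD_eq_sum, inner_sum, ← Finset.sum_neg_distrib]
  refine Finset.sum_congr rfl fun j _ => ?_
  rw [inner_smul_right]; ring

/-- The Weingarten equation, through which later arguments avoid the coordinate matrix of A. -/
theorem DX_shape (v : Euc m) : dirD (shape X N u v) X u = - dirD v N u := by
  rw [dirD_eq_sum, h.tangent_decomp hu (h.inner_N_DN hu v) (h.inner_X_DN hu v)]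
  simp only [h.shape_apply hu, neg_smul, Finset.sum_neg_distrib]

omit h hu in
theorem trace_euc (T : Euc m →ₗ[ℝ] Euc m) :
    LinearMap.trace ℝ (Euc m) T = ∑ i, T (EuclideanSpace.single i 1) i := by
  rw [LinearMap.trace_eq_matrix_trace ℝ (EuclideanSpace.basisFun (Fin m) ℝ).toBasis]
  simp [Matrix.trace, LinearMap.toMatrix_apply]

/-- `P` has to agree with dX ∘ T only after tangential projection: the dual frame is tangent, so
normal components of `P` do not contribute. -/
theorem trace_eq_sum {T : Euc m →ₗ[ℝ] Euc m} {P : Euc m → F}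
    (hP : ∀ v w, ⟪P v, dirD w X u⟫_ℝ = ⟪dirD (T v) X u, dirD w X u⟫_ℝ) :
    LinearMap.trace ℝ (Euc m) T
      = ∑ i, ⟪P (EuclideanSpace.single i 1), dualFrame X i u⟫_ℝ := by
  rw [trace_euc]
  refine Finset.sum_congr rfl fun i _ => ?_
  rw [← h.inner_dualFrame_DX hu i, real_inner_comm, dualFrame, inner_sum, inner_sum]
  refine Finset.sum_congr rfl fun j _ => ?_
  rw [inner_smul_right, inner_smul_right, pd_eq_dirD, hP]

theorem trace_shape : LinearMap.trace ℝ (Euc m) (shape X N u) = meanC X N u := by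
  rw [h.trace_eq_sum hu (P := fun v => - dirD v N u) (fun v w => by rw [h.DX_shape hu]), meanC,
    ← Finset.sum_neg_distrib]
  refine Finset.sum_congr rfl fun i _ => ?_
  rw [inner_neg_left, real_inner_comm]; rfl

theorem trace_shape_sq : LinearMap.trace ℝ (Euc m) (shape X N u * shape X N u)
    = ∑ i, ∑ j, (inducedMetric X u)⁻¹ i j * ⟪pd i N u, pd j N u⟫_ℝ := by
  rw [h.trace_eq_sum hu (P := fun v => - dirD (shape X N u v) N u)
    (fun v w => by rw [Module.End.mul_apply, h.DX_shape hu])]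
  refine Finset.sum_congr rfl fun i _ => ?_
  rw [dualFrame, inner_sum]
  refine Finset.sum_congr rfl fun j _ => ?_
  rw [inner_smul_right, inner_neg_left, pd_eq_dirD, h.inner_DN_DX_comm hu, h.DX_shape hu,
    inner_neg_right, neg_neg, real_inner_comm]
  rfl

/-- The Christoffel terms cancel the tangential part of ∂ᵢ∂ⱼX, and the connection of the sphere
removes the part along X; what remains is hᵢⱼ N. -/
theorem tension_eq : tension (inducedMetric X) X u = meanC X N u • N u := by
  have e : ∀ i j : Fin m, nabla X i (pd j X) u
      - ∑ k, christoffel (inducedMetric X) k i j u • pd k X u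
        = -⟪pd i N u, pd j X u⟫_ℝ • N u := by
    intro i j
    have h1 := h.decomp hu (pd i (pd j X) u)
    have h2 : ⟪N u, pd i (pd j X) u⟫_ℝ = -⟪pd i N u, pd j X u⟫_ℝ := h.inner_N_DDX hu _ _
    rw [h2] at h1
    simp only [h.christoffel_eq hu, nabla]
    rw [sub_sub, sub_eq_iff_eq_add]
    conv_lhs => rw [h1]
    abel
  simp only [tension, metricTrace, e, smul_smul, ← Finset.sum_smul]
  congr 1
  simp only [mul_neg, Finset.sum_neg_distrib, sum_inducedMetric_inv_inner, meanC]
  simp only [real_inner_comm]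

theorem inner_gradC (v : Euc m) : ⟪gradC X N u, dirD v X u⟫_ℝ = dirD v (meanC X N) u := by
  simp only [gradC, sum_inner, inner_smul_left, h.inner_dualFrame_DX hu]
  rw [dirD_eq_sum (meanC X N)]
  simp [mul_comm]

theorem inner_N_gradC : ⟪N u, gradC X N u⟫_ℝ = 0 := by
  simp only [gradC, inner_sum, inner_smul_right]
  exact Finset.sum_eq_zero fun i _ => by
    rw [real_inner_comm, h.inner_dualFrame_N hu, mul_zero]

theorem inner_X_gradC : ⟪X u, gradC X N u⟫_ℝ = 0 := by
  simp only [gradC, inner_sum, inner_smul_right]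
  exact Finset.sum_eq_zero fun i _ => by
    rw [real_inner_comm, h.inner_dualFrame_X hu, mul_zero]

theorem DX_gradV : dirD (gradV X N u) X u = gradC X N u := by
  conv_rhs => rw [h.tangent_decomp hu (h.inner_N_gradC hu) (h.inner_X_gradC hu)]
  simp only [gradV, dirD, map_sum, map_smul]
  rfl

theorem inner_D_gradC (v w : Euc m) : ⟪dirD v (gradC X N) u, dirD w X u⟫_ℝ
    = dirD v (dirD w (meanC X N)) u - ⟪gradC X N u, dirD v (dirD w X) u⟫_ℝ := by
  have h1 := dirD_congr h.isOpen hu (fun x hx => h.inner_gradC hx w) v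
  rw [dirD_inner (h.contDiffAt_gradC hu) ((h.smoothX u hu).dirD w)] at h1
  linarith

/-- Self-adjointness of A lets the free slot of dN absorb the contraction with the inverse metric.
-/
theorem sum_inducedMetric_inv_DN (y : F) (i : Fin m) :
    ∑ j, (inducedMetric X u)⁻¹ i j * ⟪y, pd j N u⟫_ℝ
      = ∑ k, ⟪dualFrame X k u, y⟫_ℝ * ⟪dualFrame X i u, pd k N u⟫_ℝ := by
  have e : ∀ j, ⟪y, pd j N u⟫_ℝ = ∑ k, ⟪dualFrame X k u, y⟫_ℝ * ⟪pd j X u, pd k N u⟫_ℝ := by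
    intro j
    conv_lhs => rw [h.decomp hu y]
    simp only [inner_add_left, sum_inner, inner_smul_left, conj_trivial, pd_eq_dirD,
      h.inner_N_DN hu, h.inner_X_DN hu, mul_zero, add_zero]
    refine Finset.sum_congr rfl fun k _ => ?_
    congr 1
    rw [real_inner_comm, h.inner_DN_DX_comm hu, real_inner_comm]
  simp only [e, Finset.mul_sum]
  rw [Finset.sum_comm]
  refine Finset.sum_congr rfl fun k _ => ?_
  rw [dualFrame.eq_1 X i, sum_inner, Finset.mul_sum]
  refine Finset.sum_congr rfl fun j _ => ?_
  rw [inner_smul_left, conj_trivial]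
  ring

/-- The traced Codazzi equation. -/
theorem trace_codazzi (l : Fin m) :
    ∑ i, ∑ j, (inducedMetric X u)⁻¹ i j *
      (⟪pd i (pd j N) u, pd l X u⟫_ℝ - ⟪pd i (pd j X) u, pd l N u⟫_ℝ)
      = -pd l (meanC X N) u := by
  have hX := h.smoothX u hu
  have hN := h.smoothN u hu
  -- Codazzi and symmetry of second derivatives make ∂ₗ the outer derivative, so that the
  -- contraction becomes the derivative of a trace.
  have hc : ∀ i j : Fin m, ⟪pd i (pd j N) u, pd l X u⟫_ℝ - ⟪pd i (pd j X) u, pd l N u⟫_ℝ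
      = ⟪pd l (pd i N) u, pd j X u⟫_ℝ - ⟪pd l (pd i X) u, pd j N u⟫_ℝ := by
    intro i j
    have h1 := h.codazzi hu (EuclideanSpace.single i 1) (EuclideanSpace.single j 1)
      (EuclideanSpace.single l 1)
    rw [dirD_comm hN _ (EuclideanSpace.single l 1), dirD_comm hX _ (EuclideanSpace.single l 1)]
      at h1
    rw [dirD_comm hN _ (EuclideanSpace.single i 1), dirD_comm hX _ (EuclideanSpace.single i 1)]
      at h1
    exact h1.trans (by
      rw [dirD_comm hN (EuclideanSpace.single i 1), dirD_comm hX (EuclideanSpace.single i 1)]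
      rfl)
  simp only [hc, mul_sub, Finset.sum_sub_distrib, sum_inducedMetric_inv_inner,
    h.sum_inducedMetric_inv_DN hu]
  -- The derivative of the dual frame comes from differentiating its duality relation, without
  -- differentiating the inverse metric.
  have hd : ∀ i k : Fin m, ⟪pd l (dualFrame X i) u, pd k X u⟫_ℝ
      = -⟪dualFrame X i u, pd l (pd k X) u⟫_ℝ := by
    intro i k
    have h1 := dirD_eq_zero_of_const h.isOpen hu
      (fun x hx => inner_dualFrame (h.inj x hx) i k) (EuclideanSpace.single l 1)
    rw [dirD_inner (W := pd k X) (h.contDiffAt_dual hu i) (hX.dirD _)] at h1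
    exact eq_neg_of_add_eq_zero_left h1
  have hf : pd l (meanC X N) u = -∑ i, (⟪pd l (dualFrame X i) u, pd i N u⟫_ℝ
      + ⟪dualFrame X i u, pd l (pd i N) u⟫_ℝ) := by
    have hs : ∀ i : Fin m, ContDiffAt ℝ ∞ (fun x => ⟪dualFrame X i x, pd i N x⟫_ℝ) u :=
      fun i => (h.contDiffAt_dual hu i).inner ℝ (hN.dirD _)
    rw [pd_eq_dirD]
    refine (dirD_neg _ _ _).trans ?_
    rw [dirD_sum _ (fun i _ => hs i)]
    congr 1
    exact Finset.sum_congr rfl fun i _ => dirD_inner (h.contDiffAt_dual hu i) (hN.dirD _) _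
  have hn : ∀ i : Fin m, ⟪pd l (dualFrame X i) u, pd i N u⟫_ℝ
      = -∑ k, ⟪dualFrame X k u, pd i N u⟫_ℝ * ⟪dualFrame X i u, pd l (pd k X) u⟫_ℝ := by
    intro i
    conv_lhs => rw [h.tangent_decomp hu (y := pd i N u) (h.inner_N_DN hu _) (h.inner_X_DN hu _)]
    simp only [inner_sum, inner_smul_right, hd, ← Finset.sum_neg_distrib, mul_neg]
  rw [hf, neg_neg, Finset.sum_add_distrib]
  simp only [hn, Finset.sum_neg_distrib]
  rw [Finset.sum_comm (f := fun i k => ⟪dualFrame X k u, pd i N u⟫_ℝ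
    * ⟪dualFrame X i u, pd l (pd k X) u⟫_ℝ)]
  simp only [mul_comm, real_inner_comm]
  ring

end Patch

/-! ### Normal and tangential components of the bitension field -/

namespace Patch

variable {X N : Euc m → F} {U : Set (Euc m)} (h : Patch X N U) {u : Euc m} (hu : u ∈ U)
include h hu

theorem nabla_tension (j : Fin m) :
    nabla X j (tension (inducedMetric X) X) u
      = pd j (meanC X N) u • N u + meanC X N u • pd j N u := by
  have e : pd j (tension (inducedMetric X) X) u
      = pd j (meanC X N) u • N u + meanC X N u • pd j N u :=
    (dirD_congr h.isOpen hu (fun x hx => h.tension_eq hx) _).trans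
      (dirD_smul (h.contDiffAt_meanC hu) (h.smoothN u hu) _)
  have h0 : ⟪X u, pd j N u⟫_ℝ = 0 := h.inner_X_DN hu _
  rw [nabla, e]
  simp [inner_add_right, inner_smul_right, h.XN u hu, h0]

/-- The multiple of `X` may stay unspecified: it is orthogonal to `N` and to the tangent space, the
only directions against which the bitension field is tested. -/
theorem nabla_nabla_tension (i j : Fin m) : ∃ r : ℝ,
    nabla X i (nabla X j (tension (inducedMetric X) X)) u
      = pd i (pd j (meanC X N)) u • N u + pd j (meanC X N) u • pd i N u
        + (pd i (meanC X N) u • pd j N u + meanC X N u • pd i (pd j N) u) + r • X u := by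
  have hf := h.contDiffAt_meanC hu
  have hN := h.smoothN u hu
  have e : pd i (nabla X j (tension (inducedMetric X) X)) u
      = pd i (pd j (meanC X N)) u • N u + pd j (meanC X N) u • pd i N u
        + (pd i (meanC X N) u • pd j N u + meanC X N u • pd i (pd j N) u) := by
    rw [pd_eq_dirD i (nabla X j (tension (inducedMetric X) X)),
      dirD_congr h.isOpen hu (fun x hx => h.nabla_tension hx j),
      dirD_add (V := fun x => pd j (meanC X N) x • N x) (W := fun x => meanC X N x • pd j N x)
        ((hf.dirD _).smul hN) (hf.smul (hN.dirD _)),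
      dirD_smul (c := pd j (meanC X N)) (hf.dirD _) hN,
      dirD_smul (V := pd j N) hf (hN.dirD _)]
    rfl
  refine ⟨-⟪X u, pd i (nabla X j (tension (inducedMetric X) X)) u⟫_ℝ, ?_⟩
  rw [nabla, ← e]
  module

theorem trace_sphereCurvature :
    (metricTrace (inducedMetric X) u fun i j =>
      sphereCurvature (pd i X u) (tension (inducedMetric X) X u) (pd j X u))
      = -((m : ℝ) * meanC X N u) • N u := by
  have e : ∀ i j : Fin m, sphereCurvature (pd i X u) (tension (inducedMetric X) X u) (pd j X u)
      = -⟪pd i X u, pd j X u⟫_ℝ • (meanC X N u • N u) := by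
    intro i j
    have h0 : ⟪N u, pd j X u⟫_ℝ = 0 := h.inner_N_DX hu _
    rw [sphereCurvature, h.tension_eq hu, inner_smul_left, h0]
    simp
  simp only [metricTrace, e, smul_smul, ← Finset.sum_smul]
  congr 1
  have h1 : ∀ i, ⟪pd i X u, dualFrame X i u⟫_ℝ = 1 := by
    intro i
    rw [real_inner_comm, inner_dualFrame (h.inj u hu), if_pos rfl]
  have h2 := sum_inducedMetric_inv_inner X u (fun i => pd i X u)
  simp only [h1] at h2
  simp only [mul_neg, neg_mul, Finset.sum_neg_distrib, ← mul_assoc, ← Finset.sum_mul]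
  rw [h2]
  simp

/-- The covariant Hessian of f is ⟨∂ᵢ grad f, ∂ⱼX⟩, whose trace is the divergence; ⟨N, ∂ᵢ∂ⱼN⟩ =
-⟨∂ᵢN, ∂ⱼN⟩ contributes -f |A|², and the curvature of the sphere contributes m f. -/
theorem inner_bitension_N :
    ⟪bitension (inducedMetric X) X u, N u⟫_ℝ
      = ∑ i, ⟪pd i (gradC X N) u, dualFrame X i u⟫_ℝ
        - meanC X N u * LinearMap.trace ℝ (Euc m) (shape X N u * shape X N u)
        + m * meanC X N u := by
  have e : ∀ i j : Fin m, ⟪nabla X i (nabla X j (tension (inducedMetric X) X)) u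
      - ∑ k, christoffel (inducedMetric X) k i j u • nabla X k (tension (inducedMetric X) X) u,
      N u⟫_ℝ
      = ⟪pd i (gradC X N) u, pd j X u⟫_ℝ - meanC X N u * ⟪pd i N u, pd j N u⟫_ℝ := by
    intro i j
    obtain ⟨r, hr⟩ := h.nabla_nabla_tension hu i j
    have hDN : ∀ i, ⟪pd i N u, N u⟫_ℝ = 0 := fun i => by
      rw [real_inner_comm]; exact h.inner_N_DN hu _
    have hDDN : ⟪pd i (pd j N) u, N u⟫_ℝ = -⟪pd i N u, pd j N u⟫_ℝ := by
      rw [real_inner_comm]; exact h.inner_N_DDN hu _ _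
    have hG : ⟪pd i (gradC X N) u, pd j X u⟫_ℝ
        = pd i (pd j (meanC X N)) u - ⟪gradC X N u, pd i (pd j X) u⟫_ℝ := h.inner_D_gradC hu _ _
    rw [inner_sub_left, hr, sum_inner, hG]
    simp only [h.nabla_tension hu, inner_add_left, inner_smul_left, hDN, hDDN, h.XN u hu,
      h.NN u hu, conj_trivial, h.christoffel_eq hu]
    have hs : ⟪gradC X N u, pd i (pd j X) u⟫_ℝ
        = ∑ k, ⟪dualFrame X k u, pd i (pd j X) u⟫_ℝ * pd k (meanC X N) u := by
      simp only [gradC, sum_inner, inner_smul_left, conj_trivial]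
      exact Finset.sum_congr rfl fun k _ => mul_comm _ _
    rw [hs]
    simp only [mul_one, mul_zero, add_zero]
    ring
  rw [bitension, inner_sub_left, h.trace_sphereCurvature hu, roughLaplacian, neg_neg, metricTrace]
  simp only [sum_inner, inner_smul_left, conj_trivial, e, mul_sub, Finset.sum_sub_distrib,
    h.NN u hu]
  rw [sum_inducedMetric_inv_inner, h.trace_shape_sq hu, Finset.mul_sum]
  simp only [Finset.mul_sum]
  rw [mul_one, sub_neg_eq_add]
  congr 2
  exact Finset.sum_congr rfl fun i _ => Finset.sum_congr rfl fun j _ => by ring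

/-- The two mixed terms df ⊗ dN have the same contraction ⟨grad f, ∂ₗN⟩, whence the factor 2; by the
traced Codazzi equation the second derivatives of N contribute -f ∂ₗf. -/
theorem inner_bitension_pd (l : Fin m) :
    ⟪bitension (inducedMetric X) X u, pd l X u⟫_ℝ
      = 2 * ⟪gradC X N u, pd l N u⟫_ℝ - meanC X N u * pd l (meanC X N) u := by
  have hcomm : ∀ i, ⟪pd i N u, pd l X u⟫_ℝ = ⟪pd l N u, pd i X u⟫_ℝ :=
    fun i => h.inner_DN_DX_comm hu _ _
  have e : ∀ i j : Fin m, ⟪nabla X i (nabla X j (tension (inducedMetric X) X)) u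
      - ∑ k, christoffel (inducedMetric X) k i j u • nabla X k (tension (inducedMetric X) X) u,
      pd l X u⟫_ℝ
      = pd j (meanC X N) u * ⟪pd l N u, pd i X u⟫_ℝ + pd i (meanC X N) u * ⟪pd l N u, pd j X u⟫_ℝ
        + meanC X N u * (⟪pd i (pd j N) u, pd l X u⟫_ℝ - ⟪pd i (pd j X) u, pd l N u⟫_ℝ) := by
    intro i j
    obtain ⟨r, hr⟩ := h.nabla_nabla_tension hu i j
    have hN : ⟪N u, pd l X u⟫_ℝ = 0 := h.inner_N_DX hu _
    have hX : ⟪X u, pd l X u⟫_ℝ = 0 := h.inner_X_DX hu _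
    have hs : ⟪pd i (pd j X) u, pd l N u⟫_ℝ
        = ∑ k, ⟪dualFrame X k u, pd i (pd j X) u⟫_ℝ * ⟪pd l N u, pd k X u⟫_ℝ := by
      have h1 : ⟪N u, pd l N u⟫_ℝ = 0 := h.inner_N_DN hu _
      have h2 : ⟪X u, pd l N u⟫_ℝ = 0 := h.inner_X_DN hu _
      conv_lhs => rw [h.decomp hu (pd i (pd j X) u)]
      simp only [inner_add_left, sum_inner, inner_smul_left, conj_trivial, h1, h2, mul_zero,
        add_zero]
      exact Finset.sum_congr rfl fun k _ => by rw [real_inner_comm (pd k X u)]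
    rw [inner_sub_left, hr, sum_inner, hs]
    simp only [h.nabla_tension hu, inner_add_left, inner_smul_left, hN, hX, hcomm,
      conj_trivial, h.christoffel_eq hu, mul_zero, zero_add, add_zero, mul_sub, Finset.mul_sum]
    rw [add_sub_assoc, add_sub_assoc, add_assoc]
    congr 3
    exact Finset.sum_congr rfl fun k _ => by ring
  have hg : ⟪gradC X N u, pd l N u⟫_ℝ
      = ∑ i, ∑ j, (inducedMetric X u)⁻¹ i j * (pd i (meanC X N) u * ⟪pd l N u, pd j X u⟫_ℝ) := by
    simp only [gradC, sum_inner, inner_smul_left, conj_trivial, dualFrame, Finset.mul_sum]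
    exact Finset.sum_congr rfl fun k _ => Finset.sum_congr rfl fun j _ => by
      rw [real_inner_comm]; ring
  have hg' : ⟪gradC X N u, pd l N u⟫_ℝ
      = ∑ i, ∑ j, (inducedMetric X u)⁻¹ i j * (pd j (meanC X N) u * ⟪pd l N u, pd i X u⟫_ℝ) := by
    rw [hg, Finset.sum_comm]
    exact Finset.sum_congr rfl fun k _ => Finset.sum_congr rfl fun j _ => by
      rw [inducedMetric_isSymm]
  have h0 : ⟪N u, pd l X u⟫_ℝ = 0 := h.inner_N_DX hu _
  have ht := h.trace_codazzi hu l
  rw [bitension, inner_sub_left, h.trace_sphereCurvature hu, roughLaplacian, neg_neg, metricTrace]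
  simp only [sum_inner, inner_smul_left, conj_trivial, e, mul_add, Finset.sum_add_distrib, h0]
  rw [← hg, ← hg']
  have hm : ∑ i, ∑ j, (inducedMetric X u)⁻¹ i j * (meanC X N u *
      (⟪pd i (pd j N) u, pd l X u⟫_ℝ - ⟪pd i (pd j X) u, pd l N u⟫_ℝ))
      = meanC X N u * -pd l (meanC X N) u := by
    rw [← ht]
    simp only [Finset.mul_sum]
    exact Finset.sum_congr rfl fun k _ => Finset.sum_congr rfl fun j _ => by ring
  rw [hm]
  ring

/-- The tangential part of the biharmonic equation. -/
theorem shape_gradV (hb : bitension (inducedMetric X) X u = 0) :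
    shape X N u (gradV X N u) = (-(meanC X N u) / 2) • gradV X N u := by
  refine h.DX_injective hu ?_
  rw [h.DX_shape hu, dirD_smul_dir, h.DX_gradV hu]
  have h1 : ∀ v, 2 * ⟪dirD v X u, dirD (gradV X N u) N u⟫_ℝ
      = meanC X N u * ⟪dirD v X u, gradC X N u⟫_ℝ := by
    intro v
    rw [real_inner_comm, h.inner_DN_DX_comm hu, h.DX_gradV hu, real_inner_comm (gradC X N u) (dirD v X u),
      h.inner_gradC hu, dirD_eq_sum N, dirD_eq_sum (meanC X N), sum_inner, Finset.mul_sum,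
      Finset.mul_sum]
    refine Finset.sum_congr rfl fun l _ => ?_
    have h2 := h.inner_bitension_pd hu l
    rw [hb, inner_zero_left] at h2
    rw [inner_smul_left, conj_trivial, real_inner_comm, smul_eq_mul]
    linear_combination -(v l) * h2
  refine h.ext_inner hu ?_ ?_ fun v => ?_
  · rw [inner_neg_right, h.inner_N_DN hu, inner_smul_right, h.inner_N_gradC hu]; simp
  · rw [inner_neg_right, h.inner_X_DN hu, inner_smul_right, h.inner_X_gradC hu]; simp
  · rw [inner_neg_right, inner_smul_right]
    linear_combination -(1 / 2) * h1 v

/-- The normal part of the biharmonic equation. -/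
theorem laplacian_meanC (hb : bitension (inducedMetric X) X u = 0) :
    ∑ i, ⟪pd i (gradC X N) u, dualFrame X i u⟫_ℝ
      = (LinearMap.trace ℝ (Euc m) (shape X N u * shape X N u) - m) * meanC X N u := by
  have h2 := h.inner_bitension_N hu
  rw [hb, inner_zero_left] at h2
  linarith

end Patch

end Patches

/-! ### Endomorphisms with at most two eigenvalues -/

section LinearAlgebra

theorem exists_subset_pair_of_encard_le_two {s : Set ℝ} (hs : s.encard ≤ 2) :
    ∃ a b : ℝ, s ⊆ {a, b} := by
  rcases s.eq_empty_or_nonempty with rfl | ⟨a, ha⟩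
  · exact ⟨0, 0, Set.empty_subset _⟩
  · by_cases h : ∃ b ∈ s, b ≠ a
    · obtain ⟨b, hb, hab⟩ := h
      refine ⟨a, b, fun c hc => ?_⟩
      by_contra hcn
      simp only [Set.mem_insert_iff, Set.mem_singleton_iff, not_or] at hcn
      have h3 : ({a, b, c} : Set ℝ).encard = 3 :=
        Set.encard_eq_three.2 ⟨a, b, c, hab.symm, Ne.symm hcn.1, Ne.symm hcn.2, rfl⟩
      have hsub : ({a, b, c} : Set ℝ) ⊆ s := by
        rintro x (rfl | rfl | rfl) <;> assumption
      have h4 := (Set.encard_le_encard hsub).trans hs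
      rw [h3] at h4
      exact absurd h4 (by norm_num)
    · push Not at h
      exact ⟨a, a, fun c hc => Or.inl (h c hc)⟩

/-- Only a and b occur on an orthonormal eigenbasis, so (T - a)(T - b) = 0. That T is neither scalar
is recorded to make both eigenspaces nonzero. -/
theorem symmetric_two_eigenvalues {R : Type*} [NormedAddCommGroup R] [InnerProductSpace ℝ R]
    [FiniteDimensional ℝ R] {T : R →ₗ[ℝ] R} (hT : T.IsSymmetric)
    (hs : {k : ℝ | Module.End.HasEigenvalue T k}.encard ≤ 2) :
    (∃ a : ℝ, ∀ v, T v = a • v) ∨ ∃ a b : ℝ, a ≠ b ∧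
      (∀ v, T (T v) = (a + b) • T v - (a * b) • v) ∧
      (¬ ∀ v, T v = a • v) ∧ ¬ ∀ v, T v = b • v := by
  obtain ⟨a, b, hab⟩ := exists_subset_pair_of_encard_le_two hs
  have hB := fun i => hT.apply_eigenvectorBasis (n := Module.finrank ℝ R) rfl i
  have hE := fun i => hT.hasEigenvalue_eigenvalues (n := Module.finrank ℝ R) rfl i
  set B := hT.eigenvectorBasis (n := Module.finrank ℝ R) rfl
  have hv : ∀ i, T (B i) = a • B i ∨ T (B i) = b • B i := by
    intro i
    rcases hab (hE i) with e | e
    · left; rw [hB]; simp only [RCLike.ofReal_real_eq_id, id_eq] at e ⊢; rw [e]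
    · right; rw [hB]; simp only [RCLike.ofReal_real_eq_id, id_eq] at e ⊢
      rw [Set.mem_singleton_iff.1 e]
  by_cases h1 : ∀ v, T v = a • v
  · exact Or.inl ⟨a, h1⟩
  by_cases h2 : ∀ v, T v = b • v
  · exact Or.inl ⟨b, h2⟩
  right
  refine ⟨a, b, ?_, ?_, h1, h2⟩
  · rintro rfl
    refine h1 fun v => ?_
    have : T = a • LinearMap.id := B.toBasis.ext fun i => by
      simpa using hv i
    rw [this]; rfl
  · intro v
    have : T ∘ₗ T = (a + b) • T - (a * b) • LinearMap.id := B.toBasis.ext fun i => by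
      simp only [OrthonormalBasis.coe_toBasis, LinearMap.comp_apply, LinearMap.sub_apply,
        LinearMap.smul_apply, LinearMap.id_apply]
      rcases hv i with e | e <;> simp only [e, map_smul] <;> module
    exact LinearMap.congr_fun this v

variable {E F : Type*} [AddCommGroup E] [Module ℝ E] [FiniteDimensional ℝ E]

/-- The shape operator is symmetric for the induced metric, not for the Euclidean product of the
coordinates. Transport to the range of `B` makes the spectral theorem available. -/
theorem two_eigenvalues_of_injective [NormedAddCommGroup F] [InnerProductSpace ℝ F]
    {B : E →ₗ[ℝ] F} (hB : Function.Injective B) {A : E →ₗ[ℝ] E}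
    (hA : ∀ v w, ⟪B (A v), B w⟫_ℝ = ⟪B v, B (A w)⟫_ℝ)
    (hs : {k : ℝ | Module.End.HasEigenvalue A k}.encard ≤ 2) :
    (∃ a : ℝ, ∀ v, A v = a • v) ∨ ∃ a b : ℝ, a ≠ b ∧
      (∀ v, A (A v) = (a + b) • A v - (a * b) • v) ∧
      (¬ ∀ v, A v = a • v) ∧ ¬ ∀ v, A v = b • v := by
  let e : E ≃ₗ[ℝ] LinearMap.range B := LinearEquiv.ofInjective B hB
  let T : LinearMap.range B →ₗ[ℝ] LinearMap.range B := e.conj A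
  have hTe : ∀ v, T (e v) = e (A v) := fun v => by simp [T, LinearEquiv.conj_apply]
  have hval : ∀ v, ((e v : LinearMap.range B) : F) = B v := fun v => rfl
  have hT : T.IsSymmetric := by
    intro x y
    obtain ⟨v, rfl⟩ := e.surjective x
    obtain ⟨w, rfl⟩ := e.surjective y
    rw [hTe, hTe]
    exact hA v w
  have hsub : {k : ℝ | Module.End.HasEigenvalue T k} ⊆ {k : ℝ | Module.End.HasEigenvalue A k} := by
    intro k hk
    obtain ⟨x, hx⟩ := hk.exists_hasEigenvector
    obtain ⟨v, rfl⟩ := e.surjective x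
    refine Module.End.hasEigenvalue_of_hasEigenvector (x := v)
      (Module.End.hasEigenvector_iff.2 ⟨Module.End.mem_eigenspace_iff.2 ?_, ?_⟩)
    · apply e.injective
      rw [← hTe, map_smul]
      exact hx.apply_eq_smul
    · rintro rfl
      exact hx.2 (map_zero e)
  have key : ∀ (a : ℝ), (∀ x, T x = a • x) ↔ ∀ v, A v = a • v := by
    intro a
    constructor
    · intro h v
      apply e.injective
      rw [← hTe, h, map_smul]
    · intro h x
      obtain ⟨v, rfl⟩ := e.surjective x
      rw [hTe, h, map_smul]
  rcases symmetric_two_eigenvalues hT ((Set.encard_le_encard hsub).trans hs) with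
    ⟨a, ha⟩ | ⟨a, b, hab, hq, h1, h2⟩
  · exact Or.inl ⟨a, (key a).1 ha⟩
  · refine Or.inr ⟨a, b, hab, fun v => e.injective ?_, fun h => h1 ((key a).2 h),
      fun h => h2 ((key b).2 h)⟩
    have h3 := hq (e v)
    rw [hTe, hTe] at h3
    simpa using h3

/-- (A - b)/(a - b) is the projection to the eigenspace of a along that of b; k is its rank, which
equals its trace. -/
theorem trace_of_two_eigenvalues {A : E →ₗ[ℝ] E} {a b : ℝ} (hab : a ≠ b)
    (hq : ∀ v, A (A v) = (a + b) • A v - (a * b) • v)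
    (h1 : ¬ ∀ v, A v = a • v) (h2 : ¬ ∀ v, A v = b • v) :
    ∃ k : ℕ, 1 ≤ k ∧ k < Module.finrank ℝ E ∧
      LinearMap.trace ℝ E A = k * a + (Module.finrank ℝ E - k) * b := by
  have hab' : a - b ≠ 0 := sub_ne_zero.2 hab
  obtain ⟨P, hP⟩ : ∃ P : E →ₗ[ℝ] E, ∀ v, P v = (a - b)⁻¹ • (A v - b • v) :=
    ⟨(a - b)⁻¹ • (A - b • LinearMap.id), fun v => rfl⟩
  have hAP : A = (a - b) • P + b • LinearMap.id := by
    ext v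
    simp [hP, smul_smul, hab']
  have hid : IsIdempotentElem P := by
    ext v
    rw [Module.End.mul_apply, hP, hP v, map_smul, map_sub, map_smul, hq]
    rw [smul_comm b (a - b)⁻¹, ← smul_sub, smul_smul]
    have : (a + b) • A v - (a * b) • v - b • A v - b • (A v - b • v)
      = (a - b) • (A v - b • v) := by module
    rw [this, smul_smul, mul_assoc, inv_mul_cancel₀ hab', mul_one]
  have hproj := LinearMap.IsIdempotentElem.isProj_range _ hid
  have htr := hproj.trace
  refine ⟨Module.finrank ℝ (LinearMap.range P), ?_, ?_, ?_⟩
  · rw [Nat.one_le_iff_ne_zero]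
    intro h0
    have h3 := Submodule.finrank_eq_zero.1 h0
    rw [LinearMap.range_eq_bot] at h3
    refine h2 fun v => ?_
    have h4 := hP v
    rw [h3, LinearMap.zero_apply, eq_comm, smul_eq_zero_iff_right (inv_ne_zero hab')] at h4
    exact sub_eq_zero.1 h4
  · refine lt_of_le_of_ne (Submodule.finrank_le _) fun h0 => ?_
    have h3 := Submodule.eq_top_of_finrank_eq h0
    refine h1 fun v => ?_
    have hv : P v = v := hproj.2 v (by rw [h3]; trivial)
    rw [hAP]
    simp only [LinearMap.add_apply, LinearMap.smul_apply, hv, LinearMap.id_apply]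
    module
  · conv_lhs => rw [hAP]
    rw [map_add, map_smul, map_smul, htr, LinearMap.trace_id]
    simp only [smul_eq_mul]
    ring

theorem trace_sq_of_quadratic {A : E →ₗ[ℝ] E} {s p : ℝ} (hq : ∀ v, A (A v) = s • A v - p • v) :
    LinearMap.trace ℝ E (A * A) = s * LinearMap.trace ℝ E A - p * Module.finrank ℝ E := by
  have : A * A = s • A - p • LinearMap.id := LinearMap.ext hq
  rw [this, map_sub, map_smul, map_smul, LinearMap.trace_id]
  rfl

omit [FiniteDimensional ℝ E] in
theorem trace_cube_of_quadratic {A : E →ₗ[ℝ] E} {s p : ℝ}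
    (hq : ∀ v, A (A v) = s • A v - p • v) :
    LinearMap.trace ℝ E (A * A * A)
      = s * LinearMap.trace ℝ E (A * A) - p * LinearMap.trace ℝ E A := by
  have : A * A * A = s • (A * A) - p • A := LinearMap.ext fun v => hq (A v)
  rw [this, map_sub, map_smul, map_smul]
  rfl

/-- A connected set of reals with two points is infinite. This turns integrality of multiplicities
into constancy of coefficients, with no discussion of the continuity of eigenvalues. -/
theorem eq_of_mem_finite {Y : Type*} [TopologicalSpace Y] {U : Set Y} (hU : IsPreconnected U)
    {c : Y → ℝ} (hc : ContinuousOn c U) {S : Set ℝ} (hS : S.Finite) (h : ∀ x ∈ U, c x ∈ S)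
    {x y : Y} (hx : x ∈ U) (hy : y ∈ U) : c x = c y := by
  by_contra hne
  have h1 : (c '' U).Infinite :=
    (hU.image c hc).infinite_of_nontrivial ⟨_, ⟨x, hx, rfl⟩, _, ⟨y, hy, rfl⟩, hne⟩
  exact h1 (hS.subset (by rintro _ ⟨z, hz, rfl⟩; exact h z hz))

end LinearAlgebra

/-! ### Patches with two principal curvatures -/

section Patches

variable {m : ℕ} {F : Type*} [NormedAddCommGroup F] [InnerProductSpace ℝ F]

namespace Patch

variable {X N : Euc m → F} {U : Set (Euc m)} (h : Patch X N U) {u : Euc m} (hu : u ∈ U)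
include h hu

theorem isUnitNormal : IsUnitNormal X u (N u) := by
  refine ⟨?_, h.XN u hu, fun i => h.DXN u hu _⟩
  rw [norm_eq_sqrt_real_inner, h.NN u hu, Real.sqrt_one]

theorem inner_shape_comm (v w : Euc m) :
    ⟪dirD (shape X N u v) X u, dirD w X u⟫_ℝ = ⟪dirD v X u, dirD (shape X N u w) X u⟫_ℝ := by
  rw [h.DX_shape hu, h.DX_shape hu, inner_neg_left, inner_neg_right, h.inner_DN_DX_comm hu,
    real_inner_comm]

theorem shape_two_eigenvalues (hs : (principalCurvatures X u (N u)).encard ≤ 2) :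
    (∃ a : ℝ, ∀ v, shape X N u v = a • v) ∨ ∃ a b : ℝ, a ≠ b ∧
      (∀ v, shape X N u (shape X N u v) = (a + b) • shape X N u v - (a * b) • v) ∧
      (¬ ∀ v, shape X N u v = a • v) ∧ ¬ ∀ v, shape X N u v = b • v := by
  refine two_eigenvalues_of_injective (B := (fderiv ℝ X u : Euc m →ₗ[ℝ] F)) (h.inj u hu)
    (h.inner_shape_comm hu) (le_trans (Set.encard_le_encard ?_) hs)
  intro k hk
  obtain ⟨x, hx⟩ := Module.End.HasEigenvalue.exists_hasEigenvector hk
  refine Module.End.hasEigenvalue_of_hasEigenvector (x := WithLp.ofLp x)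
    (Module.End.hasEigenvector_iff.2 ⟨Module.End.mem_eigenspace_iff.2 ?_, ?_⟩)
  · have h1 := congrArg WithLp.ofLp hx.apply_eq_smul
    simpa [shape, Matrix.toLpLin_apply] using h1
  · intro h0
    exact hx.2 (by simpa using h0)

theorem inner_DN_DN {s p : ℝ}
    (hq : ∀ v, shape X N u (shape X N u v) = s • shape X N u v - p • v) (v w : Euc m) :
    ⟪dirD v N u, dirD w N u⟫_ℝ
      = -s * ⟪dirD v N u, dirD w X u⟫_ℝ - p * ⟪dirD v X u, dirD w X u⟫_ℝ := by
  have h1 : dirD w N u = - dirD (shape X N u w) X u := by rw [h.DX_shape hu, neg_neg]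
  have h2 : dirD (shape X N u w) N u = - dirD (s • shape X N u w - p • w) X u := by
    rw [← hq, h.DX_shape hu, neg_neg]
  rw [h1, inner_neg_right, h.inner_DN_DX_comm hu, h2, dirD_sub_dir, dirD_smul_dir, dirD_smul_dir,
    h.DX_shape hu, inner_neg_left, inner_sub_left, inner_smul_left, inner_smul_left,
    inner_neg_left, h.inner_DN_DX_comm hu w v, real_inner_comm (dirD v X u) (dirD w X u)]
  simp only [conj_trivial]
  ring

/-- The covariant derivative of the second fundamental form on an eigenspace of the shape
operator. -/
theorem codazzi_eigenspace {l n : Euc m → ℝ} (hl : ∀ x ∈ U, ContDiffAt ℝ ∞ l x)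
    (hn : ∀ x ∈ U, ContDiffAt ℝ ∞ n x)
    (hq : ∀ x ∈ U, ∀ v, shape X N x (shape X N x v)
      = (l x + n x) • shape X N x v - (l x * n x) • v) (hne : l u ≠ n u)
    {v w : Euc m} (hv : shape X N u v = l u • v) (hw : shape X N u w = l u • w) (a : Euc m) :
    ⟪dirD a (dirD v N) u, dirD w X u⟫_ℝ - ⟪dirD a (dirD v X) u, dirD w N u⟫_ℝ
      = -(dirD a l u * ⟪dirD v X u, dirD w X u⟫_ℝ) := by
  have hX := h.smoothX u hu
  have hN := h.smoothN u hu
  -- This is (A - l)(A - n) = 0 for fixed v and w on all of U, so no extension to eigenvector fields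
  -- is needed. At u the left factor vanishes because v is in the eigenspace of l; after
  -- differentiation only its derivative survives, paired with (n - l) dX(w).
  have h0 : ∀ x ∈ U, ⟪dirD v N x + l x • dirD v X x, dirD w N x + n x • dirD w X x⟫_ℝ = 0 := by
    intro x hx
    simp only [inner_add_left, inner_add_right, inner_smul_left, inner_smul_right, conj_trivial]
    rw [h.inner_DN_DN hx (hq x hx), real_inner_comm (dirD w N x) (dirD v X x),
      h.inner_DN_DX_comm hx w v]
    ring
  have h1 := dirD_eq_zero_of_const h.isOpen hu h0 a
  have sv : ContDiffAt ℝ ∞ (fun x => l x • dirD v X x) u := (hl u hu).smul (hX.dirD v)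
  have sw : ContDiffAt ℝ ∞ (fun x => n x • dirD w X x) u := (hn u hu).smul (hX.dirD w)
  rw [dirD_inner (V := fun x => dirD v N x + l x • dirD v X x)
    (W := fun x => dirD w N x + n x • dirD w X x) ((hN.dirD v).add sv) ((hN.dirD w).add sw),
    dirD_add (hN.dirD v) sv, dirD_smul (hl u hu) (hX.dirD v)] at h1
  have ev : dirD v N u = -(l u • dirD v X u) := by
    rw [← dirD_smul_dir, ← hv, h.DX_shape hu, neg_neg]
  have ew : dirD w N u = -(l u • dirD w X u) := by
    rw [← dirD_smul_dir, ← hw, h.DX_shape hu, neg_neg]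
  rw [ev, ew, neg_add_cancel, inner_zero_left, add_zero] at h1
  rw [ew]
  simp only [inner_add_left, inner_add_right, inner_smul_left, inner_smul_right, conj_trivial,
    inner_neg_right] at h1 ⊢
  have h2 : n u - l u ≠ 0 := sub_ne_zero.2 hne.symm
  apply mul_left_cancel₀ h2
  linear_combination h1

end Patch

end Patches

/-! ### Constancy of the mean curvature -/

section Patches

variable {m : ℕ} {F : Type*} [NormedAddCommGroup F] [InnerProductSpace ℝ F]

/-- The squared length of the gradient of `meanC`. -/
def gradSq (X N : Euc m → F) (u : Euc m) : ℝ := ⟪gradC X N u, gradC X N u⟫_ℝ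

namespace Patch

variable {X N : Euc m → F} {U : Set (Euc m)} (h : Patch X N U)

theorem trace_scalar_add_rankOne {f : Euc m → ℝ} {u ξ : Euc m} {r s : ℝ}
    {T : Euc m →ₗ[ℝ] Euc m} (hT : ∀ v, T v = r • v + (s * dirD v f u) • ξ) :
    LinearMap.trace ℝ (Euc m) T = m * r + s * dirD ξ f u := by
  rw [trace_euc]
  simp only [hT, PiLp.add_apply, PiLp.smul_apply, smul_eq_mul, PiLp.single_apply,
    Finset.sum_add_distrib]
  rw [dirD_eq_sum f u ξ, Finset.mul_sum]
  simp only [if_true, mul_one, Finset.sum_const, Finset.card_univ, Fintype.card_fin,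
    nsmul_eq_mul, smul_eq_mul]
  congr 1
  exact Finset.sum_congr rfl fun i _ => by rw [pd_eq_dirD]; ring

include h

theorem contDiffAt_gradSq {u : Euc m} (hu : u ∈ U) : ContDiffAt ℝ ∞ (gradSq X N) u :=
  (h.contDiffAt_gradC hu).inner ℝ (h.contDiffAt_gradC hu)

theorem dirD_gradV_meanC {u : Euc m} (hu : u ∈ U) :
    dirD (gradV X N u) (meanC X N) u = gradSq X N u := by
  rw [← h.inner_gradC hu, h.DX_gradV hu]; rfl

theorem continuousOn_trace_shape_sq : ContinuousOn
    (fun u => LinearMap.trace ℝ (Euc m) (shape X N u * shape X N u)) U := by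
  intro u hu
  have h1 : ContinuousAt (fun u => ∑ i, ∑ j, (inducedMetric X u)⁻¹ i j *
      ⟪pd i N u, pd j N u⟫_ℝ) u :=
    (ContDiffAt.sum fun i _ => ContDiffAt.sum fun j _ =>
      (contDiffAt_inv_apply (contDiffAt_inducedMetric (h.smoothX u hu))
        (det_inducedMetric_ne_zero (h.inj u hu)) i j).mul
        (((h.smoothN u hu).dirD _).inner ℝ ((h.smoothN u hu).dirD _)) :
      ContDiffAt ℝ ∞ _ u).continuousAt
  exact h1.continuousWithinAt.congr (fun x hx => h.trace_shape_sq hx) (h.trace_shape_sq hu)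

/-- The tangential equation makes -f/2 one root. If it has multiplicity k, the trace condition -kf/2
+ (m - k)b = f determines the other. A scalar A is excluded, since -mf/2 = f forces f = 0. -/
theorem exists_quadratic_at {u : Euc m} (hu : u ∈ U)
    (hb : bitension (inducedMetric X) X u = 0)
    (hs : (principalCurvatures X u (N u)).encard ≤ 2)
    (hf : meanC X N u ≠ 0) (hw : gradSq X N u ≠ 0) :
    ∃ k : ℕ, 1 ≤ k ∧ k < m ∧ ∀ v, shape X N u (shape X N u v)
      = (-(meanC X N u) / 2 + (1 + k / 2) / (m - k) * meanC X N u) • shape X N u v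
        - (-(meanC X N u) / 2 * ((1 + k / 2) / (m - k) * meanC X N u)) • v := by
  have hξ := h.shape_gradV hu hb
  have hξ0 : gradV X N u ≠ 0 := by
    intro h0
    apply hw
    rw [gradSq, ← h.DX_gradV hu, h0, dirD_zero_dir, inner_zero_left]
  have htr := h.trace_shape hu
  have main : ∀ a b : ℝ, a ≠ b →
      (∀ v, shape X N u (shape X N u v) = (a + b) • shape X N u v - (a * b) • v) →
      (¬ ∀ v, shape X N u v = a • v) → (¬ ∀ v, shape X N u v = b • v) →
      a = -(meanC X N u) / 2 → ∃ k : ℕ, 1 ≤ k ∧ k < m ∧ ∀ v, shape X N u (shape X N u v)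
      = (-(meanC X N u) / 2 + (1 + k / 2) / (m - k) * meanC X N u) • shape X N u v
        - (-(meanC X N u) / 2 * ((1 + k / 2) / (m - k) * meanC X N u)) • v := by
    intro a b hab hq h1 h2 ha
    obtain ⟨k, hk1, hkm, hk⟩ := trace_of_two_eigenvalues hab hq h1 h2
    rw [finrank_euclideanSpace_fin] at hk hkm
    refine ⟨k, hk1, hkm, ?_⟩
    have hmk : (m : ℝ) - k ≠ 0 := by
      have : (k : ℝ) < m := by exact_mod_cast hkm
      linarith
    have hb' : b = (1 + k / 2) / (m - k) * meanC X N u := by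
      rw [htr, ha] at hk
      field_simp
      linarith
    rw [← hb', ← ha]
    exact hq
  rcases h.shape_two_eigenvalues hu hs with ⟨a, ha⟩ | ⟨a, b, hab, hq, h1, h2⟩
  · exfalso
    have h3 : a = -(meanC X N u) / 2 := by
      rw [ha] at hξ
      exact smul_left_injective ℝ hξ0 hξ
    have h4 := trace_scalar_add_rankOne (T := shape X N u) (f := fun _ => 0) (u := u) (ξ := 0)
      (r := a) (s := 0) (by simpa using ha)
    rw [htr, h3] at h4
    have h5 : meanC X N u * (1 + m / 2) = 0 := by linarith
    rcases mul_eq_zero.1 h5 with h6 | h6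
    · exact hf h6
    · have : (0 : ℝ) ≤ m := Nat.cast_nonneg m
      linarith
  · have h3 := hq (gradV X N u)
    rw [hξ, map_smul, hξ, smul_smul, smul_smul, ← sub_smul] at h3
    have h4 := smul_left_injective ℝ hξ0 h3
    have h5 : (-(meanC X N u) / 2 - a) * (-(meanC X N u) / 2 - b) = 0 := by
      linear_combination h4
    rcases mul_eq_zero.1 h5 with h6 | h6
    · exact main a b hab hq h1 h2 (by linarith)
    · refine main b a hab.symm ?_ h2 h1 (by linarith)
      intro v
      rw [hq, add_comm, mul_comm]

theorem exists_quadratic (hU : IsPreconnected U) (hne : U.Nonempty)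
    (hb : ∀ u ∈ U, bitension (inducedMetric X) X u = 0)
    (hs : ∀ u ∈ U, (principalCurvatures X u (N u)).encard ≤ 2)
    (hf : ∀ u ∈ U, meanC X N u ≠ 0) (hw : ∀ u ∈ U, gradSq X N u ≠ 0) :
    ∃ c : ℝ, 0 < c ∧ ∀ u ∈ U, ∀ v, shape X N u (shape X N u v)
      = (-(meanC X N u) / 2 + c * meanC X N u) • shape X N u v
        - (-(meanC X N u) / 2 * (c * meanC X N u)) • v := by
  obtain ⟨u₀, hu₀⟩ := hne
  -- The trace of the quadratic relation is |A|² = (c - 1/2) f² + m c f²/2. Solved for c, it gives a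
  -- continuous expression with finitely many possible values.
  let ratio : Euc m → ℝ := fun u =>
    (LinearMap.trace ℝ (Euc m) (shape X N u * shape X N u) / meanC X N u ^ 2 + 1 / 2)
      / (1 + m / 2)
  have hm : (1 + (m : ℝ) / 2) ≠ 0 := by positivity
  have hcont : ContinuousOn ratio U := by
    refine ContinuousOn.div_const (ContinuousOn.add (ContinuousOn.div
      h.continuousOn_trace_shape_sq ?_ fun u hu => pow_ne_zero 2 (hf u hu)) continuousOn_const) _
    exact fun u hu => ((h.contDiffAt_meanC hu).continuousAt.pow 2).continuousWithinAt
  have key : ∀ u (hu : u ∈ U) (c : ℝ), (∀ v, shape X N u (shape X N u v)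
      = (-(meanC X N u) / 2 + c * meanC X N u) • shape X N u v
        - (-(meanC X N u) / 2 * (c * meanC X N u)) • v) → ratio u = c := by
    intro u hu c hq
    have h1 := trace_sq_of_quadratic hq
    rw [h.trace_shape hu, finrank_euclideanSpace_fin] at h1
    have := hf u hu
    simp only [ratio]
    rw [h1]
    field_simp
    ring
  let S : Set ℝ := (fun k : ℕ => (1 + (k : ℝ) / 2) / (m - k)) '' (Set.Iio m)
  have hS : S.Finite := (Set.finite_Iio m).image _
  have hmem : ∀ u ∈ U, ratio u ∈ S := by
    intro u hu
    obtain ⟨k, _, hkm, hq⟩ := h.exists_quadratic_at hu (hb u hu) (hs u hu) (hf u hu) (hw u hu)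
    exact ⟨k, hkm, (key u hu _ hq).symm⟩
  refine ⟨ratio u₀, ?_, ?_⟩
  · obtain ⟨k, hkm, hk⟩ := hmem u₀ hu₀
    rw [← hk]
    have : (k : ℝ) < m := by exact_mod_cast hkm
    have h2 : (0 : ℝ) < m - k := by linarith
    positivity
  · intro u hu
    obtain ⟨k, _, hkm, hq⟩ := h.exists_quadratic_at hu (hb u hu) (hs u hu) (hf u hu) (hw u hu)
    have h1 := key u hu _ hq
    rw [eq_of_mem_finite hU hcont hS hmem hu₀ hu, h1]
    exact hq

/-- The image of A - c f lies in the eigenspace of -f/2, which Codazzi forces to be the line of grad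
f. Hence A - c f has rank at most one, and its coefficient follows from self-adjointness. -/
theorem shape_eq_of_quadratic {c : ℝ} (hc : 0 < c)
    (hb : ∀ u ∈ U, bitension (inducedMetric X) X u = 0)
    (hf : ∀ u ∈ U, meanC X N u ≠ 0) (hw : ∀ u ∈ U, gradSq X N u ≠ 0)
    (hq : ∀ u ∈ U, ∀ v, shape X N u (shape X N u v)
      = (-(meanC X N u) / 2 + c * meanC X N u) • shape X N u v
        - (-(meanC X N u) / 2 * (c * meanC X N u)) • v) {u : Euc m} (hu : u ∈ U) (v : Euc m) :
    shape X N u v = (c * meanC X N u) • v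
      + ((-1 / 2 - c) * meanC X N u / gradSq X N u * dirD v (meanC X N) u) • gradV X N u := by
  have hξ := h.shape_gradV hu (hb u hu)
  have hfu := hf u hu
  have hwu := hw u hu
  have hX := h.smoothX u hu
  have hN := h.smoothN u hu
  have hmean : ∀ x ∈ U, ContDiffAt ℝ ∞ (fun x => -(meanC X N x) / 2) x := fun x hx =>
    (h.contDiffAt_meanC hx).neg.div_const 2
  have hmean' : ∀ x ∈ U, ContDiffAt ℝ ∞ (fun x => c * meanC X N x) x := fun x hx =>
    contDiffAt_const.mul (h.contDiffAt_meanC hx)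
  have hdl : ∀ a, dirD a (fun x => -(meanC X N x) / 2) u = -(1 / 2) * dirD a (meanC X N) u := by
    intro a
    rw [← dirD_const_mul _ (h.contDiffAt_meanC hu)]
    congr 1
    funext x
    ring
  have hne : -(meanC X N u) / 2 ≠ c * meanC X N u := by
    intro h0
    have : meanC X N u * (c + 1 / 2) = 0 := by linarith
    rcases mul_eq_zero.1 this with h1 | h1
    · exact hfu h1
    · linarith
  -- For z in the eigenspace of -f/2 with df(z) = 0, the derivatives (∇_ξ h)(z, z) and (∇_z h)(ξ,
  -- z), where ξ = grad f, are equal. The second is zero and the first is |grad f|² |z|²/2 up to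
  -- sign.
  have horth : ∀ z, shape X N u z = (-(meanC X N u) / 2) • z → dirD z (meanC X N) u = 0 →
      z = 0 := by
    intro z hz hz0
    have h1 := h.codazzi_eigenspace hu hmean hmean' hq hne hz hz (gradV X N u)
    have h2 := h.codazzi_eigenspace hu hmean hmean' hq hne hξ hz z
    rw [dirD_comm hX z, dirD_comm hN z, h1, hdl, hdl, hz0, h.dirD_gradV_meanC hu] at h2
    have h3 : gradSq X N u * ⟪dirD z X u, dirD z X u⟫_ℝ = 0 := by linarith
    have h4 := inner_self_eq_zero.1 ((mul_eq_zero.1 h3).resolve_left hwu)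
    exact h.DX_injective hu (h4.trans (dirD_zero_dir X u).symm)
  set y := shape X N u v - (c * meanC X N u) • v with hy
  have hyA : shape X N u y = (-(meanC X N u) / 2) • y := by
    rw [hy, map_sub, map_smul, hq u hu]
    module
  have hdy : dirD y (meanC X N) u = (-1 / 2 - c) * meanC X N u * dirD v (meanC X N) u := by
    have h1 := h.inner_shape_comm hu v (gradV X N u)
    rw [hξ, dirD_smul_dir, h.DX_gradV hu, inner_smul_right, real_inner_comm,
      h.inner_gradC hu, real_inner_comm, h.inner_gradC hu] at h1
    rw [hy, dirD_sub_dir, dirD_smul_dir, h1, smul_eq_mul]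
    ring
  have h5 := horth (y - (dirD y (meanC X N) u / gradSq X N u) • gradV X N u) (by
    rw [map_sub, map_smul, hξ, hyA]
    module) (by
    rw [dirD_sub_dir, dirD_smul_dir, h.dirD_gradV_meanC hu, smul_eq_mul]
    field_simp
    ring)
  have h6 : shape X N u v = (c * meanC X N u) • v + y := by rw [hy]; abel
  rw [h6]
  congr 1
  rw [sub_eq_zero.1 h5, hdy]
  congr 1
  ring

end Patch

/-- The overdetermined system satisfied by `f` and `w = |∇f|²` has no solution. -/
theorem false_of_mean_curvature_system {E : Type*} [NormedAddCommGroup E] [NormedSpace ℝ E]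
    {U : Set E} (hU : IsOpen U) {u : E} (hu : u ∈ U) {f w : E → ℝ} {μ r c c₂ : ℝ} (hμ : 1 < μ)
    (hr : r = -3 / (μ + 2))
    (hfs : ∀ x ∈ U, ContDiffAt ℝ ∞ f x) (hws : ∀ x ∈ U, ContDiffAt ℝ ∞ w x)
    (hf : ∀ x ∈ U, f x ≠ 0) (hw : ∀ x ∈ U, w x ≠ 0) (ξ : E → E)
    (hξ : ∀ x ∈ U, dirD (ξ x) f x ≠ 0) {w₁ : E → ℝ}
    (hdw : ∀ x ∈ U, ∀ v, dirD v w x = w₁ x * dirD v f x)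
    (hw₁ : ∀ x ∈ U, w₁ x = 2 * ((c₂ * f x ^ 2 - μ) * f x - (μ - 1) * (r * w x / f x)))
    (hgauss : ∀ x ∈ U, r * ((w₁ x * f x - w x) / f x ^ 2)
      = (w₁ x / 2 - r * w x / f x) / w x * (r * w x / f x) + c * f x ^ 2 / 2 - 1) : False := by
  have hm2 : μ + 2 ≠ 0 := by linarith
  obtain ⟨α, hα⟩ : ∃ α, α = -(μ - 2) * r ^ 2 - r := ⟨_, rfl⟩
  obtain ⟨β, hβ⟩ : ∃ β, β = 1 - r * μ := ⟨_, rfl⟩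
  obtain ⟨γ, hγ⟩ : ∃ γ, γ = r * c₂ - c / 2 := ⟨_, rfl⟩
  have hfF : ∀ x ∈ U, w₁ x * f x = 2 * ((c₂ * f x ^ 2 - μ) * f x ^ 2 - (μ - 1) * (r * w x)) := by
    intro x hx
    have h3 := hf x hx
    rw [hw₁ x hx]
    field_simp
  -- Elimination of `w₁` between `hw₁` and `hgauss`.
  have h1 : ∀ x ∈ U, α * w x + (γ * f x ^ 4 + β * f x ^ 2) = 0 := by
    intro x hx
    have h2 := hgauss x hx
    have h3 := hf x hx
    have h4 := hw x hx
    field_simp at h2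
    rw [hα, hβ, hγ]
    linear_combination (1 / 2) * h2 - (r / 2) * hfF x hx
  -- Differentiating `h1` along ξ brings back `w₁`; eliminating it, and then `w` by `h1` itself,
  -- leaves a relation in f² alone.
  have h2 : ∀ x ∈ U, (α * c₂ + (μ - 1) * r * γ + 2 * γ) * f x ^ 2
      + (-α * μ + (μ - 1) * r * β + β) = 0 := by
    intro x hx
    have hfx := hfs x hx
    have h3 := dirD_eq_zero_of_const hU hx h1 (ξ x)
    have s2 : ContDiffAt ℝ ∞ (fun x => f x ^ 2) x := hfx.pow 2
    have s4 : ContDiffAt ℝ ∞ (fun x => f x ^ 4) x := hfx.pow 4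
    have d2 : ∀ v, dirD v (fun x => f x ^ 2) x = 2 * f x * dirD v f x := by
      intro v
      have := dirD_mul hfx hfx v
      simp only [← pow_two] at this
      rw [this]; ring
    have d4 : ∀ v, dirD v (fun x => f x ^ 4) x = 4 * f x ^ 3 * dirD v f x := by
      intro v
      have := dirD_mul s2 s2 v
      simp only [← pow_add] at this
      rw [this, d2]; ring
    rw [dirD_add (V := fun x => α * w x) (W := fun x => γ * f x ^ 4 + β * f x ^ 2)
      (contDiffAt_const.mul (hws x hx))
      ((contDiffAt_const.mul s4).add (contDiffAt_const.mul s2)),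
      dirD_add (V := fun x => γ * f x ^ 4) (W := fun x => β * f x ^ 2) (contDiffAt_const.mul s4)
      (contDiffAt_const.mul s2), dirD_const_mul _ (hws x hx), dirD_const_mul _ s4,
      dirD_const_mul _ s2, d2, d4, hdw x hx] at h3
    have h4 : α * w₁ x + 4 * γ * f x ^ 3 + 2 * β * f x = 0 := by
      apply mul_right_cancel₀ (hξ x hx)
      linear_combination h3
    have h5 := hf x hx
    apply mul_left_cancel₀ (pow_ne_zero 2 h5)
    linear_combination (f x / 2) * h4 - (α / 2) * hfF x hx + ((μ - 1) * r) * h1 x hx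
  -- f² has nonzero derivative along ξ, so its coefficient vanishes, and therefore so does the
  -- constant term.
  have h3 := dirD_congr (W := fun _ => -(-α * μ + (μ - 1) * r * β + β)) hU hu
    (fun x hx => eq_neg_of_add_eq_zero_left (h2 x hx)) (ξ u)
  have hfu := hfs u hu
  have s2 : ContDiffAt ℝ ∞ (fun x => f x ^ 2) u := hfu.pow 2
  have d2 := dirD_mul hfu hfu (ξ u)
  simp only [← pow_two] at d2
  rw [dirD_const, dirD_const_mul _ s2, d2] at h3
  have h4 : (α * c₂ + (μ - 1) * r * γ + 2 * γ) = 0 := by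
    apply mul_right_cancel₀ (mul_ne_zero (hf u hu) (hξ u hu))
    linear_combination (1 / 2) * h3
  have h5 := h2 u hu
  rw [h4, zero_mul, zero_add] at h5
  -- The constant term involves neither `c` nor `c₂`. For r = -3/(μ + 2) it is nonzero as soon as μ
  -- > 1.
  have h6 : (-α * μ + (μ - 1) * r * β + β) * (μ + 2) ^ 2 = -2 * (μ - 1) * (μ + 5) := by
    rw [hα, hβ, hr]
    field_simp
    ring
  rw [h5, zero_mul] at h6
  have h7 : 0 < (μ - 1) * (μ + 5) := mul_pos (by linarith) (by linarith)
  linarith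

namespace Patch

variable {X N : Euc m → F} {U : Set (Euc m)} (h : Patch X N U)

include h

/-- The derivative of the gradient along its orthogonal complement, and that of its length. -/
theorem dirD_gradC_of_orth {c b : ℝ} (hb : b ≠ 0)
    (hf : ∀ u ∈ U, meanC X N u ≠ 0) (hw : ∀ u ∈ U, gradSq X N u ≠ 0)
    (hA : ∀ u ∈ U, ∀ v, shape X N u v = (c * meanC X N u) • v
      + (b * meanC X N u / gradSq X N u * dirD v (meanC X N) u) • gradV X N u)
    {u : Euc m} (hu : u ∈ U) {v : Euc m} (hv : dirD v (meanC X N) u = 0) :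
    dirD v (gradSq X N) u = 0 ∧
      dirD v (gradC X N) u = (c / b * gradSq X N u / meanC X N u) • dirD v X u := by
  have hX := h.smoothX u hu
  have hN := h.smoothN u hu
  have hfs := h.contDiffAt_meanC hu
  have hws := h.contDiffAt_gradSq hu
  have hGs := h.contDiffAt_gradC hu
  have hfu := hf u hu
  have hwu := hw u hu
  let q : Euc m → ℝ := fun x => b * meanC X N x / gradSq X N x
  have hbfs : ContDiffAt ℝ ∞ (fun x => b * meanC X N x) u := contDiffAt_const.mul hfs
  have hqs : ContDiffAt ℝ ∞ q u := hbfs.div hws hwu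
  let Q : Euc m → F := fun x => q x • gradC X N x
  have hQs : ContDiffAt ℝ ∞ Q u := hqs.smul hGs
  -- The rank-one form of A reads dN = -(c f dX + df Q), where Q = (b f/w) grad f.
  have hDN : ∀ a, ∀ x ∈ U, dirD a N x
      = -((c * meanC X N x) • dirD a X x + dirD a (meanC X N) x • Q x) := by
    intro a x hx
    rw [← neg_eq_iff_eq_neg, ← h.DX_shape hx, hA x hx, dirD_add_dir, dirD_smul_dir, dirD_smul_dir,
      h.DX_gradV hx]
    simp only [Q, q, smul_smul]
    rw [mul_comm (dirD a (meanC X N) x)]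
  have hcf : ContDiffAt ℝ ∞ (fun x => c * meanC X N x) u := contDiffAt_const.mul hfs
  have hDDN : ∀ a d, dirD d (dirD a N) u
      = -((c * dirD d (meanC X N) u) • dirD a X u + (c * meanC X N u) • dirD d (dirD a X) u
        + (dirD d (dirD a (meanC X N)) u • Q u + dirD a (meanC X N) u • dirD d Q u)) := by
    intro a d
    rw [dirD_congr h.isOpen hu (hDN a) d, dirD_neg,
      dirD_add (V := fun x => (c * meanC X N x) • dirD a X x)
        (W := fun x => dirD a (meanC X N) x • Q x) (hcf.smul (hX.dirD a)) ((hfs.dirD a).smul hQs),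
      dirD_smul hcf (hX.dirD a), dirD_smul (hfs.dirD a) hQs, dirD_const_mul _ hfs]
  -- Commuting the derivatives of N along v and grad f: as df(v) = 0, everything cancels except w
  -- D_vQ = c w dX(v).
  have h1 := dirD_comm hN v (gradV X N u)
  rw [hDDN, hDDN, hv, h.dirD_gradV_meanC hu, dirD_comm hX v, dirD_comm hfs v, mul_zero, zero_smul,
    zero_smul, zero_add, add_zero, neg_inj] at h1
  have h2 : dirD v Q u = c • dirD v X u := by
    have h3 : gradSq X N u • dirD v Q u = gradSq X N u • (c • dirD v X u) := by
      rw [smul_smul, mul_comm _ c]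
      have h4 : gradSq X N u • dirD v Q u = (((c * meanC X N u) •
        dirD (gradV X N u) (dirD v X) u + (dirD (gradV X N u) (dirD v (meanC X N)) u • Q u
          + gradSq X N u • dirD v Q u)) - (c * meanC X N u) • dirD (gradV X N u) (dirD v X) u
          - dirD (gradV X N u) (dirD v (meanC X N)) u • Q u) := by abel
      rw [h4, h1]
      abel
    exact (smul_right_injective F hwu) h3
  have hdq : dirD v q u = -(b * meanC X N u * dirD v (gradSq X N) u) / gradSq X N u ^ 2 := by
    rw [dirD_div hbfs hws hwu, dirD_const_mul _ hfs, hv]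
    congr 1
    ring
  have hDQ : dirD v Q u = dirD v q u • gradC X N u + q u • dirD v (gradC X N) u :=
    dirD_smul hqs hGs v
  have hdw : dirD v (gradSq X N) u = 2 * ⟪dirD v (gradC X N) u, gradC X N u⟫_ℝ := by
    have := dirD_inner hGs hGs v
    rw [real_inner_comm (dirD v (gradC X N) u)] at this
    refine Eq.trans this ?_
    ring
  -- Pairing D_vQ = c dX(v) with grad f kills the right side. The derivative of b f/w contributes
  -- -dw(v) and that of grad f contributes dw(v)/2, in the same unit, so they cannot cancel unless
  -- dw(v) = 0.
  have hzero : dirD v (gradSq X N) u = 0 := by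
    have h3 := congrArg (fun y => ⟪y, gradC X N u⟫_ℝ) (hDQ.symm.trans h2)
    simp only [inner_add_left, inner_smul_left, conj_trivial] at h3
    rw [real_inner_comm (gradC X N u) (dirD v X u), h.inner_gradC hu, hv, hdq] at h3
    have h4 : ⟪gradC X N u, gradC X N u⟫_ℝ = gradSq X N u := rfl
    have h5 : ⟪dirD v (gradC X N) u, gradC X N u⟫_ℝ = dirD v (gradSq X N) u / 2 := by
      rw [hdw]; ring
    rw [h4, h5] at h3
    simp only [q] at h3
    field_simp at h3
    simpa [hb, hfu, show (-2 + 1 : ℝ) ≠ 0 by norm_num] using h3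
  refine ⟨hzero, ?_⟩
  rw [hdq, hzero, mul_zero, neg_zero, zero_div, zero_smul, zero_add] at hDQ
  rw [hDQ] at h2
  have hq0 : q u ≠ 0 := div_ne_zero (mul_ne_zero hb hfu) hwu
  apply smul_right_injective F hq0
  simp only
  rw [h2, smul_smul]
  congr 1
  simp only [q]
  field_simp

/-- The derivative of the gradient. -/
theorem dirD_gradC {c b : ℝ} (hb : b ≠ 0) (hcb : c + b = -1 / 2)
    (hf : ∀ u ∈ U, meanC X N u ≠ 0) (hw : ∀ u ∈ U, gradSq X N u ≠ 0)
    (hA : ∀ u ∈ U, ∀ v, shape X N u v = (c * meanC X N u) • v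
      + (b * meanC X N u / gradSq X N u * dirD v (meanC X N) u) • gradV X N u)
    {u : Euc m} (hu : u ∈ U) :
    ∃ w₁ : ℝ, (∀ v, dirD v (gradSq X N) u = w₁ * dirD v (meanC X N) u) ∧
      ∀ v, dirD v (gradC X N) u = (c / b * gradSq X N u / meanC X N u) • dirD v X u
        + dirD v (meanC X N) u •
          (((w₁ / 2 - c / b * gradSq X N u / meanC X N u) / gradSq X N u) • gradC X N u
            + (-(meanC X N u) / 2) • N u - X u) := by
  have hfu := hf u hu
  have hwu := hw u hu
  have hGs := h.contDiffAt_gradC hu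
  have key : ∀ v, ∃ z, v = z + (dirD v (meanC X N) u / gradSq X N u) • gradV X N u ∧
      dirD z (meanC X N) u = 0 := by
    intro v
    refine ⟨v - (dirD v (meanC X N) u / gradSq X N u) • gradV X N u, by abel, ?_⟩
    rw [dirD_sub_dir, dirD_smul_dir, h.dirD_gradV_meanC hu, smul_eq_mul]
    field_simp
    ring
  have hdw : ∀ v, dirD v (gradSq X N) u = dirD (gradV X N u) (gradSq X N) u / gradSq X N u
      * dirD v (meanC X N) u := by
    intro v
    obtain ⟨z, hz, hz0⟩ := key v
    conv_lhs => rw [hz]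
    rw [dirD_add_dir, dirD_smul_dir, (h.dirD_gradC_of_orth hb hf hw hA hu hz0).1, smul_eq_mul]
    ring
  have hdw2 : ∀ v, dirD v (gradSq X N) u = 2 * ⟪dirD v (gradC X N) u, gradC X N u⟫_ℝ := by
    intro v
    have := dirD_inner hGs hGs v
    rw [real_inner_comm (dirD v (gradC X N) u)] at this
    refine Eq.trans this ?_
    ring
  obtain ⟨w₁, hw₁⟩ : ∃ w₁, w₁ = dirD (gradV X N u) (gradSq X N) u / gradSq X N u := ⟨_, rfl⟩
  rw [← hw₁] at hdw
  -- The components along N and X come from differentiating ⟨N, grad f⟩ = 0 and ⟨X, grad f⟩ = 0; the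
  -- tangential one is symmetry of the Hessian together with dw = w₁ df.
  have hξ : dirD (gradV X N u) (gradC X N) u = (w₁ / 2) • gradC X N u
      + (gradSq X N u * (-(meanC X N u) / 2)) • N u - gradSq X N u • X u := by
    refine h.ext_inner hu ?_ ?_ fun v => ?_
    · have h1 := dirD_eq_zero_of_const h.isOpen hu (fun x hx => h.inner_N_gradC hx) (gradV X N u)
      rw [dirD_inner (h.smoothN u hu) hGs] at h1
      have h2 : dirD (gradV X N u) N u = (meanC X N u / 2) • gradC X N u := by
        have h3 := h.DX_shape hu (gradV X N u)
        rw [hA u hu, h.dirD_gradV_meanC hu, div_mul_cancel₀ _ hwu, ← add_smul, dirD_smul_dir,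
          h.DX_gradV hu, ← add_mul, hcb] at h3
        rw [← neg_eq_iff_eq_neg] at h3
        rw [← h3, ← neg_smul]
        congr 1
        ring
      have h4 : ⟪gradC X N u, gradC X N u⟫_ℝ = gradSq X N u := rfl
      rw [h2, inner_smul_left, conj_trivial, h4] at h1
      simp only [inner_add_right, inner_sub_right, inner_smul_right, h.inner_N_gradC hu,
        h.NN u hu, real_inner_comm (X u) (N u), h.XN u hu]
      linarith
    · have h1 := dirD_eq_zero_of_const h.isOpen hu (fun x hx => h.inner_X_gradC hx) (gradV X N u)
      rw [dirD_inner (h.smoothX u hu) hGs, h.DX_gradV hu] at h1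
      have h4 : ⟪gradC X N u, gradC X N u⟫_ℝ = gradSq X N u := rfl
      rw [h4] at h1
      simp only [inner_add_right, inner_sub_right, inner_smul_right, h.inner_X_gradC hu,
        h.XX u hu, h.XN u hu]
      linarith
    · have h1 : ⟪dirD (gradV X N u) (gradC X N) u, dirD v X u⟫_ℝ
          = ⟪dirD v (gradC X N) u, gradC X N u⟫_ℝ := by
        conv_rhs => rw [← h.DX_gradV hu]
        rw [h.inner_D_gradC hu, h.inner_D_gradC hu, dirD_comm (h.smoothX u hu),
          dirD_comm (h.contDiffAt_meanC hu)]
      have h2 := hdw2 v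
      rw [hdw] at h2
      rw [real_inner_comm, h1]
      simp only [inner_add_right, inner_sub_right, inner_smul_right, h.DXN u hu]
      rw [real_inner_comm (gradC X N u) (dirD v X u), h.inner_gradC hu,
        real_inner_comm (X u) (dirD v X u), h.inner_X_DX hu]
      linarith
  refine ⟨w₁, hdw, fun v => ?_⟩
  obtain ⟨z, hz, hz0⟩ := key v
  have hG := (h.dirD_gradC_of_orth hb hf hw hA hu hz0).2
  have e1 : dirD v (gradC X N) u = dirD z (gradC X N) u
      + (dirD v (meanC X N) u / gradSq X N u) • dirD (gradV X N u) (gradC X N) u := by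
    conv_lhs => rw [hz]
    rw [dirD_add_dir, dirD_smul_dir]
  have e2 : dirD v X u = dirD z X u + (dirD v (meanC X N) u / gradSq X N u) • gradC X N u := by
    conv_lhs => rw [hz]
    rw [dirD_add_dir, dirD_smul_dir, h.DX_gradV hu]
  rw [e1, hG, hξ, e2]
  match_scalars <;> field_simp
  ring

end Patch

/-! ### Exclusion of nonconstant mean curvature -/

namespace Patch

variable {X N : Euc m → F} {U : Set (Euc m)} (h : Patch X N U)

include h

theorem false_of_gradSq_ne_zero (hU : IsPreconnected U) (hne : U.Nonempty)
    (hbi : ∀ u ∈ U, bitension (inducedMetric X) X u = 0)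
    (hs : ∀ u ∈ U, (principalCurvatures X u (N u)).encard ≤ 2)
    (hf : ∀ u ∈ U, meanC X N u ≠ 0) (hw : ∀ u ∈ U, gradSq X N u ≠ 0) : False := by
  obtain ⟨c, hc, hq⟩ := h.exists_quadratic hU hne hbi hs hf hw
  have hA := fun u (hu : u ∈ U) v => h.shape_eq_of_quadratic hc hbi hf hw hq hu v
  obtain ⟨b, hb⟩ : ∃ b : ℝ, b = -1 / 2 - c := ⟨_, rfl⟩
  rw [← hb] at hA
  have hb0 : b ≠ 0 := by linarith
  obtain ⟨u₀, hu₀⟩ := hne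
  -- the trace of the shape operator determines `c`
  have hcm : c * (m - 1) = 3 / 2 := by
    have h1 := trace_scalar_add_rankOne (hA u₀ hu₀)
    have hf0 := hf u₀ hu₀
    rw [h.trace_shape hu₀, h.dirD_gradV_meanC hu₀, div_mul_cancel₀ _ (hw u₀ hu₀)] at h1
    apply mul_right_cancel₀ hf0
    rw [hb] at h1
    linarith
  have hm : (1 : ℝ) < m := by
    by_contra hlt
    have : c * (m - 1) ≤ 0 := mul_nonpos_of_nonneg_of_nonpos hc.le (by linarith)
    linarith
  have hm2 : 1 < m := by exact_mod_cast hm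
  choose! w₁ hdw hDG using fun u (hu : u ∈ U) => h.dirD_gradC hb0 (by linarith) hf hw hA hu
  obtain ⟨r, hr⟩ : ∃ r : ℝ, r = c / b := ⟨_, rfl⟩
  rw [← hr] at hDG
  -- Chosen so that |A|² = c₂ f².
  obtain ⟨c₂, hc₂⟩ : ∃ c₂ : ℝ, c₂ = c - 1 / 2 + m * c / 2 := ⟨_, rfl⟩
  have hrm : r = -3 / (m + 2) := by
    have h1 : (m : ℝ) + 2 ≠ 0 := by linarith
    rw [hr, div_eq_div_iff hb0 h1, hb]
    linear_combination hcm
  -- the normal equation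
  have hw₁ : ∀ x ∈ U, w₁ x = 2 * ((c₂ * meanC X N x ^ 2 - m) * meanC X N x
      - (m - 1) * (r * gradSq X N x / meanC X N x)) := by
    intro x hx
    have hfx := hf x hx
    have hwx := hw x hx
    have h1 := h.laplacian_meanC hx (hbi x hx)
    rw [trace_sq_of_quadratic (hq x hx), h.trace_shape hx, finrank_euclideanSpace_fin] at h1
    let ℓ : Euc m →ₗ[ℝ] ℝ := (fderiv ℝ (meanC X N) x : Euc m →ₗ[ℝ] ℝ)
    -- T is the tangential part of the derivative of grad f; its trace (m - 1) r w/f + w₁/2 is the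
    -- left side of the normal equation.
    let T : Euc m →ₗ[ℝ] Euc m := (r * gradSq X N x / meanC X N x) • LinearMap.id
      + ((w₁ x / 2 - r * gradSq X N x / meanC X N x) / gradSq X N x) • ℓ.smulRight (gradV X N x)
    have hT : ∀ v, T v = (r * gradSq X N x / meanC X N x) • v
        + ((w₁ x / 2 - r * gradSq X N x / meanC X N x) / gradSq X N x * dirD v (meanC X N) x)
          • gradV X N x := by
      intro v
      simp only [T, LinearMap.add_apply, LinearMap.smul_apply, LinearMap.id_apply,
        LinearMap.smulRight_apply, smul_smul]
      rfl
    have h2 := h.trace_eq_sum hx (T := T) (P := fun v => dirD v (gradC X N) x) (by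
      intro v w
      rw [hDG x hx, hT, dirD_add_dir, dirD_smul_dir, dirD_smul_dir, h.DX_gradV hx]
      simp only [inner_add_left, inner_sub_left, inner_smul_left, conj_trivial, h.inner_N_DX hx,
        h.inner_X_DX hx]
      ring)
    rw [trace_scalar_add_rankOne hT, h.dirD_gradV_meanC hx, div_mul_cancel₀ _ hwx] at h2
    have h3 := h2.trans h1
    rw [hc₂]
    linear_combination 2 * h3
  have hρs : ∀ x ∈ U, ContDiffAt ℝ ∞ (fun x => r * gradSq X N x / meanC X N x) x := fun x hx =>
    (contDiffAt_const.mul (h.contDiffAt_gradSq hx)).div (h.contDiffAt_meanC hx) (hf x hx)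
  have hdρ : ∀ x ∈ U, ∀ v, dirD v (fun x => r * gradSq X N x / meanC X N x) x
      = r * ((w₁ x * meanC X N x - gradSq X N x) / meanC X N x ^ 2) * dirD v (meanC X N) x := by
    intro x hx v
    rw [dirD_div (c := fun x => r * gradSq X N x) (contDiffAt_const.mul (h.contDiffAt_gradSq hx))
      (h.contDiffAt_meanC hx) (hf x hx), dirD_const_mul _ (h.contDiffAt_gradSq hx), hdw x hx]
    ring
  -- smoothness of the coefficients
  let w₂ : Euc m → ℝ := fun x => 2 * ((c₂ * meanC X N x ^ 2 - m) * meanC X N x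
      - (m - 1) * (r * gradSq X N x / meanC X N x))
  have hw₂s : ∀ x ∈ U, ContDiffAt ℝ ∞ w₂ x := fun x hx =>
    contDiffAt_const.mul ((((contDiffAt_const.mul ((h.contDiffAt_meanC hx).pow 2)).sub
      contDiffAt_const).mul (h.contDiffAt_meanC hx)).sub (contDiffAt_const.mul (hρs x hx)))
  have hdw₂ : ∀ x ∈ U, ∀ v, dirD v (meanC X N) x = 0 → dirD v w₂ x = 0 := by
    intro x hx v hv
    have hfx := h.contDiffAt_meanC hx
    have s1 : ContDiffAt ℝ ∞ (fun x => c₂ * meanC X N x ^ 2 - m) x :=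
      (contDiffAt_const.mul (hfx.pow 2)).sub contDiffAt_const
    have s2 : ContDiffAt ℝ ∞ (fun x => meanC X N x ^ 2) x := hfx.pow 2
    have d2 : dirD v (fun x => meanC X N x ^ 2) x = 0 := by
      have := dirD_mul hfx hfx v
      simp only [← pow_two] at this
      rw [this, hv]; ring
    rw [dirD_const_mul 2 (c := fun x => (c₂ * meanC X N x ^ 2 - m) * meanC X N x
      - (m - 1) * (r * gradSq X N x / meanC X N x))
        ((s1.mul hfx).sub (contDiffAt_const.mul (hρs x hx))),
      dirD_sub (V := fun x => (c₂ * meanC X N x ^ 2 - m) * meanC X N x)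
        (W := fun x => (m - 1) * (r * gradSq X N x / meanC X N x)) (s1.mul hfx)
        (contDiffAt_const.mul (hρs x hx)), dirD_mul s1 hfx,
      dirD_sub (V := fun x => c₂ * meanC X N x ^ 2) (W := fun _ => (m : ℝ))
        (contDiffAt_const.mul s2) contDiffAt_const, dirD_const_mul _ s2, d2, hv, dirD_const,
      dirD_const_mul _ (hρs x hx), hdρ x hx, hv]
    ring
  -- σ is built from the explicit `w₂`, because `w₁` is chosen pointwise and carries no smoothness;
  -- the two agree on U.
  let σ : Euc m → ℝ := fun x => (w₂ x / 2 - r * gradSq X N x / meanC X N x) / gradSq X N x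
  have hnum : ∀ x ∈ U, ContDiffAt ℝ ∞ (fun x => w₂ x / 2 - r * gradSq X N x / meanC X N x) x :=
    fun x hx => ((hw₂s x hx).div_const 2).sub (hρs x hx)
  have hσs : ∀ x ∈ U, ContDiffAt ℝ ∞ σ x := fun x hx =>
    (hnum x hx).div (h.contDiffAt_gradSq hx) (hw x hx)
  have hdσ : ∀ x ∈ U, ∀ v, dirD v (meanC X N) x = 0 → dirD v σ x = 0 := by
    intro x hx v hv
    have e : dirD v (fun x => w₂ x / 2) x = 0 := by
      have := dirD_const_mul (1 / 2) (hw₂s x hx) v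
      rw [hdw₂ x hx v hv, mul_zero] at this
      rw [← this]
      congr 1
      funext y
      ring
    rw [dirD_div (hnum x hx) (h.contDiffAt_gradSq hx) (hw x hx),
      dirD_sub (V := fun x => w₂ x / 2) ((hw₂s x hx).div_const 2) (hρs x hx), e, hdρ x hx, hv,
      hdw x hx, hv]
    ring
  let R : Euc m → F := fun x => σ x • gradC X N x + (-(meanC X N x) / 2) • N x - X x
  have hls : ∀ x ∈ U, ContDiffAt ℝ ∞ (fun x => -(meanC X N x) / 2) x := fun x hx =>
    (h.contDiffAt_meanC hx).neg.div_const 2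
  have hRs : ∀ x ∈ U, ContDiffAt ℝ ∞ R x := fun x hx =>
    (((hσs x hx).smul (h.contDiffAt_gradC hx)).add ((hls x hx).smul (h.smoothN x hx))).sub
      (h.smoothX x hx)
  have hDG' : ∀ v, ∀ x ∈ U, dirD v (gradC X N) x
      = (r * gradSq X N x / meanC X N x) • dirD v X x + dirD v (meanC X N) x • R x := by
    intro v x hx
    rw [hDG x hx, hw₁ x hx]
  -- the Gauss equation
  refine false_of_mean_curvature_system h.isOpen hu₀ (μ := m) (r := r) (c := c) (c₂ := c₂) hm hrm
    (fun x hx => h.contDiffAt_meanC hx) (fun x hx => h.contDiffAt_gradSq hx) hf hw (gradV X N)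
    (fun x hx => by rw [h.dirD_gradV_meanC hx]; exact hw x hx) hdw hw₁ fun x hx => ?_
  have hX := h.smoothX x hx
  have hfs := h.contDiffAt_meanC hx
  have hDDG : ∀ a d, dirD d (dirD a (gradC X N)) x
      = dirD d (fun x => r * gradSq X N x / meanC X N x) x • dirD a X x
        + (r * gradSq X N x / meanC X N x) • dirD d (dirD a X) x
        + (dirD d (dirD a (meanC X N)) x • R x + dirD a (meanC X N) x • dirD d R x) := by
    intro a d
    rw [dirD_congr h.isOpen hx (hDG' a) d,
      dirD_add (V := fun x => (r * gradSq X N x / meanC X N x) • dirD a X x)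
        (W := fun x => dirD a (meanC X N) x • R x) ((hρs x hx).smul (hX.dirD a))
        ((hfs.dirD a).smul (hRs x hx)),
      dirD_smul (hρs x hx) (hX.dirD a), dirD_smul (hfs.dirD a) (hRs x hx)]
  -- A nonzero direction orthogonal to grad f exists because m > 1.
  obtain ⟨v, hv0, hv⟩ : ∃ v : Euc m, v ≠ 0 ∧ dirD v (meanC X N) x = 0 := by
    have h1 : LinearMap.ker (fderiv ℝ (meanC X N) x : Euc m →ₗ[ℝ] ℝ) ≠ ⊥ :=
      LinearMap.ker_ne_bot_of_finrank_lt (by simpa using hm2)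
    obtain ⟨v, hv, hv0⟩ := Submodule.exists_mem_ne_zero_of_ne_bot h1
    exact ⟨v, hv0, hv⟩
  -- Commuting the derivatives of grad f along grad f and v; the coefficients of dX(v) give the
  -- required scalar equation.
  have h1 := dirD_comm (h.contDiffAt_gradC hx) (gradV X N x) v
  rw [hDDG, hDDG, hv, h.dirD_gradV_meanC hx, dirD_comm hX v, dirD_comm hfs v, hdρ x hx, hdρ x hx,
    hv, h.dirD_gradV_meanC hx, mul_zero, zero_smul, zero_smul, zero_add, add_zero] at h1
  have hDR : dirD v R x = (σ x * (r * gradSq X N x / meanC X N x)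
      + c * meanC X N x ^ 2 / 2 - 1) • dirD v X x := by
    have e1 : dirD v (fun x => -(meanC X N x) / 2) x = 0 := by
      have := dirD_const_mul (-1 / 2) hfs v
      rw [hv, mul_zero] at this
      rw [← this]
      congr 1
      funext y
      ring
    have e2 : dirD v N x = -((c * meanC X N x) • dirD v X x) := by
      rw [← neg_eq_iff_eq_neg, ← h.DX_shape hx, hA x hx, hv, mul_zero, zero_smul, add_zero,
        dirD_smul_dir]
    have sG : ContDiffAt ℝ ∞ (fun x => σ x • gradC X N x) x :=
      (hσs x hx).smul (h.contDiffAt_gradC hx)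
    have sN : ContDiffAt ℝ ∞ (fun x => (-(meanC X N x) / 2) • N x) x :=
      (hls x hx).smul (h.smoothN x hx)
    rw [dirD_sub (V := fun x => σ x • gradC X N x + (-(meanC X N x) / 2) • N x) (sG.add sN) hX,
      dirD_add sG sN, dirD_smul (hσs x hx) (h.contDiffAt_gradC hx),
      dirD_smul (hls x hx) (h.smoothN x hx), hdσ x hx v hv, e1, e2, hDG' v x hx, hv]
    module
  have hX0 : dirD v X x ≠ 0 := fun h0 =>
    hv0 (h.DX_injective hx (h0.trans (dirD_zero_dir X x).symm))
  rw [hDR] at h1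
  have h2 : (r * ((w₁ x * meanC X N x - gradSq X N x) / meanC X N x ^ 2) * gradSq X N x)
      • dirD v X x = (gradSq X N x * (σ x * (r * gradSq X N x / meanC X N x)
      + c * meanC X N x ^ 2 / 2 - 1)) • dirD v X x := by
    rw [mul_smul (gradSq X N x)]
    have h3 := congrArg (fun y => y - (r * gradSq X N x / meanC X N x) •
      dirD (gradV X N x) (dirD v X) x - dirD (gradV X N x) (dirD v (meanC X N)) x • R x) h1
    convert h3 using 1 <;> abel
  have h3 := smul_left_injective ℝ hX0 h2
  have h4 : σ x = (w₁ x / 2 - r * gradSq X N x / meanC X N x) / gradSq X N x := by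
    simp only [σ, w₂, hw₁ x hx]
  rw [h4] at h3
  apply mul_right_cancel₀ (hw x hx)
  linear_combination h3

/-- A biharmonic patch with at most two principal curvatures has constant mean curvature. -/
theorem dirD_meanC_eq_zero
    (hbi : ∀ u ∈ U, bitension (inducedMetric X) X u = 0)
    (hs : ∀ u ∈ U, (principalCurvatures X u (N u)).encard ≤ 2) {u : Euc m} (hu : u ∈ U)
    (v : Euc m) : dirD v (meanC X N) u = 0 := by
  by_contra hne
  have hopen : ∀ y ∈ U, dirD v (meanC X N) y ≠ 0 → ∃ r > 0, ∀ x ∈ Metric.ball y r,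
      x ∈ U ∧ dirD v (meanC X N) x ≠ 0 := by
    intro y hy hny
    have h1 : ∀ᶠ x in nhds y, x ∈ U ∧ dirD v (meanC X N) x ≠ 0 :=
      (h.isOpen.eventually_mem hy).and
        (((h.contDiffAt_meanC hy).dirD v).continuousAt.eventually_ne hny)
    obtain ⟨r, hr, hball⟩ := Metric.eventually_nhds_iff_ball.1 h1
    exact ⟨r, hr, hball⟩
  obtain ⟨r, hr, hball⟩ := hopen u hu hne
  -- f cannot vanish on the whole ball, where its derivative along v has no zero; a smaller ball
  -- then avoids the zeros of both f and grad f.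
  have hex : ∃ y ∈ Metric.ball u r, meanC X N y ≠ 0 := by
    by_contra hall
    push Not at hall
    exact hne (dirD_eq_zero_of_const Metric.isOpen_ball (Metric.mem_ball_self hr) hall v)
  obtain ⟨y, hy, hfy⟩ := hex
  have h1 : ∀ᶠ x in nhds y, x ∈ Metric.ball u r ∧ meanC X N x ≠ 0 :=
    (Metric.isOpen_ball.eventually_mem hy).and
      ((h.contDiffAt_meanC (hball y hy).1).continuousAt.eventually_ne hfy)
  obtain ⟨s, hs0, hball2⟩ := Metric.eventually_nhds_iff_ball.1 h1
  have hsub : Metric.ball y s ⊆ U := fun x hx => (hball x (hball2 x hx).1).1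
  have h' := h.mono Metric.isOpen_ball hsub
  refine h'.false_of_gradSq_ne_zero (convex_ball y s).isPreconnected
    ⟨y, Metric.mem_ball_self hs0⟩ (fun x hx => hbi x (hsub hx)) (fun x hx => hs x (hsub hx))
    (fun x hx => (hball2 x hx).2) fun x hx h0 => (hball x (hball2 x hx).1).2 ?_
  rw [← h'.inner_gradC hx, inner_self_eq_zero.1 h0, inner_zero_left]

end Patch

end Patches

/-! ### Patches of constant mean curvature -/

section Patches

variable {m : ℕ} {F : Type*} [NormedAddCommGroup F] [InnerProductSpace ℝ F]

/-- The covariant derivative of the second fundamental form, up to sign. -/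
def codForm (X N : Euc m → F) (u a v w : Euc m) : ℝ :=
  ⟪dirD a (dirD v N) u, dirD w X u⟫_ℝ - ⟪dirD a (dirD v X) u, dirD w N u⟫_ℝ

/-- The endomorphism of the ambient space exchanging `X` and `N`, and mapping `dX` to `dN`. -/
def reflect (X N : Euc m → F) (u : Euc m) : F →ₗ[ℝ] F where
  toFun y := ⟪X u, y⟫_ℝ • N u + ⟪N u, y⟫_ℝ • X u + ∑ i, ⟪dualFrame X i u, y⟫_ℝ • pd i N u
  map_add' y z := by
    simp only [inner_add_right, add_smul, Finset.sum_add_distrib]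
    abel
  map_smul' r y := by
    simp only [inner_smul_right, mul_smul, Finset.smul_sum, RingHom.id_apply, smul_add]

theorem reflect_apply (X N : Euc m → F) (u : Euc m) (y : F) : reflect X N u y
    = ⟪X u, y⟫_ℝ • N u + ⟪N u, y⟫_ℝ • X u + ∑ i, ⟪dualFrame X i u, y⟫_ℝ • pd i N u := rfl

namespace Patch

variable {X N : Euc m → F} {U : Set (Euc m)} (h : Patch X N U)

include h

theorem trace_shape_sq_of_const {f₀ : ℝ} (hf₀ : f₀ ≠ 0) (hf : ∀ u ∈ U, meanC X N u = f₀)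
    {u : Euc m} (hu : u ∈ U) (hbi : bitension (inducedMetric X) X u = 0) :
    LinearMap.trace ℝ (Euc m) (shape X N u * shape X N u) = m := by
  have h1 := h.laplacian_meanC hu hbi
  have h2 : ∀ x ∈ U, gradC X N x = 0 := by
    intro x hx
    refine Finset.sum_eq_zero fun k _ => ?_
    rw [pd_eq_dirD, dirD_eq_zero_of_const h.isOpen hx hf, zero_smul]
  have h3 : ∀ i, pd i (gradC X N) u = 0 := fun i => dirD_eq_zero_of_const h.isOpen hu h2 _
  simp only [h3, inner_zero_left, Finset.sum_const_zero] at h1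
  rw [hf u hu] at h1
  have := (mul_eq_zero.1 h1.symm).resolve_right hf₀
  linarith

/-- Equality case of (tr A)² ≤ m tr A²: with two curvatures of multiplicities k and m - k the defect
is k(m - k)(a - b)². -/
theorem shape_umbilic {f₀ : ℝ} (hf₀ : f₀ ^ 2 = m ^ 2) (hm : m ≠ 0) {u : Euc m} (hu : u ∈ U)
    (hf : meanC X N u = f₀)
    (htr : LinearMap.trace ℝ (Euc m) (shape X N u * shape X N u) = m)
    (hs : (principalCurvatures X u (N u)).encard ≤ 2) (v : Euc m) :
    shape X N u v = (f₀ / m) • v := by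
  have hm' : (m : ℝ) ≠ 0 := Nat.cast_ne_zero.2 hm
  have htr1 := h.trace_shape hu
  rw [hf] at htr1
  rcases h.shape_two_eigenvalues hu hs with ⟨a, ha⟩ | ⟨a, b, hab, hq, h1, h2⟩
  · have h4 := trace_scalar_add_rankOne (T := shape X N u) (f := fun _ => 0) (u := u) (ξ := 0)
      (r := a) (s := 0) (by simpa using ha)
    rw [htr1, zero_mul, add_zero] at h4
    rw [ha, h4]
    congr 1
    field_simp
  · exfalso
    obtain ⟨k, hk1, hkm, hk⟩ := trace_of_two_eigenvalues hab hq h1 h2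
    rw [trace_sq_of_quadratic hq, htr1] at htr
    rw [htr1] at hk
    rw [finrank_euclideanSpace_fin] at hk hkm htr
    have hk1' : (1 : ℝ) ≤ k := by exact_mod_cast hk1
    have hkm' : (k : ℝ) < m := by exact_mod_cast hkm
    have e1 : (k : ℝ) * (m - k) * (a - b) ^ 2 = 0 := by
      rw [hk] at htr hf₀
      linear_combination m * htr - hf₀
    have : 0 < (k : ℝ) * (m - k) * (a - b) ^ 2 := by
      have h5 : 0 < (a - b) ^ 2 := by
        have := sub_ne_zero.2 hab
        positivity
      have h6 : (0 : ℝ) < m - k := by linarith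
      positivity
    linarith

theorem dirD_umbilic {f₀ : ℝ} (hf₀ : f₀ ^ 2 = m ^ 2) (hm : m ≠ 0) {u : Euc m} (hu : u ∈ U)
    (hA : ∀ v, shape X N u v = (f₀ / m) • v) (v : Euc m) :
    dirD v (fun x => X x + (f₀ / m) • N x) u = 0 := by
  have hm' : (m : ℝ) ≠ 0 := Nat.cast_ne_zero.2 hm
  have hN := h.smoothN u hu
  have h1 := h.DX_shape hu v
  rw [hA, dirD_smul_dir] at h1
  rw [dirD_add (W := fun x => (f₀ / m) • N x) (h.smoothX u hu) (contDiffAt_const.smul hN), dirD_const_smul _ hN,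
    ← neg_eq_iff_eq_neg.2 h1, smul_neg, smul_smul]
  have : f₀ / m * (f₀ / m) = 1 := by
    field_simp
    exact hf₀
  rw [this, one_smul, add_neg_cancel]

theorem continuousOn_trace_shape_cube : ContinuousOn
    (fun u => LinearMap.trace ℝ (Euc m) (shape X N u * shape X N u * shape X N u)) U := by
  have e : ∀ u, LinearMap.trace ℝ (Euc m) (shape X N u * shape X N u * shape X N u)
      = ∑ i, ∑ j, ∑ k, shapeOperator X u (N u) i k * shapeOperator X u (N u) k j *
        shapeOperator X u (N u) j i := by
    intro u
    rw [trace_euc]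
    simp [shape, Matrix.toLpLin_apply, Matrix.mulVec, dotProduct, Matrix.mul_apply,
      Finset.sum_mul]
  have hc : ∀ i j, ContinuousOn (fun u => shapeOperator X u (N u) i j) U := by
    intro i j u hu
    have h1 : ContinuousAt (fun u => -⟪dualFrame X i u, pd j N u⟫_ℝ) u :=
      (((h.contDiffAt_dual hu i).inner ℝ ((h.smoothN u hu).dirD _)).neg :
        ContDiffAt ℝ ∞ _ u).continuousAt
    exact h1.continuousWithinAt.congr (fun x hx => h.shapeOperator_apply hx i j)
      (h.shapeOperator_apply hu i j)
  simp only [e]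
  exact continuousOn_finsetSum _ fun i _ => continuousOn_finsetSum _ fun j _ =>
    continuousOn_finsetSum _ fun k _ => ((hc i k).mul (hc k j)).mul (hc j i)

theorem shape_not_scalar {f₀ : ℝ} (hf₀ : f₀ ^ 2 ≠ m ^ 2) {u : Euc m} (hu : u ∈ U)
    (hf : meanC X N u = f₀)
    (htr : LinearMap.trace ℝ (Euc m) (shape X N u * shape X N u) = m) (a : ℝ) :
    ¬ ∀ v, shape X N u v = a • v := by
  intro ha
  have htr1 := h.trace_shape hu
  rw [hf] at htr1
  have h4 := trace_scalar_add_rankOne (T := shape X N u) (f := fun _ => 0) (u := u) (ξ := 0)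
    (r := a) (s := 0) (by simpa using ha)
  rw [htr1, zero_mul, add_zero] at h4
  have h5 := trace_sq_of_quadratic (A := shape X N u) (s := 2 * a) (p := a * a) (by
    intro v
    rw [ha, ha, smul_smul]
    module)
  rw [htr, htr1, h4, finrank_euclideanSpace_fin] at h5
  apply hf₀
  rw [h4]
  linear_combination -(m : ℝ) * h5

/-- For given k, the values tr A = f₀ and tr A² = m leave finitely many possibilities for a + b,
which tr A³ recovers as a continuous function; ab is then determined by a + b. -/
theorem exists_const_quadratic (hU : IsPreconnected U) (hne : U.Nonempty) {f₀ : ℝ}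
    (hf₀ : f₀ ^ 2 ≠ m ^ 2) (hm : m ≠ 0) (hf : ∀ u ∈ U, meanC X N u = f₀)
    (htr : ∀ u ∈ U, LinearMap.trace ℝ (Euc m) (shape X N u * shape X N u) = m)
    (hs : ∀ u ∈ U, (principalCurvatures X u (N u)).encard ≤ 2) :
    ∃ a b : ℝ, a ≠ b ∧ ∀ u ∈ U,
      ∀ v, shape X N u (shape X N u v) = (a + b) • shape X N u v - (a * b) • v := by
  have hm' : (m : ℝ) ≠ 0 := Nat.cast_ne_zero.2 hm
  have hD : (m : ℝ) - f₀ ^ 2 / m ≠ 0 := by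
    intro h0
    apply hf₀
    field_simp at h0
    linarith
  let t : Euc m → ℝ := fun u =>
    (LinearMap.trace ℝ (Euc m) (shape X N u * shape X N u * shape X N u) - f₀)
      / (m - f₀ ^ 2 / m)
  have hcont : ContinuousOn t U :=
    (h.continuousOn_trace_shape_cube.sub continuousOn_const).div_const _
  have hat : ∀ u ∈ U, ∃ a b : ℝ, a ≠ b ∧
      (∀ v, shape X N u (shape X N u v) = (a + b) • shape X N u v - (a * b) • v) ∧
      t u = a + b ∧ a * b = ((a + b) * f₀ - m) / m ∧ ∃ k : ℕ, k < m ∧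
        (a + b - 2 * f₀ / m) ^ 2 = (m - f₀ ^ 2 / m) * (m - 2 * k) ^ 2 / (k * m * (m - k)) := by
    intro u hu
    have htr1 := h.trace_shape hu
    rw [hf u hu] at htr1
    have htr2 := htr u hu
    rcases h.shape_two_eigenvalues hu (hs u hu) with ⟨a, ha⟩ | ⟨a, b, hab, hq, h1, h2⟩
    · exact absurd ha (h.shape_not_scalar hf₀ hu (hf u hu) htr2 a)
    · have h3 := trace_cube_of_quadratic hq
      have h4 := trace_sq_of_quadratic hq
      obtain ⟨k, hk1, hkm, hk⟩ := trace_of_two_eigenvalues hab hq h1 h2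
      rw [finrank_euclideanSpace_fin] at h4 hk hkm
      rw [htr2, htr1] at h3 h4
      rw [htr1] at hk
      have hk1' : (k : ℝ) ≠ 0 := by
        have : (1 : ℝ) ≤ k := by exact_mod_cast hk1
        linarith
      have hkm' : (m : ℝ) - k ≠ 0 := by
        have : (k : ℝ) < m := by exact_mod_cast hkm
        linarith
      have hp : a * b = ((a + b) * f₀ - m) / m := by
        field_simp
        linarith
      refine ⟨a, b, hab, hq, ?_, hp, k, hkm, ?_⟩
      · simp only [t]
        rw [h3, div_eq_iff hD, hp]
        field_simp
        ring
      · have e1 : (m : ℝ) - f₀ ^ 2 / m = k * (m - k) * (a - b) ^ 2 / m := by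
          field_simp
          rw [hk] at h4 ⊢
          linear_combination (m : ℝ) * h4
        rw [e1, hk]
        field_simp
        ring
  -- ε is the sign of the square root. The index k = 0 does not occur and merely enlarges the finite
  -- set.
  let S : Set ℝ := Set.image2 (fun (k : ℕ) (ε : ℝ) => 2 * f₀ / m
    + ε * √((m - f₀ ^ 2 / m) * (m - 2 * k) ^ 2 / (k * m * (m - k)))) (Set.Iio m) {1, -1}
  have hS : S.Finite := (Set.finite_Iio m).image2 _ (Set.toFinite _)
  have hmem : ∀ u ∈ U, t u ∈ S := by
    intro u hu
    obtain ⟨a, b, _, _, ht, _, k, hkm, hk⟩ := hat u hu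
    rw [ht]
    rcases le_total 0 (a + b - 2 * f₀ / m) with h0 | h0
    · refine ⟨k, hkm, 1, by simp, ?_⟩
      simp only
      rw [← hk, Real.sqrt_sq h0]
      ring
    · refine ⟨k, hkm, -1, by simp, ?_⟩
      simp only
      rw [← hk, Real.sqrt_sq_eq_abs, abs_of_nonpos h0]
      ring
  obtain ⟨u₀, hu₀⟩ := hne
  obtain ⟨a, b, hab, _, ht, hp, _⟩ := hat u₀ hu₀
  refine ⟨a, b, hab, fun u hu => ?_⟩
  obtain ⟨a', b', _, hq', ht', hp', _⟩ := hat u hu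
  have e : a' + b' = a + b := by
    rw [← ht, ← ht', eq_of_mem_finite hU hcont hS hmem hu₀ hu]
  have e' : a' * b' = a * b := by rw [hp, hp', e]
  rw [← e, ← e']
  exact hq'

/-! ### Parallelism of the second fundamental form -/

section Pointwise

variable {u : Euc m} (hu : u ∈ U)
include hu

theorem codForm_comm_left (a v w : Euc m) : codForm X N u a v w = codForm X N u v a w := by
  rw [codForm, codForm, dirD_comm (h.smoothX u hu), dirD_comm (h.smoothN u hu)]

theorem codForm_comm_right (a v w : Euc m) : codForm X N u a v w = codForm X N u a w v :=
  h.codazzi hu a v w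

omit h hu in
theorem codForm_add_left (a a' v w : Euc m) :
    codForm X N u (a + a') v w = codForm X N u a v w + codForm X N u a' v w := by
  simp only [codForm, dirD_add_dir, inner_add_left]
  ring

theorem codForm_add_mid (a v v' w : Euc m) :
    codForm X N u a (v + v') w = codForm X N u a v w + codForm X N u a v' w := by
  simp only [h.codForm_comm_left hu a, codForm_add_left]

omit h hu in
theorem codForm_add_right (a v w w' : Euc m) :
    codForm X N u a v (w + w') = codForm X N u a v w + codForm X N u a v w' := by
  simp only [codForm, dirD_add_dir, inner_add_right]
  ring

omit h hu in
theorem exists_eigen_decomp {a b : ℝ} (hab : a ≠ b)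
    (hq : ∀ v, shape X N u (shape X N u v) = (a + b) • shape X N u v - (a * b) • v)
    (v : Euc m) : ∃ y z, v = y + z ∧ shape X N u y = a • y ∧ shape X N u z = b • z := by
  have hab' : a - b ≠ 0 := sub_ne_zero.2 hab
  refine ⟨(a - b)⁻¹ • (shape X N u v - b • v), (a - b)⁻¹ • (a • v - shape X N u v), ?_, ?_, ?_⟩
  · rw [← smul_add]
    have : shape X N u v - b • v + (a • v - shape X N u v) = (a - b) • v := by module
    rw [this, smul_smul, inv_mul_cancel₀ hab', one_smul]
  · rw [map_smul, map_sub, map_smul, hq, smul_comm a]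
    congr 1
    module
  · rw [map_smul, map_sub, map_smul, hq, smul_comm b]
    congr 1
    module

theorem inner_eigen_orth {a b : ℝ} (hab : a ≠ b) {y z : Euc m} (hy : shape X N u y = a • y)
    (hz : shape X N u z = b • z) : ⟪dirD y X u, dirD z X u⟫_ℝ = 0 := by
  have h1 := h.inner_shape_comm hu y z
  rw [hy, hz, dirD_smul_dir, dirD_smul_dir, inner_smul_left, inner_smul_right, conj_trivial] at h1
  have h2 : (a - b) * ⟪dirD y X u, dirD z X u⟫_ℝ = 0 := by linarith
  exact (mul_eq_zero.1 h2).resolve_left (sub_ne_zero.2 hab)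

theorem dirD_N_of_eigen {a : ℝ} {y : Euc m} (hy : shape X N u y = a • y) :
    dirD y N u = -(a • dirD y X u) := by
  rw [← dirD_smul_dir, ← hy, h.DX_shape hu, neg_neg]

/-- `codForm` is totally symmetric, and of three eigenvectors two belong to the same eigenspace.
Moved to the last two slots, these give the derivative of a constant eigenvalue. -/
theorem codForm_eq_zero {a b : ℝ} (hab : a ≠ b) (hq : ∀ u ∈ U,
      ∀ v, shape X N u (shape X N u v) = (a + b) • shape X N u v - (a * b) • v)
    (d v w : Euc m) : codForm X N u d v w = 0 := by
  have ha : ∀ d v w, shape X N u v = a • v → shape X N u w = a • w → codForm X N u d v w = 0 := by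
    intro d v w hv hw
    have := h.codazzi_eigenspace hu (l := fun _ => a) (n := fun _ => b)
      (fun _ _ => contDiffAt_const) (fun _ _ => contDiffAt_const) hq hab hv hw d
    rw [dirD_const, zero_mul, neg_zero] at this
    exact this
  have hb : ∀ d v w, shape X N u v = b • v → shape X N u w = b • w → codForm X N u d v w = 0 := by
    intro d v w hv hw
    have := h.codazzi_eigenspace hu (l := fun _ => b) (n := fun _ => a)
      (fun _ _ => contDiffAt_const) (fun _ _ => contDiffAt_const)
      (fun x hx v => by rw [hq x hx, add_comm, mul_comm]) hab.symm hv hw d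
    rw [dirD_const, zero_mul, neg_zero] at this
    exact this
  obtain ⟨d₁, d₂, rfl, hd₁, hd₂⟩ := exists_eigen_decomp hab (hq u hu) d
  obtain ⟨v₁, v₂, rfl, hv₁, hv₂⟩ := exists_eigen_decomp hab (hq u hu) v
  obtain ⟨w₁, w₂, rfl, hw₁, hw₂⟩ := exists_eigen_decomp hab (hq u hu) w
  have ha' : ∀ d v w, shape X N u d = a • d → shape X N u w = a • w →
      codForm X N u d v w = 0 := fun d v w hd hw => by
    rw [h.codForm_comm_left hu]; exact ha _ _ _ hd hw
  have hb' : ∀ d v w, shape X N u d = b • d → shape X N u w = b • w →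
      codForm X N u d v w = 0 := fun d v w hd hw => by
    rw [h.codForm_comm_left hu]; exact hb _ _ _ hd hw
  have ha'' : ∀ d v w, shape X N u d = a • d → shape X N u v = a • v →
      codForm X N u d v w = 0 := fun d v w hd hw => by
    rw [h.codForm_comm_right hu]; exact ha' _ _ _ hd hw
  have hb'' : ∀ d v w, shape X N u d = b • d → shape X N u v = b • v →
      codForm X N u d v w = 0 := fun d v w hd hw => by
    rw [h.codForm_comm_right hu]; exact hb' _ _ _ hd hw
  simp only [codForm_add_left, h.codForm_add_mid hu, codForm_add_right]
  rw [ha _ _ _ hv₁ hw₁, ha' d₁ v₂ w₁ hd₁ hw₁, hb'' d₂ v₂ w₁ hd₂ hv₂, ha'' d₁ v₁ w₂ hd₁ hv₁,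
    hb _ _ _ hv₂ hw₂, hb' d₂ v₁ w₂ hd₂ hw₂, ha d₂ v₁ w₁ hv₁ hw₁, hb d₂ v₂ w₂ hv₂ hw₂]
  simp

/-- The inner product of two vectors whose tangential parts lie in different eigenspaces. -/
theorem inner_of_tangential_orth {a b : ℝ} (hab : a ≠ b)
    (hq : ∀ v, shape X N u (shape X N u v) = (a + b) • shape X N u v - (a * b) • v) {P Q : F}
    (hP : ∀ y, shape X N u y = a • y → ⟪P, dirD y X u⟫_ℝ = 0)
    (hQ : ∀ z, shape X N u z = b • z → ⟪Q, dirD z X u⟫_ℝ = 0) :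
    ⟪P, Q⟫_ℝ = ⟪N u, P⟫_ℝ * ⟪N u, Q⟫_ℝ + ⟪X u, P⟫_ℝ * ⟪X u, Q⟫_ℝ := by
  obtain ⟨p, s, t, hp⟩ := h.exists_decomp hu P
  obtain ⟨y, z, hpyz, hy, hz⟩ := exists_eigen_decomp hab hq p
  have h1 := hP y hy
  rw [hp, hpyz, dirD_add_dir] at h1
  simp only [inner_add_left, inner_smul_left, conj_trivial, h.inner_N_DX hu, h.inner_X_DX hu] at h1
  rw [real_inner_comm (dirD y X u) (dirD z X u), h.inner_eigen_orth hu hab hy hz] at h1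
  have h2 : dirD y X u = 0 := (inner_self_eq_zero (𝕜 := ℝ)).1 (by linarith)
  have h3 : P = dirD z X u + s • N u + t • X u := by
    rw [hp, hpyz, dirD_add_dir, h2, zero_add]
  have h4 := hQ z hz
  have hNP : ⟪N u, P⟫_ℝ = s := by
    rw [h3]
    simp only [inner_add_right, inner_smul_right, h.inner_N_DX hu, h.NN u hu,
      real_inner_comm (X u) (N u), h.XN u hu]
    ring
  have hXP : ⟪X u, P⟫_ℝ = t := by
    rw [h3]
    simp only [inner_add_right, inner_smul_right, h.inner_X_DX hu, h.XX u hu, h.XN u hu]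
    ring
  rw [hNP, hXP, h3, inner_add_left, inner_add_left, inner_smul_left, inner_smul_left,
    real_inner_comm, h4]
  simp

end Pointwise

end Patch

/-! ### The Gauss equation for constant principal curvatures -/

namespace Patch

variable {X N : Euc m → F} {U : Set (Euc m)} (h : Patch X N U)

include h

theorem dirD_N_add_smul_X (a : ℝ) {u : Euc m} (hu : u ∈ U) (v : Euc m) :
    dirD v (fun x => N x + a • X x) u = dirD v N u + a • dirD v X u := by
  have hX := h.smoothX u hu
  rw [dirD_add (W := fun x => a • X x) (h.smoothN u hu) (contDiffAt_const.smul hX),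
    dirD_const_smul _ hX]

theorem dirD_dirD_N_add_smul_X (a : ℝ) {u : Euc m} (hu : u ∈ U) (v w : Euc m) :
    dirD w (dirD v fun x => N x + a • X x) u
      = dirD w (dirD v N) u + a • dirD w (dirD v X) u := by
  have hX := h.smoothX u hu
  rw [dirD_congr h.isOpen hu (fun x hx => h.dirD_N_add_smul_X a hx v),
    dirD_add (W := fun x => a • dirD v X x) ((h.smoothN u hu).dirD v)
      (contDiffAt_const.smul (hX.dirD v)), dirD_const_smul _ (hX.dirD v)]

theorem smooth_N_add_smul_X (a : ℝ) {u : Euc m} (hu : u ∈ U) :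
    ContDiffAt ℝ ∞ (fun x => N x + a • X x) u :=
  (h.smoothN u hu).add (contDiffAt_const.smul (h.smoothX u hu))

/-- The Gauss equation for two constant principal curvatures. -/
theorem mul_eq_neg_one {a b : ℝ} (hab : a ≠ b) (hq : ∀ u ∈ U,
      ∀ v, shape X N u (shape X N u v) = (a + b) • shape X N u v - (a * b) • v)
    {u : Euc m} (hu : u ∈ U) (ha : ¬ ∀ v, shape X N u v = a • v)
    (hb : ¬ ∀ v, shape X N u v = b • v) : a * b = -1 := by
  have hq' : ∀ u ∈ U,
      ∀ v, shape X N u (shape X N u v) = (b + a) • shape X N u v - (b * a) • v := by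
    intro u hu v
    rw [hq u hu, add_comm, mul_comm]
  obtain ⟨z, hz, hz0⟩ : ∃ z, shape X N u z = a • z ∧ z ≠ 0 := by
    by_contra hall
    push Not at hall
    refine hb fun v => ?_
    obtain ⟨y, z, rfl, hy, hz⟩ := exists_eigen_decomp hab (hq u hu) v
    rw [hall y hy, zero_add, hz]
  obtain ⟨y, hy, hy0⟩ : ∃ y, shape X N u y = b • y ∧ y ≠ 0 := by
    by_contra hall
    push Not at hall
    refine ha fun v => ?_
    obtain ⟨y, z, rfl, hy, hz⟩ := exists_eigen_decomp hab (hq u hu) v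
    rw [hall z hz, add_zero, hy]
  -- second derivatives of `N + aX` are orthogonal to the eigenspace of `a`
  have orth : ∀ {a b : ℝ}, a ≠ b → (∀ u ∈ U,
      ∀ v, shape X N u (shape X N u v) = (a + b) • shape X N u v - (a * b) • v) →
      ∀ x ∈ U, ∀ d v w, shape X N x w = a • w →
        ⟪dirD d (dirD v fun x => N x + a • X x) x, dirD w X x⟫_ℝ = 0 := by
    intro a b hab hq x hx d v w hw
    have h1 := h.codForm_eq_zero hx hab hq d v w
    rw [codForm, h.dirD_N_of_eigen hx hw, inner_neg_right, inner_smul_right] at h1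
    rw [h.dirD_dirD_N_add_smul_X a hx, inner_add_left, inner_smul_left, conj_trivial]
    linarith
  -- The derivative of N + bX annihilates the eigenspace of b, hence takes values in dX of the
  -- eigenspace of a.
  have hYZ : ∀ d v w, ∀ x ∈ U, ⟪dirD d (dirD v fun x => N x + a • X x) x,
      dirD w (fun x => N x + b • X x) x⟫_ℝ = 0 := by
    intro d v w x hx
    obtain ⟨w₁, w₂, rfl, hw₁, hw₂⟩ := exists_eigen_decomp hab (hq x hx) w
    rw [dirD_add_dir, h.dirD_N_add_smul_X b hx, h.dirD_N_add_smul_X b hx,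
      h.dirD_N_of_eigen hx hw₁, h.dirD_N_of_eigen hx hw₂, neg_add_cancel, add_zero,
      inner_add_right, inner_neg_right, inner_smul_right, inner_smul_right,
      orth hab hq x hx d v w₁ hw₁]
    ring
  have hY := h.smooth_N_add_smul_X a hu
  have hZ := h.smooth_N_add_smul_X b hu
  have hD : ∀ d e v w, ⟪dirD d (dirD e (dirD v fun x => N x + a • X x)) u,
      dirD w (fun x => N x + b • X x) u⟫_ℝ
      + ⟪dirD e (dirD v fun x => N x + a • X x) u, dirD d (dirD w fun x => N x + b • X x) u⟫_ℝ
        = 0 := by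
    intro d e v w
    have := dirD_eq_zero_of_const h.isOpen hu (hYZ e v w) d
    rwa [dirD_inner ((hY.dirD v).dirD e) (hZ.dirD w)] at this
  -- The third derivatives of N + aX in `h1` and `h2` agree by symmetry. Subtracting leaves products
  -- of second derivatives, of which only the N and X components contribute, and these yield (ab +
  -- 1)(a - b)² |y|² |z|² = 0.
  have h1 := hD z y y z
  have h2 := hD y z y z
  rw [dirD_comm (hY.dirD y)] at h1
  have key : ∀ d e v w, ⟪dirD d (dirD v fun x => N x + a • X x) u,
      dirD e (dirD w fun x => N x + b • X x) u⟫_ℝ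
      = (-⟪dirD d N u, dirD v N u⟫_ℝ - a * ⟪dirD d N u, dirD v X u⟫_ℝ) *
        (-⟪dirD e N u, dirD w N u⟫_ℝ - b * ⟪dirD e N u, dirD w X u⟫_ℝ)
        + (-⟪dirD d X u, dirD v N u⟫_ℝ - a * ⟪dirD d X u, dirD v X u⟫_ℝ) *
        (-⟪dirD e X u, dirD w N u⟫_ℝ - b * ⟪dirD e X u, dirD w X u⟫_ℝ) := by
    intro d e v w
    rw [h.inner_of_tangential_orth hu hab (hq u hu)
      (fun y hy => orth hab hq u hu d v y hy) (fun z hz => orth hab.symm hq' u hu e w z hz)]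
    simp only [h.dirD_dirD_N_add_smul_X _ hu, inner_add_right, inner_smul_right,
      h.inner_N_DDX hu, h.inner_N_DDN hu, h.inner_X_DDX hu, h.inner_X_DDN hu]
    ring
  rw [key] at h1 h2
  have h0 := h.inner_eigen_orth hu hab hz hy
  simp only [h.dirD_N_of_eigen hu hz, h.dirD_N_of_eigen hu hy, inner_neg_left, inner_neg_right,
    inner_smul_left, inner_smul_right, conj_trivial, h0,
    real_inner_comm (dirD z X u) (dirD y X u)] at h1 h2
  have hny : ⟪dirD y X u, dirD y X u⟫_ℝ ≠ 0 := fun e => hy0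
    (h.DX_injective hu (((inner_self_eq_zero (𝕜 := ℝ)).1 e).trans (dirD_zero_dir X u).symm))
  have hnz : ⟪dirD z X u, dirD z X u⟫_ℝ ≠ 0 := fun e => hz0
    (h.DX_injective hu (((inner_self_eq_zero (𝕜 := ℝ)).1 e).trans (dirD_zero_dir X u).symm))
  have hab' : a - b ≠ 0 := sub_ne_zero.2 hab
  have h3 : (a * b + 1) * ((a - b) ^ 2 * ⟪dirD y X u, dirD y X u⟫_ℝ
      * ⟪dirD z X u, dirD z X u⟫_ℝ) = 0 := by
    linear_combination h2 - h1
  have h4 := (mul_eq_zero.1 h3).resolve_right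
    (mul_ne_zero (mul_ne_zero (pow_ne_zero 2 hab') hny) hnz)
  linarith

/-- With ab = -1, the trace of the quadratic relation reads m = (a + b) f₀ + m, so a + b = 0. -/
theorem shape_involution {a b : ℝ} (hab : a ≠ b) (hq : ∀ u ∈ U,
      ∀ v, shape X N u (shape X N u v) = (a + b) • shape X N u v - (a * b) • v)
    {f₀ : ℝ} (hf₀ : f₀ ^ 2 ≠ m ^ 2) (hf₀' : f₀ ≠ 0) {u : Euc m} (hu : u ∈ U)
    (hf : meanC X N u = f₀)
    (htr : LinearMap.trace ℝ (Euc m) (shape X N u * shape X N u) = m) (v : Euc m) :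
    shape X N u (shape X N u v) = v := by
  have h1 := h.mul_eq_neg_one hab hq hu (h.shape_not_scalar hf₀ hu hf htr a)
    (h.shape_not_scalar hf₀ hu hf htr b)
  have h2 := trace_sq_of_quadratic (hq u hu)
  rw [htr, h1, h.trace_shape hu, hf, finrank_euclideanSpace_fin] at h2
  have h3 : a + b = 0 := (mul_eq_zero.1 (by linarith : (a + b) * f₀ = 0)).resolve_right hf₀'
  rw [hq u hu, h1, h3]
  module

/-! ### The ambient involution exchanging position and normal -/

section Reflect

variable {u : Euc m} (hu : u ∈ U)
include hu

theorem reflect_X : reflect X N u (X u) = N u := by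
  rw [reflect_apply, h.XX u hu, real_inner_comm (X u) (N u), h.XN u hu]
  simp [h.inner_dualFrame_X hu]

theorem reflect_N : reflect X N u (N u) = X u := by
  rw [reflect_apply, h.NN u hu, h.XN u hu]
  simp [h.inner_dualFrame_N hu]

theorem reflect_DX (v : Euc m) : reflect X N u (dirD v X u) = dirD v N u := by
  rw [reflect_apply, h.inner_X_DX hu, h.inner_N_DX hu, dirD_eq_sum N]
  simp [h.inner_dualFrame_DX hu]

theorem reflect_symm (y z : F) : ⟪reflect X N u y, z⟫_ℝ = ⟪y, reflect X N u z⟫_ℝ := by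
  obtain ⟨p, s, t, rfl⟩ := h.exists_decomp hu y
  obtain ⟨p', s', t', rfl⟩ := h.exists_decomp hu z
  simp only [map_add, map_smul, h.reflect_X hu, h.reflect_N hu, h.reflect_DX hu, inner_add_left,
    inner_add_right, inner_smul_left, inner_smul_right, conj_trivial, h.inner_X_DX hu,
    h.inner_N_DX hu, h.XN u hu, h.XX u hu, h.NN u hu, real_inner_comm (X u) (N u),
    h.inner_X_DN hu, h.inner_N_DN hu, real_inner_comm (X u), real_inner_comm (N u)]
  rw [h.inner_DN_DX_comm hu p p', real_inner_comm (dirD p X u) (dirD p' N u)]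

theorem reflect_DN (hA : ∀ v, shape X N u (shape X N u v) = v) (v : Euc m) :
    reflect X N u (dirD v N u) = dirD v X u := by
  have h1 := h.DX_shape hu v
  have h2 := h.DX_shape hu (shape X N u v)
  rw [← neg_eq_iff_eq_neg.2 h1, map_neg, h.reflect_DX hu, ← h2, hA]

theorem reflect_reflect (hA : ∀ v, shape X N u (shape X N u v) = v) (y : F) :
    reflect X N u (reflect X N u y) = y := by
  obtain ⟨p, s, t, rfl⟩ := h.exists_decomp hu y
  simp only [map_add, map_smul, h.reflect_X hu, h.reflect_N hu, h.reflect_DX hu,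
    h.reflect_DN hu hA]

/-- The N component uses A² = Id, the X component the symmetry of A, and the tangential component
the vanishing of `codForm`. -/
theorem reflect_DDX (hA : ∀ v, shape X N u (shape X N u v) = v)
    (hT : ∀ d v w, codForm X N u d v w = 0) (v w : Euc m) :
    reflect X N u (dirD v (dirD w X) u) = dirD v (dirD w N) u := by
  refine h.ext_inner hu ?_ ?_ fun d => ?_
  · rw [← h.reflect_symm hu, h.reflect_N hu, h.inner_X_DDX hu, h.inner_N_DDN hu,
      h.inner_DN_DN hu (s := 0) (p := -1) (by simpa using hA)]
    ring
  · rw [← h.reflect_symm hu, h.reflect_X hu, h.inner_N_DDX hu, h.inner_X_DDN hu,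
      h.inner_DN_DX_comm hu, real_inner_comm]
  · rw [← h.reflect_symm hu, h.reflect_DX hu]
    have := hT v w d
    rw [codForm] at this
    rw [real_inner_comm, real_inner_comm _ (dirD d X u)]
    linarith

theorem smooth_reflect {z : Euc m → F} (hz : ContDiffAt ℝ ∞ z u) :
    ContDiffAt ℝ ∞ (fun x => reflect X N x (z x)) u := by
  have hX := h.smoothX u hu
  have hN := h.smoothN u hu
  simp only [reflect_apply]
  exact (((hX.inner ℝ hz).smul hN).add ((hN.inner ℝ hz).smul hX)).add
    (ContDiffAt.sum fun i _ => ((h.contDiffAt_dual hu i).inner ℝ hz).smul (hN.dirD _))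

theorem dirD_reflect_of_eq_zero {z : Euc m → F} (hz : ContDiffAt ℝ ∞ z u) (hz0 : z u = 0)
    (v : Euc m) : dirD v (fun x => reflect X N x (z x)) u = reflect X N u (dirD v z u) := by
  have hX := h.smoothX u hu
  have hN := h.smoothN u hu
  have key : ∀ {P Q : Euc m → F}, ContDiffAt ℝ ∞ P u → ContDiffAt ℝ ∞ Q u →
      dirD v (fun x => ⟪P x, z x⟫_ℝ • Q x) u = ⟪P u, dirD v z u⟫_ℝ • Q u := by
    intro P Q hP hQ
    rw [dirD_smul (c := fun x => ⟪P x, z x⟫_ℝ) (hP.inner ℝ hz) hQ, dirD_inner hP hz, hz0]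
    simp
  have s1 : ContDiffAt ℝ ∞ (fun x => ⟪X x, z x⟫_ℝ • N x) u := (hX.inner ℝ hz).smul hN
  have s2 : ContDiffAt ℝ ∞ (fun x => ⟪N x, z x⟫_ℝ • X x) u := (hN.inner ℝ hz).smul hX
  have s3 : ∀ i, ContDiffAt ℝ ∞ (fun x => ⟪dualFrame X i x, z x⟫_ℝ • pd i N x) u := fun i =>
    ((h.contDiffAt_dual hu i).inner ℝ hz).smul (hN.dirD _)
  simp only [reflect_apply]
  rw [dirD_add (V := fun x => ⟪X x, z x⟫_ℝ • N x + ⟪N x, z x⟫_ℝ • X x) (s1.add s2)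
    (ContDiffAt.sum fun i _ => s3 i), dirD_add s1 s2, dirD_sum _ (fun i _ => s3 i), key hX hN,
    key hN hX]
  congr 1
  exact Finset.sum_congr rfl fun i _ => key (h.contDiffAt_dual hu i) (hN.dirD _)

/-- The fixed vector y is compared with the field Y that has, in the moving frame, the coefficients
of y at u. The image of Y is explicit, and y - Y vanishes at u, so the dual frame never has to be
differentiated. -/
theorem dirD_reflect (hA : ∀ v, shape X N u (shape X N u v) = v)
    (hT : ∀ d v w, codForm X N u d v w = 0) (y : F) (v : Euc m) :
    dirD v (fun x => reflect X N x y) u = 0 := by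
  have hX := h.smoothX u hu
  have hN := h.smoothN u hu
  obtain ⟨p, s, t, hy⟩ := h.exists_decomp hu y
  let Y : Euc m → F := fun x => dirD p X x + s • N x + t • X x
  have hs : ∀ {V : Euc m → F} (r : ℝ), ContDiffAt ℝ ∞ V u → ContDiffAt ℝ ∞ (fun x => r • V x) u :=
    fun r hV => contDiffAt_const.smul hV
  have hYs : ContDiffAt ℝ ∞ Y u := ((hX.dirD p).add (hs s hN)).add (hs t hX)
  have hDY : dirD v Y u = dirD v (dirD p X) u + s • dirD v N u + t • dirD v X u := by
    rw [dirD_add (V := fun x => dirD p X x + s • N x) ((hX.dirD p).add (hs s hN)) (hs t hX),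
      dirD_add (hX.dirD p) (hs s hN), dirD_const_smul _ hN, dirD_const_smul _ hX]
  have hzs : ContDiffAt ℝ ∞ (fun x => y - Y x) u := contDiffAt_const.sub hYs
  have e : ∀ x ∈ U, reflect X N x y
      = reflect X N x (y - Y x) + (dirD p N x + s • X x + t • N x) := by
    intro x hx
    have : reflect X N x (Y x) = dirD p N x + s • X x + t • N x := by
      simp only [Y, map_add, map_smul, h.reflect_X hx, h.reflect_N hx, h.reflect_DX hx]
    rw [← this, ← map_add, sub_add_cancel]
  rw [dirD_congr h.isOpen hu e, dirD_add (V := fun x => reflect X N x (y - Y x))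
    (h.smooth_reflect hu hzs) (((hN.dirD p).add (hs s hX)).add (hs t hN)),
    h.dirD_reflect_of_eq_zero hu hzs (sub_eq_zero.2 hy),
    dirD_sub contDiffAt_const hYs, dirD_const, hDY,
    dirD_add (V := fun x => dirD p N x + s • X x) ((hN.dirD p).add (hs s hX)) (hs t hN),
    dirD_add (hN.dirD p) (hs s hX), dirD_const_smul _ hN, dirD_const_smul _ hX]
  simp only [zero_sub, map_neg, map_add, map_smul, h.reflect_DX hu, h.reflect_DN hu hA,
    h.reflect_DDX hu hA hT]
  abel

theorem trace_reflect : LinearMap.trace ℝ F (reflect X N u) = -meanC X N u := by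
  have := h.finiteDimensional
  have e : reflect X N u = (innerₗ F (X u)).smulRight (N u) + (innerₗ F (N u)).smulRight (X u)
      + ∑ i, (innerₗ F (dualFrame X i u)).smulRight (pd i N u) := by
    ext y
    simp [reflect_apply, LinearMap.sum_apply]
  rw [e, map_add, map_add, map_sum]
  simp only [LinearMap.trace_smulRight, innerₗ_apply_apply]
  rw [h.XN u hu, real_inner_comm, h.XN u hu, meanC]
  simp

end Reflect

theorem eq_of_dirD_eq_zero (hU : IsPreconnected U) {V : Euc m → F}
    (hV : ∀ u ∈ U, ContDiffAt ℝ ∞ V u) (h0 : ∀ u ∈ U, ∀ v, dirD v V u = 0) {x y : Euc m}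
    (hx : x ∈ U) (hy : y ∈ U) : V x = V y :=
  h.isOpen.is_const_of_fderiv_eq_zero hU
    (fun u hu => (hV u hu).diffAt.differentiableWithinAt)
    (fun u hu => ContinuousLinearMap.ext fun v => h0 u hu v) hx hy

end Patch

end Patches

/-! ### Local unit normals -/

section Normals

variable {m : ℕ} {F : Type*} [NormedAddCommGroup F] [InnerProductSpace ℝ F]

/-- A vector normal at u₀ is projected off X and the tangent space at nearby points; it stays
nonzero near u₀ and can be normalised. -/
theorem exists_patch (hF : Module.finrank ℝ F = m + 2) {X : Euc m → F} {U : Set (Euc m)}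
    (hU : IsOpen U) (hX : ∀ u ∈ U, ContDiffAt ℝ ∞ X u)
    (hinj : ∀ u ∈ U, Function.Injective (fderiv ℝ X u)) (hXX : ∀ u ∈ U, ⟪X u, X u⟫_ℝ = 1)
    {u₀ : Euc m} (hu₀ : u₀ ∈ U) :
    ∃ N : Euc m → F, ∃ r > 0, Metric.ball u₀ r ⊆ U ∧ Patch X N (Metric.ball u₀ r) := by
  have hfd : FiniteDimensional ℝ F := Module.finite_of_finrank_pos (by rw [hF]; omega)
  have hXD : ∀ u ∈ U, ∀ v, ⟪X u, dirD v X u⟫_ℝ = 0 := by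
    intro u hu v
    have h1 := dirD_eq_zero_of_const hU hu hXX v
    rw [dirD_inner (hX u hu) (hX u hu), real_inner_comm] at h1
    linarith
  obtain ⟨n, hn0, hnX, hnD⟩ : ∃ n : F, n ≠ 0 ∧ ⟪X u₀, n⟫_ℝ = 0 ∧
      ∀ v, ⟪dirD v X u₀, n⟫_ℝ = 0 := by
    let W : Submodule ℝ F := LinearMap.range
      ((fderiv ℝ X u₀ : Euc m →ₗ[ℝ] F).coprod (LinearMap.toSpanSingleton ℝ F (X u₀)))
    have hW : Module.finrank ℝ W < Module.finrank ℝ F := by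
      refine lt_of_le_of_lt (LinearMap.finrank_range_le _) ?_
      simp [hF]
    have hW' : Wᗮ ≠ ⊥ := by
      intro h0
      have := Submodule.orthogonal_eq_bot_iff.1 h0
      rw [this, finrank_top] at hW
      exact lt_irrefl _ hW
    obtain ⟨n, hn, hn0⟩ := Submodule.exists_mem_ne_zero_of_ne_bot hW'
    refine ⟨n, hn0, hn _ ⟨(0, 1), by simp⟩, fun v => hn _ ⟨(v, 0), ?_⟩⟩
    simp [dirD]
  let P : Euc m → F := fun u => n - ⟪X u, n⟫_ℝ • X u - ∑ i, ⟪pd i X u, n⟫_ℝ • dualFrame X i u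
  have hPs : ∀ u ∈ U, ContDiffAt ℝ ∞ P u := fun u hu =>
    (contDiffAt_const.sub (((hX u hu).inner ℝ contDiffAt_const).smul (hX u hu))).sub
      (ContDiffAt.sum fun i _ => (((hX u hu).dirD _).inner ℝ contDiffAt_const).smul
        (contDiffAt_dualFrame (hX u hu) (hinj u hu) i))
  have hP0 : P u₀ = n := by
    have : ∀ i, ⟪pd i X u₀, n⟫_ℝ = 0 := fun i => hnD _
    simp [P, this, hnX]
  have hdX : ∀ u ∈ U, ∀ i, ⟪X u, dualFrame X i u⟫_ℝ = 0 := by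
    intro u hu i
    simp only [dualFrame, inner_sum, inner_smul_right, pd_eq_dirD, hXD u hu, mul_zero,
      Finset.sum_const_zero]
  have hXP : ∀ u ∈ U, ⟪X u, P u⟫_ℝ = 0 := by
    intro u hu
    simp only [P, inner_sub_right, inner_sum, inner_smul_right, hdX u hu, hXX u hu]
    simp
  have hDP : ∀ u ∈ U, ∀ j, ⟪pd j X u, P u⟫_ℝ = 0 := by
    intro u hu j
    have h1 : ∀ i, ⟪pd j X u, dualFrame X i u⟫_ℝ = if i = j then 1 else 0 := fun i => by
      rw [real_inner_comm, inner_dualFrame (hinj u hu)]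
    have h2 : ⟪pd j X u, X u⟫_ℝ = 0 := by
      rw [real_inner_comm]; exact hXD u hu _
    simp [P, inner_sub_right, inner_sum, inner_smul_right, h1, h2]
  have hDP' : ∀ u ∈ U, ∀ v, ⟪dirD v X u, P u⟫_ℝ = 0 := by
    intro u hu v
    simp [dirD_eq_sum, sum_inner, inner_smul_left, hDP u hu]
  have hev : ∀ᶠ u in nhds u₀, u ∈ U ∧ P u ≠ 0 :=
    (hU.eventually_mem hu₀).and ((hPs u₀ hu₀).continuousAt.eventually_ne (by rwa [hP0]))
  obtain ⟨r, hr, hball⟩ := Metric.eventually_nhds_iff_ball.1 hev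
  refine ⟨fun u => ‖P u‖⁻¹ • P u, r, hr, fun u hu => (hball u hu).1, hF, Metric.isOpen_ball,
    fun u hu => hX u (hball u hu).1, fun u hu => ?_, fun u hu => hinj u (hball u hu).1,
    fun u hu => hXX u (hball u hu).1, fun u hu => ?_, fun u hu => ?_, fun u hu v => ?_⟩
  · have := hPs u (hball u hu).1
    exact ((this.norm ℝ (hball u hu).2).inv (norm_ne_zero_iff.2 (hball u hu).2)).smul this
  · have := norm_ne_zero_iff.2 (hball u hu).2
    rw [inner_smul_left, inner_smul_right, real_inner_self_eq_norm_sq, conj_trivial]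
    field_simp
  · rw [inner_smul_right, hXP u (hball u hu).1, mul_zero]
  · rw [inner_smul_right, hDP' u (hball u hu).1, mul_zero]

end Normals

/-! ### The tension field as a map on the manifold -/

section Manifolds

variable {m : ℕ} {M : Type*} [TopologicalSpace M] [ChartedSpace (Euc m) M]
  [IsManifold (𝓡 m) ∞ M] {φ : M → UnitSphere (m + 1)}
  {e e' : OpenPartialHomeomorph M (Euc m)}

omit [IsManifold (𝓡 m) ∞ M] in
theorem contDiffAt_localRep (hφ : IsImmersedHypersurface φ)
    (he : e ∈ IsManifold.maximalAtlas (𝓡 m) ∞ M) {u : Euc m} (hu : u ∈ e.target) :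
    ContDiffAt ℝ ∞ (localRep φ e) u := by
  have : Fact (Module.finrank ℝ (Euc (m + 1 + 1)) = m + 1 + 1) := ⟨finrank_euclideanSpace_fin⟩
  have h1 : ContMDiffAt (𝓡 m) (𝓡 m) ∞ e.symm u :=
    (contMDiffOn_symm_of_mem_maximalAtlas he).contMDiffAt (e.open_target.mem_nhds hu)
  have h2 : ContMDiffAt (𝓡 m) 𝓘(ℝ, Euc (m + 2)) ∞ (localRep φ e) u :=
    (contMDiff_coe_sphere (E := Euc (m + 1 + 1)) (n := m + 1)).contMDiffAt.comp u
      (hφ.1.contMDiffAt.comp u h1)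
  exact h2.contDiffAt

omit [IsManifold (𝓡 m) ∞ M] in
theorem fderiv_localRep_injective (hφ : IsImmersedHypersurface φ)
    (he : e ∈ IsManifold.maximalAtlas (𝓡 m) ∞ M) {u : Euc m} (hu : u ∈ e.target) :
    Function.Injective (fderiv ℝ (localRep φ e) u) := by
  have : Fact (Module.finrank ℝ (Euc (m + 1 + 1)) = m + 1 + 1) := ⟨finrank_euclideanSpace_fin⟩
  have h1 : MDifferentiableAt (𝓡 m) (𝓡 m) e.symm u :=
    ((contMDiffOn_symm_of_mem_maximalAtlas he).contMDiffAt
      (e.open_target.mem_nhds hu)).mdifferentiableAt (by simp)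
  have h2 : MDifferentiableAt (𝓡 m) (𝓡 m) e (e.symm u) :=
    ((contMDiffOn_of_mem_maximalAtlas he).contMDiffAt
      (e.open_source.mem_nhds (e.map_target hu))).mdifferentiableAt (by simp)
  have h3 : Function.Injective (mfderiv (𝓡 m) (𝓡 m) e.symm u) := by
    have h4 := mfderiv_comp u h2 h1
    have h5 : (e ∘ e.symm) =ᶠ[nhds u] id :=
      Filter.eventually_of_mem (e.open_target.mem_nhds hu) fun x hx => e.right_inv hx
    rw [h5.mfderiv_eq, mfderiv_id] at h4
    intro a b hab
    have h6 := congrArg (fun L => L a) h4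
    have h7 := congrArg (fun L => L b) h4
    exact h6.trans ((congrArg _ hab).trans h7.symm)
  have h8 : MDifferentiableAt (𝓡 m) (𝓡 (m + 1)) φ (e.symm u) :=
    hφ.1.mdifferentiableAt (by simp)
  have h9 : MDifferentiableAt (𝓡 (m + 1)) 𝓘(ℝ, Euc (m + 1 + 1))
      ((↑) : UnitSphere (m + 1) → Euc (m + 1 + 1)) (φ (e.symm u)) :=
    (contMDiff_coe_sphere (m := ∞)).mdifferentiableAt (by simp)
  have h10 := mfderiv_comp u h9 (h8.comp u h1)
  rw [mfderiv_comp u h8 h1] at h10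
  have h11 : Function.Injective (mfderiv (𝓡 m) 𝓘(ℝ, Euc (m + 1 + 1))
      (((↑) : UnitSphere (m + 1) → Euc (m + 1 + 1)) ∘ φ ∘ e.symm) u) := by
    rw [h10]
    exact (injective_mvfderiv_subtypeVal_sphere (φ (e.symm u))).comp ((hφ.2 _).comp h3)
  rw [mfderiv_eq_fderiv] at h11
  exact h11

omit [IsManifold (𝓡 m) ∞ M] [ChartedSpace (Euc m) M] in
theorem inner_localRep_self (u : Euc m) : ⟪localRep φ e u, localRep φ e u⟫_ℝ = 1 := by
  rw [real_inner_self_eq_norm_sq, localRep, norm_eq_of_mem_sphere]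
  norm_num

omit [IsManifold (𝓡 m) ∞ M] in
theorem exists_patch_localRep (hφ : IsImmersedHypersurface φ)
    (he : e ∈ IsManifold.maximalAtlas (𝓡 m) ∞ M) {u : Euc m} (hu : u ∈ e.target) :
    ∃ N : Euc m → Euc (m + 2), ∃ r > 0, Metric.ball u r ⊆ e.target ∧
      Patch (localRep φ e) N (Metric.ball u r) :=
  exists_patch (by simp) e.open_target (fun _ hx => contDiffAt_localRep hφ he hx)
    (fun _ hx => fderiv_localRep_injective hφ he hx) (fun x _ => inner_localRep_self x) hu

omit [IsManifold (𝓡 m) ∞ M] in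
-- When the normal is pulled back by the transition map ψ, both sides are (tr A) N with the same N,
-- and the two shape operators are conjugate by dψ.
theorem tension_localRep_eq (hφ : IsImmersedHypersurface φ)
    (he : e ∈ IsManifold.maximalAtlas (𝓡 m) ∞ M) (he' : e' ∈ IsManifold.maximalAtlas (𝓡 m) ∞ M)
    {p : M} (hp : p ∈ e.source) (hp' : p ∈ e'.source) :
    tension (inducedMetric (localRep φ e)) (localRep φ e) (e p)
      = tension (inducedMetric (localRep φ e')) (localRep φ e') (e' p) := by
  obtain ⟨N, r, hr, hball, hN⟩ := exists_patch_localRep hφ he' (e'.map_source hp')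
  set X := localRep φ e with hX
  set X' := localRep φ e' with hX'
  let ψ : Euc m → Euc m := e' ∘ e.symm
  let U : Set (Euc m) := e.target ∩ e.symm ⁻¹' (e'.source ∩ e' ⁻¹' Metric.ball (e' p) r)
  have hU : IsOpen U := e.isOpen_inter_preimage_symm
    (e'.isOpen_inter_preimage Metric.isOpen_ball)
  have hpU : e p ∈ U := by
    refine ⟨e.map_source hp, ?_⟩
    simp only [Set.mem_preimage, e.left_inv hp]
    exact ⟨hp', Metric.mem_ball_self hr⟩
  have hψ : ∀ u ∈ U, ContDiffAt ℝ ∞ ψ u := by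
    intro u hu
    have h1 : ContMDiffAt (𝓡 m) (𝓡 m) ∞ e.symm u :=
      (contMDiffOn_symm_of_mem_maximalAtlas he).contMDiffAt (e.open_target.mem_nhds hu.1)
    have h2 : ContMDiffAt (𝓡 m) (𝓡 m) ∞ e' (e.symm u) :=
      (contMDiffOn_of_mem_maximalAtlas he').contMDiffAt (e'.open_source.mem_nhds hu.2.1)
    exact (h2.comp u h1).contDiffAt
  have hXψ : ∀ u ∈ U, X u = X' (ψ u) := by
    intro u hu
    simp only [hX, hX', localRep, ψ, Function.comp_apply, e'.left_inv hu.2.1]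
  have hDX : ∀ u ∈ U, ∀ v, dirD v X u = dirD (fderiv ℝ ψ u v) X' (ψ u) := by
    intro u hu v
    rw [dirD_congr hU hu hXψ]
    have h1 := (hN.smoothX (ψ u) hu.2.2).diffAt
    have := fderiv_comp u h1 (hψ u hu).diffAt
    simp only [dirD]
    exact congrArg (fun L => L v) this
  have hDN : ∀ u ∈ U, ∀ v, dirD v (N ∘ ψ) u = dirD (fderiv ℝ ψ u v) N (ψ u) := by
    intro u hu v
    have h1 := (hN.smoothN (ψ u) hu.2.2).diffAt
    exact congrArg (fun L => L v) (fderiv_comp u h1 (hψ u hu).diffAt)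
  have hpatch : Patch X (N ∘ ψ) U := by
    refine ⟨by simp, hU, fun u hu => contDiffAt_localRep hφ he hu.1, fun u hu =>
      (hN.smoothN (ψ u) hu.2.2).comp u (hψ u hu), fun u hu => fderiv_localRep_injective hφ he hu.1,
      fun u _ => inner_localRep_self u, fun u hu => hN.NN _ hu.2.2, fun u hu => ?_, fun u hu v => ?_⟩
    · rw [hXψ u hu]
      exact hN.XN _ hu.2.2
    · rw [hDX u hu]
      exact hN.DXN _ hu.2.2 _
  have hψp : ψ (e p) = e' p := by simp [ψ, e.left_inv hp]
  have hmem : e' p ∈ Metric.ball (e' p) r := Metric.mem_ball_self hr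
  rw [hpatch.tension_eq hpU, hN.tension_eq hmem, Function.comp_apply, hψp,
    ← hpatch.trace_shape hpU, ← hN.trace_shape hmem]
  congr 1
  have hinj : Function.Injective (fderiv ℝ ψ (e p)) := by
    intro a b hab
    apply hpatch.inj (e p) hpU
    have ha := hDX (e p) hpU a
    have hb := hDX (e p) hpU b
    rw [hab, ← hb] at ha
    exact ha
  let L : Euc m ≃ₗ[ℝ] Euc m :=
    LinearEquiv.ofInjectiveEndo (fderiv ℝ ψ (e p) : Euc m →ₗ[ℝ] Euc m) hinj
  have hL : ∀ v, L v = fderiv ℝ ψ (e p) v := fun v => rfl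
  have hconj : shape X' N (e' p) = L.conj (shape X (N ∘ ψ) (e p)) := by
    ext1 y
    obtain ⟨v, rfl⟩ := L.surjective y
    rw [LinearEquiv.conj_apply_apply, L.symm_apply_apply]
    apply hN.DX_injective hmem
    have h1 := hpatch.DX_shape hpU v
    rw [hDX _ hpU, hDN _ hpU, hψp] at h1
    rw [hN.DX_shape hmem, hL, hL, h1]
  rw [hconj, LinearMap.trace_conj']

/-- The tension field of `φ`, as a map on `M`. -/
def tens (φ : M → UnitSphere (m + 1)) (p : M) : Euc (m + 2) :=
  tension (inducedMetric (localRep φ (chartAt (Euc m) p))) (localRep φ (chartAt (Euc m) p))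
    (chartAt (Euc m) p p)

theorem tension_localRep (hφ : IsImmersedHypersurface φ)
    (he : e ∈ IsManifold.maximalAtlas (𝓡 m) ∞ M) {u : Euc m} (hu : u ∈ e.target) :
    tension (inducedMetric (localRep φ e)) (localRep φ e) u = tens φ (e.symm u) := by
  have := tension_localRep_eq hφ he (IsManifold.chart_mem_maximalAtlas (e.symm u))
    (e.map_target hu) (mem_chart_source (Euc m) (e.symm u))
  rwa [e.right_inv hu] at this

end Manifolds

/-! ### Biharmonic hypersurfaces with at most two principal curvatures -/

section Manifolds

variable {m : ℕ} {M : Type*} [TopologicalSpace M] [ChartedSpace (Euc m) M]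
  [IsManifold (𝓡 m) ∞ M] {φ : M → UnitSphere (m + 1)}

/-- A coordinate patch of constant mean curvature around `p`, contained in `W`. -/
structure CMCChart (φ : M → UnitSphere (m + 1)) (p : M) (W : Set M)
    (e : OpenPartialHomeomorph M (Euc m)) (N : Euc m → Euc (m + 2)) (B : Set (Euc m))
    (f₀ : ℝ) : Prop where
  mem_atlas : e ∈ IsManifold.maximalAtlas (𝓡 m) ∞ M
  mem_source : p ∈ e.source
  mem : e p ∈ B
  preconn : IsPreconnected B
  sub : B ⊆ e.target
  subW : ∀ u ∈ B, e.symm u ∈ W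
  patch : Patch (localRep φ e) N B
  mean : ∀ u ∈ B, meanC (localRep φ e) N u = f₀
  bih : ∀ u ∈ B, bitension (inducedMetric (localRep φ e)) (localRep φ e) u = 0
  curv : ∀ u ∈ B, (principalCurvatures (localRep φ e) u (N u)).encard ≤ 2

theorem exists_cmcChart (hφ : IsImmersedHypersurface φ) (hb : IsBiharmonic φ)
    (hc : AtMostTwoPrincipalCurvatures φ) {W : Set M} (hW : IsOpen W) {p : M} (hp : p ∈ W) :
    ∃ e N B f₀, CMCChart φ p W e N B f₀ := by
  have he := IsManifold.chart_mem_maximalAtlas (I := 𝓡 m) (n := ∞) p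
  set e := chartAt (Euc m) p
  have hps : p ∈ e.source := mem_chart_source (Euc m) p
  obtain ⟨N, r, hr, hball, hN⟩ := exists_patch_localRep hφ he (e.map_source hps)
  have hopen : IsOpen (e.target ∩ e.symm ⁻¹' W) := e.isOpen_inter_preimage_symm hW
  obtain ⟨s, hs, hsub⟩ := Metric.isOpen_iff.1 hopen (e p)
    ⟨e.map_source hps, by simpa [e.left_inv hps] using hp⟩
  let B := Metric.ball (e p) (min r s)
  have hB : B ⊆ Metric.ball (e p) r := Metric.ball_subset_ball (min_le_left _ _)
  have hpatch := hN.mono (U' := B) Metric.isOpen_ball hB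
  have hmem : e p ∈ B := Metric.mem_ball_self (lt_min hr hs)
  have hbB : ∀ u ∈ B, bitension (inducedMetric (localRep φ e)) (localRep φ e) u = 0 :=
    fun u hu => hb e he u (hball (hB hu))
  have hcB : ∀ u ∈ B, (principalCurvatures (localRep φ e) u (N u)).encard ≤ 2 :=
    fun u hu => hc e he u (hball (hB hu)) _ (hpatch.isUnitNormal hu)
  have hpre : IsPreconnected B := (convex_ball _ _).isPreconnected
  refine ⟨e, N, B, meanC (localRep φ e) N (e p), he, hps, hmem, hpre, hB.trans hball,
    fun u hu => (hsub (Metric.ball_subset_ball (min_le_right _ _) hu)).2, hpatch,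
    fun u hu => ?_, hbB, hcB⟩
  exact hpatch.isOpen.is_const_of_fderiv_eq_zero hpre
    (fun u hu => (hpatch.contDiffAt_meanC hu).diffAt.differentiableWithinAt)
    (fun u hu => ContinuousLinearMap.ext fun v => hpatch.dirD_meanC_eq_zero hbB hcB hu v) hu hmem

namespace CMCChart

variable {p : M} {W : Set M} {e : OpenPartialHomeomorph M (Euc m)} {N : Euc m → Euc (m + 2)}
  {B : Set (Euc m)} {f₀ : ℝ} (h : CMCChart φ p W e N B f₀)
include h

theorem tens_eq (hφ : IsImmersedHypersurface φ) {u : Euc m} (hu : u ∈ B) :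
    tens φ (e.symm u) = f₀ • N u := by
  rw [← tension_localRep hφ h.mem_atlas (h.sub hu), h.patch.tension_eq hu, h.mean u hu]

theorem norm_tens (hφ : IsImmersedHypersurface φ) {u : Euc m} (hu : u ∈ B) :
    ‖tens φ (e.symm u)‖ = |f₀| := by
  rw [h.tens_eq hφ hu, norm_smul, (h.patch.isUnitNormal hu).1, mul_one, Real.norm_eq_abs]

omit [IsManifold (𝓡 m) ∞ M] in
/-- What holds on the patch holds near `p`. -/
theorem exists_open {P : M → Prop} (hP : ∀ u ∈ B, P (e.symm u)) :
    ∃ O : Set M, IsOpen O ∧ p ∈ O ∧ ∀ q ∈ O, P q := by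
  refine ⟨e.source ∩ e ⁻¹' B, e.isOpen_inter_preimage h.patch.isOpen, ⟨h.mem_source, h.mem⟩,
    fun q hq => ?_⟩
  have := hP (e q) hq.2
  rwa [e.left_inv hq.1] at this

omit [IsManifold (𝓡 m) ∞ M] in
theorem symm_mem : e.symm (e p) = p := e.left_inv h.mem_source

end CMCChart

variable [ConnectedSpace M]

/-- Passing to the norm removes the sign ambiguity of the local normals; |f₀| is locally constant,
and nonzero because φ is not harmonic. -/
theorem exists_norm_tens_eq (hφ : IsImmersedHypersurface φ) (hb : IsProperBiharmonic φ)
    (hc : AtMostTwoPrincipalCurvatures φ) : ∃ c > 0, ∀ p, ‖tens φ p‖ = c := by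
  have hloc : IsLocallyConstant fun p => ‖tens φ p‖ := by
    rw [IsLocallyConstant.iff_exists_open]
    intro p
    obtain ⟨e, N, B, f₀, h⟩ := exists_cmcChart hφ hb.1 hc isOpen_univ (Set.mem_univ p)
    refine h.exists_open fun u hu => ?_
    have h1 := h.norm_tens hφ h.mem
    rw [h.symm_mem] at h1
    rw [h.norm_tens hφ hu, h1]
  obtain ⟨p, hp⟩ : ∃ p, tens φ p ≠ 0 := by
    by_contra hall
    push Not at hall
    exact hb.2 fun e he u hu => by rw [tension_localRep hφ he hu, hall]
  exact ⟨‖tens φ p‖, norm_pos_iff.2 hp, fun q => hloc.apply_eq_of_preconnectedSpace q p⟩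

omit [ConnectedSpace M] in
theorem inner_tens (hφ : IsImmersedHypersurface φ) (hb : IsProperBiharmonic φ)
    (hc : AtMostTwoPrincipalCurvatures φ) (p : M) : ⟪(φ p : Euc (m + 2)), tens φ p⟫_ℝ = 0 := by
  obtain ⟨e, N, B, f₀, h⟩ := exists_cmcChart hφ hb.1 hc isOpen_univ (Set.mem_univ p)
  have h1 := h.tens_eq hφ h.mem
  have h2 := h.patch.XN _ h.mem
  rw [h.symm_mem] at h1
  rw [localRep, h.symm_mem] at h2
  rw [h1, inner_smul_right, h2, mul_zero]

omit [ConnectedSpace M] in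
/-- A criterion for being an open part of `S`: the hypersurface stays in `S`, and no other
points of the normal spaces near it are in `S`. -/
theorem isOpenPartOf_of_normal (hφ : IsImmersedHypersurface φ) (hb : IsProperBiharmonic φ)
    (hc : AtMostTwoPrincipalCurvatures φ) {c : ℝ} (hc0 : 0 < c) (hn : ∀ p, ‖tens φ p‖ = c)
    {S : Set (Euc (m + 2))} (hS : ∀ p, (φ p : Euc (m + 2)) ∈ S)
    (hS' : ∀ p (s t : ℝ), -1 < s → -1 < t →
      (1 + s) • ((1 / 2 : ℝ) • ((φ p : Euc (m + 2)) + c⁻¹ • tens φ p))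
        + (1 + t) • ((1 / 2 : ℝ) • ((φ p : Euc (m + 2)) - c⁻¹ • tens φ p)) ∈ S → s = 0 ∧ t = 0) :
    IsOpenPartOf φ S := by
  refine ⟨hS, fun W hW => ?_⟩
  have key : ∀ p ∈ W, ∃ O : Set (Euc (m + 2)), IsOpen O ∧ (φ p : Euc (m + 2)) ∈ O ∧
      O ∩ S ⊆ (fun p => (φ p : Euc (m + 2))) '' W := by
    intro p hp
    obtain ⟨e, N, B, f₀, h⟩ := exists_cmcChart hφ hb.1 hc hW hp
    obtain ⟨X, hXdef⟩ : ∃ X, X = localRep φ e := ⟨_, rfl⟩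
    have hpatch : Patch X N B := hXdef ▸ h.patch
    have hf₀ : |f₀| = c := by rw [← h.norm_tens hφ h.mem, hn]
    -- ν = ±1 compares the local normal with the global one, τ/c.
    obtain ⟨ν, hν⟩ : ∃ ν : ℝ, ν = c⁻¹ * f₀ := ⟨_, rfl⟩
    have hν0 : ν ≠ 0 := by
      rw [hν]
      refine mul_ne_zero (inv_ne_zero hc0.ne') ?_
      rintro rfl
      rw [abs_zero] at hf₀
      exact hc0.ne hf₀
    let Y : Euc m → Euc (m + 2) := fun u => (1 / 2 : ℝ) • (X u + ν • N u)
    let Z : Euc m → Euc (m + 2) := fun u => (1 / 2 : ℝ) • (X u - ν • N u)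
    -- As Y + Z = X, this is (1 + s)Y + (1 + t)Z, a displacement in the normal plane. Its
    -- differential at (e p, 0, 0) is onto, so images of neighbourhoods are neighbourhoods.
    let Ψ : Euc m × ℝ × ℝ → Euc (m + 2) := fun x => X x.1 + (x.2.1 • Y x.1 + x.2.2 • Z x.1)
    have hXs := hpatch.smoothX _ h.mem
    have hNs := hpatch.smoothN _ h.mem
    have hYs : ContDiffAt ℝ ∞ Y (e p) := (hXs.add (hNs.const_smul ν)).const_smul (1 / 2 : ℝ)
    have hZs : ContDiffAt ℝ ∞ Z (e p) := (hXs.sub (hNs.const_smul ν)).const_smul (1 / 2 : ℝ)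
    let x₀ : Euc m × ℝ × ℝ := (e p, 0, 0)
    have hfst : ContDiffAt ℝ ∞ (fun x : Euc m × ℝ × ℝ => x.1) x₀ := contDiffAt_fst
    have hs1 : ContDiffAt ℝ ∞ (fun x : Euc m × ℝ × ℝ => x.2.1) x₀ :=
      contDiffAt_fst.comp x₀ contDiffAt_snd
    have ht1 : ContDiffAt ℝ ∞ (fun x : Euc m × ℝ × ℝ => x.2.2) x₀ :=
      contDiffAt_snd.comp x₀ contDiffAt_snd
    have hΨs : ContDiffAt ℝ ∞ Ψ x₀ :=
      (ContDiffAt.comp x₀ hXs hfst).add ((hs1.smul (ContDiffAt.comp x₀ hYs hfst)).add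
        (ht1.smul (ContDiffAt.comp x₀ hZs hfst)))
    have hstrict := hΨs.hasStrictFDerivAt (by simp)
    have hD : ∀ v s t, fderiv ℝ Ψ x₀ (v, s, t)
        = dirD v X (e p) + (s • Y (e p) + t • Z (e p)) := by
      intro v s t
      have dX : HasFDerivAt (fun x : Euc m × ℝ × ℝ => X x.1) _ x₀ :=
        HasFDerivAt.comp (g := X) x₀ hXs.diffAt.hasFDerivAt hasFDerivAt_fst
      have dY : HasFDerivAt (fun x : Euc m × ℝ × ℝ => Y x.1) _ x₀ :=
        HasFDerivAt.comp (g := Y) x₀ hYs.diffAt.hasFDerivAt hasFDerivAt_fst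
      have dZ : HasFDerivAt (fun x : Euc m × ℝ × ℝ => Z x.1) _ x₀ :=
        HasFDerivAt.comp (g := Z) x₀ hZs.diffAt.hasFDerivAt hasFDerivAt_fst
      have ds : HasFDerivAt (fun x : Euc m × ℝ × ℝ => x.2.1) _ x₀ :=
        ((ContinuousLinearMap.fst ℝ ℝ ℝ).comp
          (ContinuousLinearMap.snd ℝ (Euc m) (ℝ × ℝ))).hasFDerivAt
      have dt : HasFDerivAt (fun x : Euc m × ℝ × ℝ => x.2.2) _ x₀ :=
        ((ContinuousLinearMap.snd ℝ ℝ ℝ).comp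
          (ContinuousLinearMap.snd ℝ (Euc m) (ℝ × ℝ))).hasFDerivAt
      have dΨ : HasFDerivAt Ψ _ x₀ := dX.add ((ds.smul dY).add (dt.smul dZ))
      rw [dΨ.fderiv]
      simp [x₀, dirD]
    have hsurj : (fderiv ℝ Ψ x₀).range = ⊤ := by
      rw [LinearMap.range_eq_top]
      intro y
      obtain ⟨v, s, t, hy⟩ := hpatch.exists_decomp h.mem y
      refine ⟨(v, t + s / ν, t - s / ν), ?_⟩
      refine (hD _ _ _).trans ?_
      rw [hy]
      simp only [Y, Z]
      match_scalars <;> field_simp <;> ring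
    have hmap := hstrict.map_nhds_eq_of_surj hsurj
    have hΨ0 : Ψ x₀ = (φ p : Euc (m + 2)) := by
      simp [Ψ, x₀, hXdef, localRep, h.symm_mem]
    -- The bounds s, t > -1 discard the solutions with 1 + s = -1 or 1 + t = -1.
    let T : Set (Euc m × ℝ × ℝ) := B ×ˢ (Set.Ioi (-1 : ℝ) ×ˢ Set.Ioi (-1 : ℝ))
    have hT : T ∈ nhds x₀ :=
      (hpatch.isOpen.prod (isOpen_Ioi.prod isOpen_Ioi)).mem_nhds
        ⟨h.mem, by simp [x₀], by simp [x₀]⟩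
    have hTi : Ψ '' T ∈ nhds (φ p : Euc (m + 2)) := by
      rw [← hΨ0, ← hmap]
      exact Filter.image_mem_map hT
    obtain ⟨O, hOT, hO, hpO⟩ := mem_nhds_iff.1 hTi
    refine ⟨O, hO, hpO, ?_⟩
    rintro x ⟨hxO, hxS⟩
    obtain ⟨⟨u, s, t⟩, ⟨hu, hs, ht⟩, rfl⟩ := hOT hxO
    have ht' := h.tens_eq hφ hu
    have hst := hS' (e.symm u) s t hs ht (by
      convert hxS using 1
      rw [ht', smul_smul c⁻¹ f₀, ← hν]
      simp only [Ψ, Y, Z, hXdef, localRep]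
      module)
    refine ⟨e.symm u, h.subW u hu, ?_⟩
    simp [Ψ, hst.1, hst.2, hXdef, localRep]
  choose! O hO hpO hsub using key
  refine ⟨⋃ p ∈ W, O p, isOpen_biUnion hO, Set.Subset.antisymm ?_ ?_⟩
  · rintro _ ⟨p, hp, rfl⟩
    exact ⟨Set.mem_biUnion hp (hpO p hp), hS p⟩
  · rintro x ⟨hx, hxS⟩
    obtain ⟨p, hp, hxp⟩ := Set.mem_iUnion₂.1 hx
    exact hsub p hp ⟨hxp, hxS⟩

end Manifolds

/-! ### Elementary facts for the model hypersurfaces -/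

section Models

variable {F : Type*} [NormedAddCommGroup F] [InnerProductSpace ℝ F]

theorem norm_eq_one_div_sqrt_two_iff (y : F) : ‖y‖ = 1 / √2 ↔ ⟪y, y⟫_ℝ = 1 / 2 := by
  rw [real_inner_self_eq_norm_sq]
  have h2 : (1 / √2) ^ 2 = (1 / 2 : ℝ) := by
    rw [div_pow, Real.sq_sqrt (by norm_num)]; norm_num
  rw [← h2]
  exact (pow_left_inj₀ (norm_nonneg y) (by positivity) two_ne_zero).symm

theorem two_le_finrank_of_orthogonal {V : Submodule ℝ F} [FiniteDimensional ℝ V] {y z : F}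
    (hy : y ∈ V) (hz : z ∈ V) (hy0 : y ≠ 0) (hz0 : z ≠ 0) (hyz : ⟪y, z⟫_ℝ = 0) :
    2 ≤ Module.finrank ℝ V := by
  by_contra hlt
  obtain ⟨⟨w, hw⟩, hall⟩ := finrank_le_one_iff.1 (by omega : Module.finrank ℝ V ≤ 1)
  obtain ⟨a, ha⟩ := hall ⟨y, hy⟩
  obtain ⟨b, hb⟩ := hall ⟨z, hz⟩
  replace ha : a • w = y := congrArg Subtype.val ha
  replace hb : b • w = z := congrArg Subtype.val hb
  rw [← ha, ← hb, inner_smul_left, inner_smul_right, conj_trivial] at hyz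
  rcases mul_eq_zero.1 hyz with h0 | h0
  · exact hy0 (by rw [← ha, h0, zero_smul])
  · rcases mul_eq_zero.1 h0 with h1 | h1
    · exact hz0 (by rw [← hb, h1, zero_smul])
    · exact hy0 (by rw [← ha, (inner_self_eq_zero (𝕜 := ℝ)).1 h1, smul_zero])

theorem eq_zero_of_sq_add_one {t : ℝ} (ht : -1 < t) (h : (1 + t) ^ 2 = 1) : t = 0 := by
  have : t * (t + 2) = 0 := by linarith
  rcases mul_eq_zero.1 this with h | h <;> linarith

end Models

/-! ### The two cases: hypersphere and Clifford torus -/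

section Manifolds

variable {m : ℕ} {M : Type*} [TopologicalSpace M] [ChartedSpace (Euc m) M]
  [IsManifold (𝓡 m) ∞ M] {φ : M → UnitSphere (m + 1)} [ConnectedSpace M]

/-- With K = τ/m, the vector w = φ + K has zero derivative since A = ±Id. It is constant with |w|² =
2, so φ = (φ - K)/2 + w/2 exhibits the center w/2. -/
theorem isOpenPartOf_smallHypersphere (hφ : IsImmersedHypersurface φ)
    (hb : IsProperBiharmonic φ) (hc : AtMostTwoPrincipalCurvatures φ) (hm : m ≠ 0)
    (hn : ∀ p, ‖tens φ p‖ = m) :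
    ∃ v : Euc (m + 2), ‖v‖ = 1 ∧ IsOpenPartOf φ (smallHypersphere v) := by
  have hm' : (0 : ℝ) < m := by positivity
  let K : M → Euc (m + 2) := fun p => (m : ℝ)⁻¹ • tens φ p
  have hKK : ∀ p, ⟪K p, K p⟫_ℝ = 1 := by
    intro p
    rw [real_inner_self_eq_norm_sq, norm_smul, hn, norm_inv, Real.norm_of_nonneg hm'.le,
      inv_mul_cancel₀ hm'.ne', one_pow]
  have hφK : ∀ p, ⟪(φ p : Euc (m + 2)), K p⟫_ℝ = 0 := by
    intro p
    rw [inner_smul_right, inner_tens hφ hb hc, mul_zero]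
  have hφφ : ∀ p, ⟪(φ p : Euc (m + 2)), (φ p : Euc (m + 2))⟫_ℝ = 1 := by
    intro p
    rw [real_inner_self_eq_norm_sq, norm_eq_of_mem_sphere, one_pow]
  have hloc : IsLocallyConstant fun p => (φ p : Euc (m + 2)) + K p := by
    rw [IsLocallyConstant.iff_exists_open]
    intro p
    obtain ⟨e, N, B, f₀, h⟩ := exists_cmcChart hφ hb.1 hc isOpen_univ (Set.mem_univ p)
    have hf₀ : |f₀| = m := by rw [← h.norm_tens hφ h.mem, hn]
    have hsq : f₀ ^ 2 = (m : ℝ) ^ 2 := by rw [← hf₀, sq_abs]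
    have hf0 : f₀ ≠ 0 := by
      rintro rfl
      rw [abs_zero] at hf₀
      exact hm'.ne hf₀
    have key : ∀ u ∈ B, (φ (e.symm u) : Euc (m + 2)) + K (e.symm u)
        = localRep φ e u + (f₀ / m) • N u := by
      intro u hu
      simp only [K, h.tens_eq hφ hu, smul_smul, localRep]
      rw [div_eq_inv_mul]
    refine h.exists_open fun u hu => ?_
    have h1 := key _ h.mem
    rw [h.symm_mem] at h1
    rw [key u hu, h1]
    refine h.patch.eq_of_dirD_eq_zero h.preconn (V := fun x => localRep φ e x + (f₀ / m) • N x)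
      (fun x hx => (h.patch.smoothX x hx).add ((h.patch.smoothN x hx).const_smul _))
      (fun x hx v => ?_) hu h.mem
    exact h.patch.dirD_umbilic hsq hm hx (fun v => h.patch.shape_umbilic hsq hm hx (h.mean x hx)
      (h.patch.trace_shape_sq_of_const hf0 h.mean hx (h.bih x hx)) (h.curv x hx) v) v
  obtain ⟨p₀⟩ : Nonempty M := inferInstance
  obtain ⟨w, hw⟩ : ∃ w, w = (φ p₀ : Euc (m + 2)) + K p₀ := ⟨_, rfl⟩
  have hwp : ∀ p, (φ p : Euc (m + 2)) + K p = w := fun p =>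
    (hloc.apply_eq_of_preconnectedSpace p p₀).trans hw.symm
  have hww : ⟪w, w⟫_ℝ = 2 := by
    rw [hw]
    simp only [inner_add_left, inner_add_right, hφφ, hKK, hφK, real_inner_comm (φ p₀).1 (K p₀)]
    norm_num
  have h2 : (0 : ℝ) < √2 := by positivity
  have h22 : (1 / √2) * (1 / √2) = (1 / 2 : ℝ) := by
    rw [div_mul_div_comm, Real.mul_self_sqrt (by norm_num)]; norm_num
  have hv : ∀ p, (1 / √2) • ((1 / √2) • w) = (1 / 2 : ℝ) • ((φ p : Euc (m + 2)) + K p) := by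
    intro p
    rw [smul_smul, h22, hwp]
  refine ⟨(1 / √2) • w, ?_, isOpenPartOf_of_normal hφ hb hc hm' hn (fun p => ?_)
    fun p s t hs ht hst => ?_⟩
  · have : ‖w‖ = √2 := by
      rw [norm_eq_sqrt_real_inner, hww]
    rw [norm_smul, this, Real.norm_of_nonneg (by positivity)]
    field_simp
  · refine ⟨(1 / 2 : ℝ) • ((φ p : Euc (m + 2)) - K p), ?_, ?_, ?_⟩
    · rw [← hwp p]
      simp only [inner_add_left, inner_sub_right, inner_smul_left, inner_smul_right, hφφ, hKK,
        hφK, real_inner_comm (φ p).1 (K p)]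
      ring
    · rw [norm_eq_one_div_sqrt_two_iff]
      simp only [inner_sub_left, inner_sub_right, inner_smul_left, inner_smul_right, hφφ, hKK,
        hφK, real_inner_comm (φ p).1 (K p), conj_trivial]
      norm_num
    · rw [hv p]
      module
  · obtain ⟨y, hvy, hy, hyx⟩ := hst
    have hwy : ⟪w, y⟫_ℝ = 0 := by
      rw [inner_smul_left, conj_trivial] at hvy
      exact (mul_eq_zero.1 hvy).resolve_left (by positivity)
    rw [norm_eq_one_div_sqrt_two_iff] at hy
    rw [hv p] at hyx
    have hyK : y = s • ((1 / 2 : ℝ) • ((φ p : Euc (m + 2)) + K p))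
        + (1 + t) • ((1 / 2 : ℝ) • ((φ p : Euc (m + 2)) - K p)) := by
      rw [eq_sub_of_add_eq hyx.symm]
      simp only [K]
      module
    have hs0 : s = 0 := by
      rw [← hwp p, hyK] at hwy
      simp only [inner_add_left, inner_add_right, inner_sub_right, inner_smul_right, hφφ, hKK,
        hφK, real_inner_comm (φ p).1 (K p)] at hwy
      linarith
    refine ⟨hs0, eq_zero_of_sq_add_one ht ?_⟩
    rw [hyK, hs0] at hy
    simp only [zero_smul, zero_add, inner_sub_left, inner_sub_right, inner_smul_left,
      inner_smul_right, hφφ, hKK, hφK, real_inner_comm (φ p).1 (K p), conj_trivial] at hy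
    linarith

/-- Locally R is ±`reflect`, with the sign that turns N into τ/c. Uniqueness on overlaps makes R
locally constant, hence constant. -/
theorem exists_involution (hφ : IsImmersedHypersurface φ)
    (hb : IsProperBiharmonic φ) (hc : AtMostTwoPrincipalCurvatures φ) (hm : m ≠ 0) {c : ℝ}
    (hc0 : 0 < c) (hcm : c ^ 2 ≠ m ^ 2) (hn : ∀ p, ‖tens φ p‖ = c) :
    ∃ R : Euc (m + 2) →ₗ[ℝ] Euc (m + 2), (∀ p, R (φ p) = c⁻¹ • tens φ p) ∧
      (∀ y, R (R y) = y) ∧ (∀ y z, ⟪R y, z⟫_ℝ = ⟪y, R z⟫_ℝ) ∧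
      LinearMap.trace ℝ (Euc (m + 2)) R = -c := by
  have hlocal : ∀ p : M, ∃ R : Euc (m + 2) →ₗ[ℝ] Euc (m + 2), ((∀ y, R (R y) = y) ∧
      (∀ y z, ⟪R y, z⟫_ℝ = ⟪y, R z⟫_ℝ) ∧ LinearMap.trace ℝ (Euc (m + 2)) R = -c) ∧
      ∃ O : Set M, IsOpen O ∧ p ∈ O ∧ ∀ q ∈ O, R (φ q) = c⁻¹ • tens φ q := by
    intro p
    obtain ⟨e, N, B, f₀, h⟩ := exists_cmcChart hφ hb.1 hc isOpen_univ (Set.mem_univ p)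
    have hf₀ : |f₀| = c := by rw [← h.norm_tens hφ h.mem, hn]
    have hsq : f₀ ^ 2 = c ^ 2 := by rw [← hf₀, sq_abs]
    have hf0 : f₀ ≠ 0 := by
      rintro rfl
      rw [abs_zero] at hf₀
      exact hc0.ne hf₀
    have hne : f₀ ^ 2 ≠ m ^ 2 := by rwa [hsq]
    have htr := fun u hu => h.patch.trace_shape_sq_of_const hf0 h.mean (u := u) hu (h.bih u hu)
    obtain ⟨a, b, hab, hq⟩ := h.patch.exists_const_quadratic h.preconn ⟨_, h.mem⟩ hne hm h.mean
      htr h.curv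
    have hA := fun u (hu : u ∈ B) => h.patch.shape_involution hab hq hne hf0 hu (h.mean u hu)
      (htr u hu)
    have hR : ∀ u ∈ B, ∀ y, reflect (localRep φ e) N u y = reflect (localRep φ e) N (e p) y :=
      fun u hu y => h.patch.eq_of_dirD_eq_zero h.preconn
        (V := fun x => reflect (localRep φ e) N x y)
        (fun x hx => h.patch.smooth_reflect hx contDiffAt_const)
        (fun x hx v => h.patch.dirD_reflect hx (hA x hx)
          (fun d v w => h.patch.codForm_eq_zero hx hab hq d v w) y v) hu h.mem
    have hν : (c⁻¹ * f₀) * (c⁻¹ * f₀) = 1 := by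
      have : c ≠ 0 := hc0.ne'
      field_simp
      linarith
    refine ⟨(c⁻¹ * f₀) • reflect (localRep φ e) N (e p), ⟨fun y => ?_, fun y z => ?_, ?_⟩,
      h.exists_open fun u hu => ?_⟩
    · simp only [LinearMap.smul_apply, map_smul, smul_smul, hν,
        h.patch.reflect_reflect h.mem (hA _ h.mem), one_smul]
    · simp only [LinearMap.smul_apply, inner_smul_left, inner_smul_right, conj_trivial,
        h.patch.reflect_symm h.mem]
    · rw [map_smul, h.patch.trace_reflect h.mem, h.mean _ h.mem, smul_eq_mul]
      have : c ≠ 0 := hc0.ne'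
      field_simp
      linarith
    · have h1 := h.patch.reflect_X hu
      rw [hR u hu] at h1
      rw [LinearMap.smul_apply, h.tens_eq hφ hu, smul_smul]
      exact congrArg _ h1
  -- R is known on φ, by differentiation on dφ, and by involutivity on N; these span the ambient
  -- space.
  have huniq : ∀ (R R' : Euc (m + 2) →ₗ[ℝ] Euc (m + 2)), (∀ y, R (R y) = y) →
      (∀ y, R' (R' y) = y) → ∀ (O : Set M), IsOpen O → ∀ p ∈ O,
      (∀ q ∈ O, R (φ q) = c⁻¹ • tens φ q) → (∀ q ∈ O, R' (φ q) = c⁻¹ • tens φ q) → R = R' := by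
    intro R R' hRR hRR' O hO p hp hR hR'
    obtain ⟨e, N, B, f₀, h⟩ := exists_cmcChart hφ hb.1 hc hO hp
    have hf₀ : |f₀| = c := by rw [← h.norm_tens hφ h.mem, hn]
    have hf0 : f₀ ≠ 0 := by
      rintro rfl
      rw [abs_zero] at hf₀
      exact hc0.ne hf₀
    have hν0 : c⁻¹ * f₀ ≠ 0 := mul_ne_zero (inv_ne_zero hc0.ne') hf0
    have hX : ∀ (R : Euc (m + 2) →ₗ[ℝ] Euc (m + 2)), (∀ q ∈ O, R (φ q) = c⁻¹ • tens φ q) →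
        ∀ u ∈ B, R (localRep φ e u) = (c⁻¹ * f₀) • N u := by
      intro R hR u hu
      have h1 := hR _ (h.subW u hu)
      rwa [h.tens_eq hφ hu, smul_smul] at h1
    have hDX : ∀ (R : Euc (m + 2) →ₗ[ℝ] Euc (m + 2)), (∀ q ∈ O, R (φ q) = c⁻¹ • tens φ q) →
        ∀ v, R (dirD v (localRep φ e) (e p)) = (c⁻¹ * f₀) • dirD v N (e p) := by
      intro R hR v
      rw [← dirD_const_smul _ (h.patch.smoothN _ h.mem),
        ← dirD_congr h.patch.isOpen h.mem (hX R hR) v]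
      have h1 := (R.toContinuousLinearMap.hasFDerivAt.comp (e p)
        (h.patch.smoothX _ h.mem).diffAt.hasFDerivAt).fderiv
      exact (congrArg (fun L => L v) h1).symm
    have hN : ∀ (R : Euc (m + 2) →ₗ[ℝ] Euc (m + 2)), (∀ y, R (R y) = y) →
        (∀ q ∈ O, R (φ q) = c⁻¹ • tens φ q) →
        R (N (e p)) = (c⁻¹ * f₀)⁻¹ • localRep φ e (e p) := by
      intro R hRR hR
      have h1 := hX R hR _ h.mem
      rw [eq_inv_smul_iff₀ hν0, ← map_smul, ← h1, hRR]
    ext1 y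
    obtain ⟨v, s, t, rfl⟩ := h.patch.exists_decomp h.mem y
    simp only [map_add, map_smul, hX R hR _ h.mem, hX R' hR' _ h.mem, hDX R hR, hDX R' hR',
      hN R hRR hR, hN R' hRR' hR']
  choose R hR O hO hpO hRO using hlocal
  have hloc : IsLocallyConstant R := by
    rw [IsLocallyConstant.iff_exists_open]
    intro p
    refine ⟨O p, hO p, hpO p, fun q hq => ?_⟩
    exact huniq _ _ (hR q).1 (hR p).1 (O q ∩ O p) ((hO q).inter (hO p)) q ⟨hpO q, hq⟩
      (fun x hx => hRO q x hx.1) (fun x hx => hRO p x hx.2)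
  obtain ⟨p₀⟩ : Nonempty M := inferInstance
  refine ⟨R p₀, fun p => ?_, hR p₀⟩
  rw [hloc.apply_eq_of_preconnectedSpace p₀ p]
  exact hRO p p (hpO p)

/-- V and Vᗮ are the eigenspaces of R for 1 and -1, and φ = (φ + Rφ)/2 + (φ - Rφ)/2. Since dim V -
dim Vᗮ = tr R = -c is nonzero, the dimensions differ. -/
theorem isOpenPartOf_cliffordTorus (hφ : IsImmersedHypersurface φ)
    (hb : IsProperBiharmonic φ) (hc : AtMostTwoPrincipalCurvatures φ) (hm : m ≠ 0) {c : ℝ}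
    (hc0 : 0 < c) (hcm : c ^ 2 ≠ m ^ 2) (hn : ∀ p, ‖tens φ p‖ = c) :
    ∃ m₁ m₂ : ℕ, 1 ≤ m₁ ∧ 1 ≤ m₂ ∧ m₁ + m₂ = m ∧ m₁ ≠ m₂ ∧
      ∃ V : Submodule ℝ (Euc (m + 2)),
        Module.finrank ℝ V = m₁ + 1 ∧ Module.finrank ℝ Vᗮ = m₂ + 1 ∧
        IsOpenPartOf φ (cliffordTorus V) := by
  obtain ⟨R, hRφ, hRR, hRs, hRt⟩ := exists_involution hφ hb hc hm hc0 hcm hn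
  let V : Submodule ℝ (Euc (m + 2)) := LinearMap.eqLocus R LinearMap.id
  have hV : ∀ y, y ∈ V ↔ R y = y := fun y => Iff.rfl
  have hadd : ∀ y, y + R y ∈ V := fun y => by
    rw [hV, map_add, hRR]
    exact add_comm (R y) y
  have hV' : ∀ y, y ∈ Vᗮ ↔ R y = -y := by
    intro y
    constructor
    · intro hy
      have h1 := hy _ (hadd y)
      have h2 : ⟪y + R y, y + R y⟫_ℝ = 0 := by
        have h3 : ⟪y + R y, R y⟫_ℝ = ⟪y + R y, y⟫_ℝ := by
          rw [← hRs, (hV _).1 (hadd y)]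
        rw [inner_add_right, h3, h1, add_zero]
      have h4 := (inner_self_eq_zero (𝕜 := ℝ)).1 h2
      exact eq_neg_of_add_eq_zero_right h4
    · intro hy z hz
      have h1 := hRs z y
      rw [(hV z).1 hz, hy, inner_neg_right] at h1
      linarith
  have hsub : ∀ y, y - R y ∈ Vᗮ := fun y => by
    rw [hV', map_sub, hRR, neg_sub]
  have hsum : Module.finrank ℝ V + Module.finrank ℝ Vᗮ = m + 2 := by
    rw [Submodule.finrank_add_finrank_orthogonal, finrank_euclideanSpace_fin]
  have htrV : 2 * (Module.finrank ℝ V : ℝ) = m + 2 - c := by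
    have hproj : LinearMap.IsProj V ((1 / 2 : ℝ) • (LinearMap.id + R)) := by
      refine ⟨fun y => V.smul_mem _ (hadd y), fun y hy => ?_⟩
      rw [LinearMap.smul_apply, LinearMap.add_apply, LinearMap.id_apply, (hV y).1 hy]
      module
    have h1 := hproj.trace
    rw [map_smul, map_add, hRt, LinearMap.trace_id, finrank_euclideanSpace_fin,
      smul_eq_mul] at h1
    push_cast at h1
    linarith
  obtain ⟨p₀⟩ : Nonempty M := inferInstance
  have hφφ : ∀ p, ⟪(φ p : Euc (m + 2)), (φ p : Euc (m + 2))⟫_ℝ = 1 := by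
    intro p
    rw [real_inner_self_eq_norm_sq, norm_eq_of_mem_sphere, one_pow]
  have hφR : ∀ p, ⟪(φ p : Euc (m + 2)), R (φ p)⟫_ℝ = 0 := by
    intro p
    rw [hRφ, inner_smul_right, inner_tens hφ hb hc, mul_zero]
  have hRR1 : ∀ p, ⟪R (φ p), R (φ p)⟫_ℝ = 1 := fun p => by rw [hRs, hRR, hφφ]
  -- Each eigenspace contains a component of φ(p₀) and, orthogonal to it, one of a tangent vector.
  -- The latter can be chosen nonzero, as otherwise A would be scalar.
  have hdim : 2 ≤ Module.finrank ℝ V ∧ 2 ≤ Module.finrank ℝ Vᗮ := by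
    obtain ⟨e, N, B, f₀, h⟩ := exists_cmcChart hφ hb.1 hc isOpen_univ (Set.mem_univ p₀)
    have hf₀ : |f₀| = c := by rw [← h.norm_tens hφ h.mem, hn]
    have hsq : f₀ ^ 2 = c ^ 2 := by rw [← hf₀, sq_abs]
    have hf0 : f₀ ≠ 0 := by
      rintro rfl
      rw [abs_zero] at hf₀
      exact hc0.ne hf₀
    have hne : f₀ ^ 2 ≠ m ^ 2 := by rwa [hsq]
    have hns := h.patch.shape_not_scalar hne h.mem (h.mean _ h.mem)
      (h.patch.trace_shape_sq_of_const hf0 h.mean h.mem (h.bih _ h.mem))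
    obtain ⟨ν, hνdef⟩ : ∃ ν, ν = c⁻¹ * f₀ := ⟨_, rfl⟩
    have hν0 : ν ≠ 0 := by
      rw [hνdef]
      exact mul_ne_zero (inv_ne_zero hc0.ne') hf0
    have hX : ∀ u ∈ B, R (localRep φ e u) = ν • N u := by
      intro u hu
      have h1 := hRφ (e.symm u)
      rwa [h.tens_eq hφ hu, smul_smul, ← hνdef] at h1
    have hDX : ∀ v, R (dirD v (localRep φ e) (e p₀)) = ν • dirD v N (e p₀) := by
      intro v
      rw [← dirD_const_smul _ (h.patch.smoothN _ h.mem),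
        ← dirD_congr h.patch.isOpen h.mem hX v]
      have h1 := (R.toContinuousLinearMap.hasFDerivAt.comp (e p₀)
        (h.patch.smoothX _ h.mem).diffAt.hasFDerivAt).fderiv
      exact (congrArg (fun L => L v) h1).symm
    obtain ⟨X₀, hX₀⟩ : ∃ X₀, X₀ = localRep φ e (e p₀) := ⟨_, rfl⟩
    have hX₀φ : X₀ = (φ p₀ : Euc (m + 2)) := by rw [hX₀, localRep, h.symm_mem]
    have horth : ∀ v, ⟪X₀, dirD v (localRep φ e) (e p₀)⟫_ℝ = 0 ∧
        ⟪X₀, R (dirD v (localRep φ e) (e p₀))⟫_ℝ = 0 := by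
      intro v
      rw [hX₀, hDX, inner_smul_right, h.patch.inner_X_DN h.mem, mul_zero]
      exact ⟨h.patch.inner_X_DX h.mem v, rfl⟩
    have horth' : ∀ v, ⟪R X₀, dirD v (localRep φ e) (e p₀)⟫_ℝ = 0 ∧
        ⟪R X₀, R (dirD v (localRep φ e) (e p₀))⟫_ℝ = 0 := by
      intro v
      rw [hRs, hRs, hRR]
      exact ⟨(horth v).2, (horth v).1⟩
    have hne1 : X₀ + R X₀ ≠ 0 := by
      intro h0
      have h1 := congrArg (fun y => ⟪X₀, y⟫_ℝ) h0
      simp only [inner_add_right, inner_zero_right, hX₀φ, hφφ, hφR] at h1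
      norm_num at h1
    have hne2 : X₀ - R X₀ ≠ 0 := by
      intro h0
      have h1 := congrArg (fun y => ⟪X₀, y⟫_ℝ) h0
      simp only [inner_sub_right, inner_zero_right, hX₀φ, hφφ, hφR] at h1
      norm_num at h1
    obtain ⟨v, hv⟩ : ∃ v, dirD v (localRep φ e) (e p₀) + R (dirD v (localRep φ e) (e p₀)) ≠ 0 := by
      by_contra hall
      push Not at hall
      refine hns ν⁻¹ fun v => h.patch.DX_injective h.mem ?_
      have h1 := hall v
      rw [hDX, add_eq_zero_iff_eq_neg] at h1
      rw [h.patch.DX_shape h.mem, dirD_smul_dir, h1, smul_neg, inv_smul_smul₀ hν0]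
    obtain ⟨w, hw⟩ : ∃ v, dirD v (localRep φ e) (e p₀) - R (dirD v (localRep φ e) (e p₀)) ≠ 0 := by
      by_contra hall
      push Not at hall
      refine hns (-ν⁻¹) fun v => h.patch.DX_injective h.mem ?_
      have h1 := hall v
      rw [hDX, sub_eq_zero] at h1
      rw [h.patch.DX_shape h.mem, dirD_smul_dir, h1, neg_smul, inv_smul_smul₀ hν0]
    refine ⟨two_le_finrank_of_orthogonal (hadd X₀) (hadd _) hne1 hv ?_,
      two_le_finrank_of_orthogonal (hsub X₀) (hsub _) hne2 hw ?_⟩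
    · simp only [inner_add_left, inner_add_right, (horth v).1, (horth v).2, (horth' v).1,
        (horth' v).2, add_zero]
    · simp only [inner_sub_left, inner_sub_right, (horth w).1, (horth w).2, (horth' w).1,
        (horth' w).2, sub_zero]
  have hinner : ∀ p, ⟪R (φ p), (φ p : Euc (m + 2))⟫_ℝ = 0 := fun p => by
    rw [real_inner_comm, hφR]
  have hny : ∀ p, ⟪(1 / 2 : ℝ) • ((φ p : Euc (m + 2)) + R (φ p)),
      (1 / 2 : ℝ) • ((φ p : Euc (m + 2)) + R (φ p))⟫_ℝ = 1 / 2 := by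
    intro p
    simp only [inner_add_left, inner_add_right, inner_smul_left, inner_smul_right, hφφ, hRR1,
      hφR, hinner, conj_trivial]
    norm_num
  have hnz : ∀ p, ⟪(1 / 2 : ℝ) • ((φ p : Euc (m + 2)) - R (φ p)),
      (1 / 2 : ℝ) • ((φ p : Euc (m + 2)) - R (φ p))⟫_ℝ = 1 / 2 := by
    intro p
    simp only [inner_sub_left, inner_sub_right, inner_smul_left, inner_smul_right, hφφ, hRR1,
      hφR, hinner, conj_trivial]
    norm_num
  refine ⟨Module.finrank ℝ V - 1, Module.finrank ℝ Vᗮ - 1, by omega, by omega, by omega, ?_,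
    V, by omega, by omega, isOpenPartOf_of_normal hφ hb hc hc0 hn (fun p => ?_)
      fun p s t hs ht hst => ?_⟩
  · intro heq
    have h1 : Module.finrank ℝ V = Module.finrank ℝ Vᗮ := by omega
    rw [← h1] at hsum
    have h2 : (Module.finrank ℝ V : ℝ) + Module.finrank ℝ V = m + 2 := by exact_mod_cast hsum
    linarith
  · refine ⟨_, V.smul_mem (1 / 2) (hadd (φ p)), _, Vᗮ.smul_mem (1 / 2) (hsub (φ p)),
      (norm_eq_one_div_sqrt_two_iff _).2 (hny p), (norm_eq_one_div_sqrt_two_iff _).2 (hnz p), ?_⟩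
    module
  · obtain ⟨y, hy, z, hz, hny', hnz', hx⟩ := hst
    rw [norm_eq_one_div_sqrt_two_iff] at hny' hnz'
    rw [← hRφ p] at hx
    obtain ⟨P, hP⟩ : ∃ P, P = (1 / 2 : ℝ) • ((φ p : Euc (m + 2)) + R (φ p)) := ⟨_, rfl⟩
    obtain ⟨Q, hQ⟩ : ∃ Q, Q = (1 / 2 : ℝ) • ((φ p : Euc (m + 2)) - R (φ p)) := ⟨_, rfl⟩
    have hPV : P ∈ V := hP ▸ V.smul_mem _ (hadd _)
    have hQV : Q ∈ Vᗮ := hQ ▸ Vᗮ.smul_mem _ (hsub _)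
    have hnP := hny p
    have hnQ := hnz p
    rw [← hP] at hx hnP
    rw [← hQ] at hx hnQ
    -- Applying R changes the sign of the Vᗮ parts only, so sum and difference with `hx` separate
    -- the two components.
    have h1 := congrArg R hx
    simp only [map_add, map_smul, (hV _).1 hPV, (hV' _).1 hQV, (hV _).1 hy, (hV' _).1 hz] at h1
    have hyP : y = (1 + s) • P := by
      have h2 : (2 : ℝ) • y = (2 : ℝ) • ((1 + s) • P) := by
        have h3 : (2 : ℝ) • y = (y + z) + (y + -z) := by module
        rw [h3, ← hx, ← h1]
        module
      exact smul_right_injective _ (two_ne_zero) h2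
    have hzQ : z = (1 + t) • Q := by
      have h2 : (2 : ℝ) • z = (2 : ℝ) • ((1 + t) • Q) := by
        have h3 : (2 : ℝ) • z = (y + z) - (y + -z) := by module
        rw [h3, ← hx, ← h1]
        module
      exact smul_right_injective _ (two_ne_zero) h2
    constructor
    · apply eq_zero_of_sq_add_one hs
      rw [hyP, inner_smul_left, inner_smul_right, hnP, conj_trivial] at hny'
      linarith
    · apply eq_zero_of_sq_add_one ht
      rw [hzQ, inner_smul_left, inner_smul_right, hnQ, conj_trivial] at hnz'
      linarith

omit [IsManifold (𝓡 m) ∞ M] [ConnectedSpace M] in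
-- In dimension 0 the tension field is an empty sum, so a proper biharmonic map has m ≥ 1.
theorem IsProperBiharmonic.dim_ne_zero (hb : IsProperBiharmonic φ) : m ≠ 0 := by
  rintro rfl
  refine hb.2 fun e he u hu => ?_
  simp [tension, metricTrace]

end Manifolds

end Biharmonic
end

theorem mainTheorem1 {m : ℕ} {M : Type*} [TopologicalSpace M] [ConnectedSpace M]
    [ChartedSpace (Euc m) M] [IsManifold (𝓡 m) ∞ M]
    (φ : M → UnitSphere (m + 1))
    (himm : Biharmonic.IsImmersedHypersurface φ)
    (hbih : Biharmonic.IsProperBiharmonic φ)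
    (hcurv : Biharmonic.AtMostTwoPrincipalCurvatures φ) :
    (∃ v : Euc (m + 2), ‖v‖ = 1 ∧
      Biharmonic.IsOpenPartOf φ (Biharmonic.smallHypersphere v)) ∨
    (∃ m₁ m₂ : ℕ, 1 ≤ m₁ ∧ 1 ≤ m₂ ∧ m₁ + m₂ = m ∧ m₁ ≠ m₂ ∧
      ∃ V : Submodule ℝ (Euc (m + 2)),
        Module.finrank ℝ V = m₁ + 1 ∧ Module.finrank ℝ Vᗮ = m₂ + 1 ∧
        Biharmonic.IsOpenPartOf φ (Biharmonic.cliffordTorus V)) := by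
  have hm := Biharmonic.IsProperBiharmonic.dim_ne_zero hbih
  obtain ⟨c, hc0, hn⟩ := Biharmonic.exists_norm_tens_eq himm hbih hcurv
  by_cases hcm : c ^ 2 = (m : ℝ) ^ 2
  · left
    have hc : c = m := (pow_left_inj₀ hc0.le (Nat.cast_nonneg m) two_ne_zero).1 hcm
    exact Biharmonic.isOpenPartOf_smallHypersphere himm hbih hcurv hm (hc ▸ hn)
  · right
    exact Biharmonic.isOpenPartOf_cliffordTorus himm hbih hcurv hm hc0 hcm hn
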